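/- \textbf{Conventions.} Graphs are finite and non-empty; $g\sqcap h$ means that $g,h$ are equal or adjacent. A vertex of degree at most $1$ is an end, and $\mathsf E G$ is the set of ends of $G$. A (nontrivial) graph fan $F$ is a tree with exactly one vertex $0_F$ of degree at least $3$ (its root); its spokes are the subpaths from $0_F$ to an end of $F$. A relation ${\sqsupset}\subseteq H\times G$ is regarded as going from $G$ to $H$; write $S^{\sqsubset}=\{h:\exists g\in S,\ h\sqsupset g\}$ and $C^{\sqsupset}=\{g:\exists h\in C,\ h\sqsupset g\}$. It is edge-preserving if $h\sqsupset g\sqcap g'\sqsubset h'$ implies $h\sqcap h'$; co-surjective if every $g\in G$ satisfies $\{g\}^{\sqsubset}\neq\emptyset$; co-injective if for every $h\in H$ some $g\in G$ satisfies $\{g\}^{\sqsubset}=\{h\}$; co-bijective if it is both; monotone if $C^{\sqsupset}$ is connected for every connected $C\subseteq H$ (the empty set counts as connected). A sequence $(G_n,\sqsupset^m_n)_{m\le n}$ consists of graphs $G_n$ and edge-preserving co-surjective relations ${\sqsupset^m_n}\subseteq G_m\times G_n$ with $\sqsupset^n_n$ the identity and ${\sqsupset^l_m}\circ{\sqsupset^m_n}={\sqsupset^l_n}$.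 It is in $\mathbf L$ if every $G_n$ is a graph fan, every $\sqsupset^m_n$ is co-bijective, $\{0_{G_n}\}^{\sqsubset^m_n}=\{0_{G_m}\}$, and for every spoke $S$ of $G_n$ there is a spoke $T$ of $G_m$ with $S^{\sqsubset^m_n}\subseteq T$ and ${\sqsupset^m_n}\restriction T\times S$ monotone. It is in $\mathbf X$ if moreover $(\mathsf EG_n)^{\sqsubset^m_n}\subseteq\mathsf EG_m$ for all $m\le n$. It is in $\mathbf D$ if every $G_n$ has no edges between distinct vertices and every $\sqsupset^m_n$ is co-bijective. An upper restriction is a family of non-empty $H_n\subseteq G_n$ with $H_n^{\sqsubset^m_n}\subseteq H_m$ for $m\le n$, with the induced subgraphs and restricted relations. The induced poset $\mathbb P$ is $\bigsqcup_n G_n$, with $p\le q$ iff $q\sqsupset^m_n p$ for $p\in G_n$, $q\in G_m$, $m\le n$. In a poset, a band is a finite set $B$ such that every element is comparable with some member of $B$; a cap is a set $C$ such that for some band $B$ every $b\in B$ lies below some $c\in C$; a selector is a set meeting every cap. The spectrum $\mathsf S\mathbb P$ is the set of minimal selectors with the topology generated by the sets $\{S: p\in S\}$, $p\in\mathbb P$;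 the spectrum of a sequence is that of its induced poset. A thread is $(t_n)\in\prod G_n$ with $t_m\sqsupset^m_n t_n$ for $m\le n$; $(t_n)^{\le}$ is the upward closure of $\{t_n:n\}$ in $\mathbb P$. A branch of spokes of a sequence in $\mathbf L$ is $\bar S=(S_n)$ such that for some $n_0$: for $n\ge n_0$, $S_n$ is a spoke of $G_n$ and $\{0_{G_n}\}\subsetneq S_{n+1}{}^{\sqsubset^n_{n+1}}\subseteq S_n$; and for $m<n_0$, $S_m=\{0_{G_m}\}=S_{n_0}{}^{\sqsubset^m_{n_0}}$. Its surjective core is the upper restriction $T_n=\bigcap_{k\ge n}S_k{}^{\sqsubset^n_k}$, with induced poset $\mathbb Q_{\bar S}$. The branch is nondegenerate if $\mathsf S\mathbb Q_{\bar S}$ is not a singleton. A co-bijective modification of $(T_n)$ is a family $H_n\subseteq T_n$ that is pointwise-inclusion minimal among the families such that for every $n$ there is $k\ge n$ with $H_n{}^{\sqsupset^n_k}\supseteq T_k$, and such that all restricted relations ${\sqsupset^m_n}\restriction H_m\times H_n$ are co-surjective, and for which these restricted relations moreover form a sequence. An arc is a homeomorphic copy of $[0,1]$. A dendroid is a non-empty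 compact connected metrizable space $X$ in which any two distinct points are the endpoints of an arc and in which the intersection of any two subcontinua is connected (possibly empty). A point is an endpoint of $X$ if it is an endpoint of every arc in $X$ containing it; $\mathsf EX$ is the set of endpoints. A point $x$ is a ramification point if there are three arcs in $X$ any two of which intersect exactly in $\{x\}$. A topological fan with root $r$ is a dendroid whose only ramification point is $r$; its spokes are the arcs in $X$ with endpoints $r$ and $e$, for $e\in\mathsf EX$. \textbf{Proposition.} Let $(G_n,\sqsupset^m_n)$ be a sequence in $\mathbf L$ with spectrum $X$, and suppose that $X$ is connected and Hausdorff. Then: (1) $\bar 0=\{0_{G_n}:n\in\omega\}$ is a point of $X$, and $X$ is a topological fan with root $\bar 0$. (2) For every nondegenerate branch of spokes $\bar S$, $\mathsf S\mathbb Q_{\bar S}$ is a closed subspace of $X$, and $\bar S\mapsto\mathsf S\mathbb Q_{\bar S}$ is a bijection from the nondegenerate branches of spokes onto the spokes of $X$. Moreover, for each such $\bar S$, the surjective core has a unique co-bijective modification $(H_n)$; there is a unique thread $(e_n)$ of the core, different from $(0_{G_n})$, such that each $e_n$ is an end of $H_n$; the set $(e_n)^{\le}$ is a point of $\mathsf EX\cap\mathsf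 S\mathbb Q_{\bar S}$; and $\mathsf S\mathbb Q_{\bar S}$ is an arc with endpoints $\bar 0$ and $(e_n)^{\le}$. (3) If in addition the sequence is in $\mathbf X$, then the upper restriction to $(\mathsf EG_n)$ is a sequence in $\mathbf D$, the spectrum of its induced poset is a closed subspace of $X$, and this subspace equals $\mathsf EX$. -/

import Mathlib

open Set Topology

universe u

namespace FanSpectra

/-! ### The spectrum of a poset -/

section Poset

variable {P : Type u} [PartialOrder P]

/-- A band: a finite set such that every element of the poset is comparable to one of its
members. -/
def IsBand (B : Set P) : Prop :=
  B.Finite ∧ ∀ p, ∃ b ∈ B, b ≤ p ∨ p ≤ b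

/-- A cap: a set refined by a band. -/
def IsCap (C : Set P) : Prop :=
  ∃ B : Set P, IsBand B ∧ ∀ b ∈ B, ∃ c ∈ C, b ≤ c

/-- A selector: a set that meets every cap. -/
def IsSelector (S : Set P) : Prop :=
  ∀ C : Set P, IsCap C → (S ∩ C).Nonempty

variable (P) in
/-- The spectrum of a poset: its minimal selectors. -/
def Spectrum : Type u :=
  {S : Set P // Minimal IsSelector S}

/-- The subbasic open sets are the sets of all minimal selectors containing a given `p`. -/
instance : TopologicalSpace (Spectrum P) :=
  TopologicalSpace.generateFrom {U | ∃ p : P, U = {S : Spectrum P | p ∈ S.1}}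

end Poset

/-! ### Topological fans -/

section Topological

variable {X : Type u} [TopologicalSpace X]

/-- `A` is an arc with endpoints `a` and `b`. -/
def IsArcBetween (A : Set X) (a b : X) : Prop :=
  ∃ f : unitInterval → X, IsEmbedding f ∧ range f = A ∧ f 0 = a ∧ f 1 = b

def IsArc (A : Set X) : Prop :=
  ∃ a b, IsArcBetween A a b

/-- `x` is an endpoint of every arc that contains it. -/
def IsEndpoint (x : X) : Prop :=
  ∀ (A : Set X) (a b : X), IsArcBetween A a b → x ∈ A → x = a ∨ x = b

/-- There are three arcs any two of which meet exactly in `x`. -/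
def IsRamificationPoint (x : X) : Prop :=
  ∃ A : Fin 3 → Set X, (∀ i, IsArc (A i)) ∧ ∀ i j, i ≠ j → A i ∩ A j = {x}

variable (X) in
/-- A dendroid: a non-empty compact connected metrizable space that is arcwise connected and
hereditarily unicoherent. -/
structure IsDendroid : Prop where
  connected : ConnectedSpace X
  compact : CompactSpace X
  metrizable : TopologicalSpace.MetrizableSpace X
  arcwise : ∀ x y : X, x ≠ y → ∃ A : Set X, IsArcBetween A x y
  unicoherent : ∀ C D : Set X, IsCompact C → IsConnected C → IsCompact D → IsConnected D →
    IsPreconnected (C ∩ D)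

variable (X) in
/-- A fan with root `r`: a dendroid whose only ramification point is `r`. -/
def IsFanWithRoot (r : X) : Prop :=
  IsDendroid X ∧ ∀ x : X, IsRamificationPoint x ↔ x = r

/-- The spokes of a fan with root `r`: the arcs from `r` to an endpoint. -/
def spokesFrom (r : X) : Set (Set X) :=
  {A | ∃ e : X, IsEndpoint e ∧ IsArcBetween A r e}

end Topological

/-! ### Graphs and relations -/

section Graph

variable {V W : Type u}

/-- The reflexive edge relation of a graph. -/
def Edge (G : SimpleGraph V) (a b : V) : Prop :=
  a = b ∨ G.Adj a b

/-- The ends of a graph: the vertices of degree at most one. -/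
def endSet (G : SimpleGraph V) : Set V :=
  {v | (G.neighborSet v).ncard ≤ 1}

/-- A (nontrivial) fan with root `r`: a tree in which `r` is the only vertex of degree at
least three. -/
def IsGraphFan (G : SimpleGraph V) (r : V) : Prop :=
  G.IsTree ∧ ∀ v, 3 ≤ (G.neighborSet v).ncard ↔ v = r

/-- The spokes of a fan with root `r`: the vertex sets of the paths from `r` to an end. -/
def graphSpokes (G : SimpleGraph V) (r : V) : Set (Set V) :=
  {S | ∃ e ∈ endSet G, ∃ p : G.Walk r e, p.IsPath ∧ S = {v | v ∈ p.support}}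

/-- The image `S^⊏` of a set under a relation `R ⊆ W × V`, viewed as going from `V` to `W`. -/
def relImage (R : W → V → Prop) (S : Set V) : Set W :=
  {a | ∃ b ∈ S, R a b}

/-- No vertex set splits into two non-empty parts without edges between them; the empty set is
connected in this sense. -/
def IsConnectedSet (G : SimpleGraph V) (C : Set V) : Prop :=
  (G.induce C).Preconnected

/-- The restriction of `R ⊆ W × V` to `T × S` is monotone: preimages of connected sets are
connected. -/
def IsMonotoneBetween (H : SimpleGraph W) (G : SimpleGraph V) (R : W → V → Prop)
    (T : Set W) (S : Set V) : Prop :=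
  ∀ C ⊆ T, IsConnectedSet H C → IsConnectedSet G {b ∈ S | ∃ a ∈ C, R a b}

/-- Co-injective: every `a` is the only element related to some `b`. -/
def IsCoInjective (R : W → V → Prop) : Prop :=
  ∀ a, ∃ b, ∀ a', R a' b ↔ a' = a

/-- Spoke-monotone relations from a fan `G` with root `r` to a fan `H` with root `s`. -/
def IsSpokeMonotone (H : SimpleGraph W) (s : W) (G : SimpleGraph V) (r : V)
    (R : W → V → Prop) : Prop :=
  (∀ a, R a r ↔ a = s) ∧
  ∀ S ∈ graphSpokes G r, ∃ T ∈ graphSpokes H s,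
    relImage R S ⊆ T ∧ IsMonotoneBetween H G R T S

end Graph

/-! ### Sequences of graphs -/

/-- A sequence of non-empty finite graphs and co-surjective edge-preserving relations
`rel : G m ⊐ G n` for `m ≤ n`, functorial in the index. -/
structure GraphSeq where
  V : ℕ → Type u
  graph : ∀ n, SimpleGraph (V n)
  rel : ∀ {m n : ℕ}, m ≤ n → V m → V n → Prop
  finite : ∀ n, Finite (V n)
  nonempty : ∀ n, Nonempty (V n)
  edge_preserving : ∀ {m n : ℕ} (h : m ≤ n) {a a' : V m} {b b' : V n},
    rel h a b → rel h a' b' → Edge (graph n) b b' → Edge (graph m) a a'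
  coSurjective : ∀ {m n : ℕ} (h : m ≤ n) (b : V n), ∃ a, rel h a b
  rel_self : ∀ {n : ℕ} (a b : V n), rel le_rfl a b ↔ a = b
  rel_trans : ∀ {l m n : ℕ} (h : l ≤ m) (h' : m ≤ n) (a : V l) (c : V n),
    rel (h.trans h') a c ↔ ∃ b, rel h a b ∧ rel h' b c

namespace GraphSeq

variable (A : GraphSeq.{u})

/-- The induced poset: the disjoint union of the graphs, lower elements having larger index. -/
def InducedPoset : Type u := Σ n, A.V n

instance : PartialOrder A.InducedPoset where
  le p q := ∃ h : q.1 ≤ p.1, A.rel h q.2 p.2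
  le_refl p := ⟨le_rfl, (A.rel_self _ _).2 rfl⟩
  le_trans p q r := fun ⟨h, hr⟩ ⟨h', hr'⟩ => ⟨h'.trans h, (A.rel_trans h' h _ _).2 ⟨_, hr', hr⟩⟩
  le_antisymm := by
    rintro ⟨n, a⟩ ⟨m, b⟩ ⟨h, hr⟩ ⟨h', hr'⟩
    obtain rfl : n = m := le_antisymm h' h
    have : a = b := (A.rel_self _ _).1 hr'
    rw [this]

/-- The spectrum of the sequence. -/
abbrev Spec : Type u := Spectrum A.InducedPoset

/-- A thread of the sequence. -/
def IsThread (t : ∀ n, A.V n) : Prop :=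
  ∀ (m n : ℕ) (h : m ≤ n), A.rel h (t m) (t n)

/-- The upward closure of a sequence of vertices in the induced poset. -/
def upClosure (t : ∀ n, A.V n) : Set A.InducedPoset :=
  {p | ∃ q : A.InducedPoset, q.2 = t q.1 ∧ q ≤ p}

/-- A family of non-empty vertex sets that induces an upper restriction. -/
structure IsUpperRestriction (H : ∀ n, Set (A.V n)) : Prop where
  nonempty : ∀ n, (H n).Nonempty
  upper : ∀ (m n : ℕ) (h : m ≤ n), relImage (A.rel h) (H n) ⊆ H m

/-- The upper restriction to a family of vertex sets, with the induced subgraphs and the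
restricted relations. -/
def restrict (H : ∀ n, Set (A.V n)) (hH : A.IsUpperRestriction H) : GraphSeq.{u} where
  V n := ↥(H n)
  graph n := (A.graph n).induce (H n)
  rel h a b := A.rel h a.1 b.1
  finite n := by
    have := A.finite n
    infer_instance
  nonempty n := (hH.nonempty n).to_subtype
  edge_preserving := by
    intro m n h a a' b b' hab hab' hb
    have : Edge (A.graph n) b.1 b'.1 := hb.imp (congrArg Subtype.val) id
    exact (A.edge_preserving h hab hab' this).imp (fun e => Subtype.ext e) id
  coSurjective := by
    intro m n h b
    obtain ⟨a, ha⟩ := A.coSurjective h b.1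
    exact ⟨⟨a, hH.upper m n h ⟨b.1, b.2, ha⟩⟩, ha⟩
  rel_self := by
    intro n a b
    rw [A.rel_self, Subtype.ext_iff]
  rel_trans := by
    intro l m n h h' a c
    rw [A.rel_trans h h']
    constructor
    · rintro ⟨b, h1, h2⟩
      exact ⟨⟨b, hH.upper m n h' ⟨c.1, c.2, h2⟩⟩, h1, h2⟩
    · rintro ⟨b, h1, h2⟩
      exact ⟨b.1, h1, h2⟩

/-- The inclusion of the induced poset of an upper restriction. -/
def incl (H : ∀ n, Set (A.V n)) (hH : A.IsUpperRestriction H) :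
    (A.restrict H hH).InducedPoset → A.InducedPoset :=
  fun p => ⟨p.1, p.2.1⟩

/-- The part of the spectrum of the sequence formed by the minimal selectors of the poset
induced by an upper restriction. -/
def subSpec (H : ∀ n, Set (A.V n)) (hH : A.IsUpperRestriction H) : Set A.Spec :=
  {x | ∃ s : (A.restrict H hH).Spec, x.1 = A.incl H hH '' s.1}

/-- Every minimal selector of the poset induced by the restriction is a minimal selector of the
whole induced poset, and this inclusion is a homeomorphism onto a closed subspace. -/
def IsClosedSubSpec (H : ∀ n, Set (A.V n)) (hH : A.IsUpperRestriction H) : Prop :=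
  ∃ f : (A.restrict H hH).Spec → A.Spec,
    IsClosedEmbedding f ∧ ∀ s, (f s).1 = A.incl H hH '' s.1

/-- A dense co-surjective lax-restriction. -/
def IsDenseLaxRestriction (H : ∀ n, Set (A.V n)) : Prop :=
  (∀ n, ∃ k, ∃ h : n ≤ k, ∀ x : A.V k, ∃ y ∈ H n, A.rel h y x) ∧
  ∀ (m n : ℕ) (h : m ≤ n), ∀ x ∈ H n, ∃ y ∈ H m, A.rel h y x

/-- A co-bijective modification: a minimal dense co-surjective lax-restriction whose restricted
relations form a sequence, i.e. are closed under composition without loss. -/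
def IsCoBijectiveModification (H : ∀ n, Set (A.V n)) : Prop :=
  Minimal A.IsDenseLaxRestriction H ∧
  ∀ (l m n : ℕ) (h : l ≤ m) (h' : m ≤ n), ∀ a ∈ H l, ∀ c ∈ H n,
    A.rel (h.trans h') a c → ∃ b ∈ H m, A.rel h a b ∧ A.rel h' b c

/-- Sequences of discrete graphs and co-bijective relations. -/
def IsInD : Prop :=
  (∀ n, A.graph n = ⊥) ∧ ∀ (m n : ℕ) (h : m ≤ n), IsCoInjective (A.rel h)

end GraphSeq

/-- A sequence of nontrivial fans and spoke-monotone co-bijective edge-preserving relations. -/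
structure LSeq extends GraphSeq.{u} where
  root : ∀ n, V n
  isFan : ∀ n, IsGraphFan (graph n) (root n)
  coInjective : ∀ {m n : ℕ} (h : m ≤ n), IsCoInjective (rel h)
  spokeMonotone : ∀ {m n : ℕ} (h : m ≤ n),
    IsSpokeMonotone (graph m) (root m) (graph n) (root n) (rel h)

namespace LSeq

variable (A : LSeq.{u})

/-- All relations are end-preserving. -/
def IsInX : Prop :=
  ∀ (m n : ℕ) (h : m ≤ n), relImage (A.rel h) (endSet (A.graph n)) ⊆ endSet (A.graph m)

/-- The spokes of the `n`-th fan. -/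
def spokes (n : ℕ) : Set (Set (A.V n)) := graphSpokes (A.graph n) (A.root n)

/-- The thread of roots, as a subset of the induced poset. -/
def rootThread : Set A.InducedPoset := range fun n => ⟨n, A.root n⟩

/-- Branches of spokes: from some index `n₀` on, a sequence of spokes each of which is an
immediate successor of the preceding one, and the root before `n₀`, where the spoke with index
`n₀` is collapsed to the root. -/
structure Branch where
  S : ∀ n, Set (A.V n)
  isBranch : ∃ n₀,
    (∀ n, n₀ ≤ n → S n ∈ A.spokes n ∧
      {A.root n} ⊂ relImage (A.rel n.le_succ) (S (n + 1)) ∧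
      relImage (A.rel n.le_succ) (S (n + 1)) ⊆ S n) ∧
    ∀ m (h : m < n₀), S m = {A.root m} ∧ relImage (A.rel h.le) (S n₀) = {A.root m}

theorem root_mem_of_spoke {n : ℕ} {S : Set (A.V n)} (h : S ∈ A.spokes n) : A.root n ∈ S := by
  obtain ⟨e, -, p, -, rfl⟩ := h
  exact p.start_mem_support

namespace Branch

variable {A} (b : A.Branch)

theorem root_mem (n : ℕ) : A.root n ∈ b.S n := by
  obtain ⟨n₀, h1, h2⟩ := b.isBranch
  rcases le_or_gt n₀ n with h | h
  · exact A.root_mem_of_spoke (h1 n h).1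
  · rw [(h2 n h).1]
    rfl

theorem relImage_subset (m n : ℕ) (h : m ≤ n) : relImage (A.rel h) (b.S n) ⊆ b.S m := by
  obtain ⟨n₀, h1, h2⟩ := b.isBranch
  have key : ∀ m, n₀ ≤ m → ∀ k (h : m ≤ m + k),
      relImage (A.rel h) (b.S (m + k)) ⊆ b.S m := by
    intro m hm k
    induction k with
    | zero =>
      rintro h a ⟨c, hc, hac⟩
      rw [(A.rel_self _ _).1 hac]
      exact hc
    | succ k ih =>
      rintro h a ⟨c, hc, hac⟩
      obtain ⟨d, had, hdc⟩ := (A.rel_trans (Nat.le_add_right m k) (Nat.le_succ (m + k)) a c).1 hac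
      exact ih (Nat.le_add_right m k)
        ⟨d, (h1 (m + k) (by omega)).2.2 ⟨c, hc, hdc⟩, had⟩
  rcases le_or_gt n₀ m with hm | hm
  · obtain ⟨k, rfl⟩ := Nat.exists_eq_add_of_le h
    exact key m hm k h
  · rintro a ⟨c, hc, hac⟩
    rcases le_or_gt n₀ n with hn | hn
    · obtain ⟨d, had, hdc⟩ := (A.rel_trans hm.le hn a c).1 hac
      obtain ⟨k, rfl⟩ := Nat.exists_eq_add_of_le hn
      have hd := key n₀ le_rfl k hn ⟨c, hc, hdc⟩
      rw [(h2 m hm).1, ← (h2 m hm).2]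
      exact ⟨d, hd, had⟩
    · rw [(h2 n hn).1] at hc
      rw [show c = A.root n from hc] at hac
      rw [(h2 m hm).1]
      exact ((A.spokeMonotone h).1 a).1 hac

/-- The surjective core of a branch of spokes. -/
def core (n : ℕ) : Set (A.V n) :=
  {a | ∀ k (h : n ≤ k), a ∈ relImage (A.rel h) (b.S k)}

theorem core_isUpperRestriction : A.IsUpperRestriction b.core where
  nonempty n := ⟨A.root n, fun k h =>
    ⟨A.root k, b.root_mem k, ((A.spokeMonotone h).1 _).2 rfl⟩⟩
  upper := by
    rintro m n h a ⟨c, hc, hac⟩ k hk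
    rcases le_total n k with hn | hn
    · obtain ⟨d, hd, hcd⟩ := hc k hn
      exact ⟨d, hd, (A.rel_trans h hn a d).2 ⟨c, hac, hcd⟩⟩
    · obtain ⟨d, had, hdc⟩ := (A.rel_trans hk hn a c).1 hac
      obtain ⟨c', hc', hcc'⟩ := hc n le_rfl
      rw [← (A.rel_self c c').1 hcc'] at hc'
      exact ⟨d, b.relImage_subset k n hn ⟨c, hc', hdc⟩, had⟩

/-- The surjective core as a sequence. -/
def coreSeq : GraphSeq.{u} := A.restrict b.core b.core_isUpperRestriction

/-- The spectrum of the surjective core is not a singleton. -/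
def Nondegenerate : Prop := ¬ ∃ x : b.coreSeq.Spec, ∀ y, y = x

/-- The spectrum of the surjective core as a subset of the spectrum of the whole sequence. -/
def subSpec : Set A.Spec := A.toGraphSeq.subSpec b.core b.core_isUpperRestriction

/-- `e` is a thread of ends, different from the thread of roots, of a co-bijective modification
of the surjective core. -/
def IsEndThread (e : ∀ n, b.coreSeq.V n) : Prop :=
  ∃ H, b.coreSeq.IsCoBijectiveModification H ∧ b.coreSeq.IsThread e ∧
    (∀ n, ∃ h : e n ∈ H n, (⟨e n, h⟩ : ↥(H n)) ∈ endSet ((b.coreSeq.graph n).induce (H n))) ∧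
    ∃ n, (e n).1 ≠ A.root n

end Branch

theorem ends_isUpperRestriction (hA : A.IsInX) :
    A.IsUpperRestriction fun n => endSet (A.graph n) where
  nonempty n := by
    classical
    have := A.finite n
    have := Fintype.ofFinite (A.V n)
    have hr : 3 ≤ ((A.graph n).neighborSet (A.root n)).ncard := ((A.isFan n).2 _).2 rfl
    have : Nontrivial (A.V n) := by
      obtain ⟨v, hv⟩ := Set.nonempty_of_ncard_ne_zero (s := (A.graph n).neighborSet (A.root n))
        (by omega)
      exact ⟨A.root n, v, hv.ne⟩
    obtain ⟨v, hv⟩ := (A.isFan n).1.exists_vert_degree_one_of_nontrivial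
    refine ⟨v, ?_⟩
    change ((A.graph n).neighborSet v).ncard ≤ 1
    rw [Set.ncard_eq_toFinset_card', Set.toFinset_card,
      SimpleGraph.card_neighborSet_eq_degree, hv]
  upper := hA

/-- The sequence of the sets of ends. -/
def endSeq (hA : A.IsInX) : GraphSeq.{u} :=
  A.restrict (fun n => endSet (A.graph n)) (A.ends_isUpperRestriction hA)

end LSeq

end FanSpectra

open FanSpectra

/-! Co-injectivity makes the relations surjective, so the caps are exactly the sets refined by some
level (`isCap_iff`), and the points of the spectrum are the minimal upper sets meeting every level
(`minimal_isSelector_iff`). The levels of a point are finite sets of pairwise related vertices, and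
each vertex of a point lies above all its vertices of large index (`eventually_rel_of_mem_level`).
They thus serve as shrinking neighbourhoods, and König's lemma produces points from upper families
of vertices.

If the spectrum is connected, every edge is witnessed by a point. With the Hausdorff property,
distinct points therefore have unrelated vertices at all late levels (`eventually_not_edge`), and
disjoint closed sets are separated by chains of fixed length in a single graph. Consequently upper
families of connected vertex sets define connected sets of points
(`isPreconnected_of_isUpperFamily`). Since traces of continua are connected in trees, intersections
of continua are connected.

A point other than the root point eventually avoids the roots, so its vertices single out one spoke
at each late level and hence exactly one branch. The relations respect the order along spokes
(`exists_rel_of_depth_le`), so the points of a branch are linearly ordered by depth, through the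
open relation `Before`. A compact metrizable space with a closed linear order embeds in the line;
being connected, a branch with more than one point is an arc from the root point to its last point.
Distinct branches meet only in the root point. A continuum contains everything between two of its
points on a branch, and contains the root point if it leaves the branch through one of its points.
This identifies ramification points, endpoints and spokes.

The co-bijective modification consists of the vertices that are the sole vertex of some point of the
branch at their level. Every dense lax restriction contains these vertices, and they form such a
restriction themselves, hence the least one. Connectedness of the branch makes them initial in its
trace (`mem_witnessed_of_depth_lt`). Their deepest members form the end thread, whose upward closure
is the last point. For end-preserving relations, a point consisting of ends has nothing after it on
its branch, and each nondegenerate branch contains such a point. -/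

namespace FanSpectra

/-! ### The spectrum of a sequence with surjective relations -/

namespace GraphSeq

section Konig

variable {V : ℕ → Type u} [∀ n, Finite (V n)]

/-- König's lemma for non-empty finite sets and compatible bonding maps. -/
theorem exists_compatible_sequence (f : ∀ n, V (n + 1) → V n) (B : ∀ n, Set (V n))
    (hne : ∀ n, (B n).Nonempty) (hB : ∀ n, ∀ v ∈ B (n + 1), f n v ∈ B n) :
    ∃ t : ∀ n, V n, (∀ n, t n ∈ B n) ∧ ∀ n, f n (t (n + 1)) = t n := by
  let D (n : ℕ) : Type u := B n
  have hfin : ∀ n, Finite (D n) := fun n => inferInstanceAs (Finite (B n))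
  have hnon : ∀ n, Nonempty (D n) := fun n => (hne n).to_subtype
  let F : CategoryTheory.Functor ℕᵒᵖ (Type u) := CategoryTheory.Functor.ofOpSequence (X := D)
    (fun n => TypeCat.ofHom (fun v : D (n + 1) => (⟨f n v.1, hB n v.1 v.2⟩ : D n)))
  have h1 : ∀ j, Finite (F.obj j) := fun j => hfin j.unop
  have h2 : ∀ j, Nonempty (F.obj j) := fun j => hnon j.unop
  obtain ⟨s, hs⟩ := nonempty_sections_of_finite_inverse_system F
  have key : ∀ n : ℕ, f n (s (Opposite.op (n + 1)) : D (n + 1)).1 = (s (Opposite.op n) : D n).1 := by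
    intro n
    have := hs (CategoryTheory.homOfLE (Nat.le_succ n)).op
    rw [← this]
    simp only [F, CategoryTheory.Functor.ofOpSequence_map_homOfLE_succ]
    rfl
  exact ⟨fun n => (s (Opposite.op n) : D n).1, fun n => (s (Opposite.op n) : D n).2, key⟩

end Konig

variable (A : GraphSeq.{u})

/-- Every vertex is related to a vertex at every later index. -/
def IsSurjective : Prop :=
  ∀ {m n : ℕ} (h : m ≤ n) (a : A.V m), ∃ b, A.rel h a b

variable {A}

/-- A vertex of the `n`-th graph as an element of the induced poset. -/
def vert (n : ℕ) (v : A.V n) : A.InducedPoset := ⟨n, v⟩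

/-- The vertices of the `n`-th graph that belong to a subset of the induced poset. -/
def level (S : Set A.InducedPoset) (n : ℕ) : Set (A.V n) :=
  {v | vert n v ∈ S}

/-- A family of vertex sets that is closed under passing to related vertices at lower indices. -/
def IsUpperFamily (B : ∀ n, Set (A.V n)) : Prop :=
  ∀ {m n : ℕ} (h : m ≤ n) {a : A.V m} {b : A.V n}, A.rel h a b → b ∈ B n → a ∈ B m

theorem isThread_of_rel_succ {t : ∀ n, A.V n}
    (ht : ∀ n, A.rel (Nat.le_succ n) (t n) (t (n + 1))) : A.IsThread t := by
  intro m n h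
  induction n, h using Nat.le_induction with
  | base => exact (A.rel_self _ _).2 rfl
  | succ n h ih => exact (A.rel_trans h (Nat.le_succ n) _ _).2 ⟨t n, ih, ht n⟩

/-- König's lemma for relations: sets of vertices closed under the relations between consecutive
indices contain a thread. -/
theorem exists_thread (B : ∀ n, Set (A.V n)) (hne : ∀ n, (B n).Nonempty)
    (hB : IsUpperFamily B) : ∃ t, A.IsThread t ∧ ∀ n, t n ∈ B n := by
  have := A.finite
  choose f hf using fun n => A.coSurjective (Nat.le_succ n)
  obtain ⟨t, htB, ht⟩ := exists_compatible_sequence f B hne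
    fun n v hv => hB (Nat.le_succ n) (hf n v) hv
  refine ⟨t, isThread_of_rel_succ fun n => ?_, htB⟩
  have := hf n (t (n + 1))
  rwa [ht n] at this

/-- The induced poset has only countably many elements. -/
theorem countable_inducedPoset : Countable A.InducedPoset := by
  have : ∀ n, Countable (A.V n) := fun n => by have := A.finite n; infer_instance
  exact inferInstanceAs (Countable (Σ n, A.V n))

theorem isBand_level (hA : A.IsSurjective) (n : ℕ) :
    IsBand (range fun v : A.V n => vert n v) := by
  have := A.finite n
  refine ⟨finite_range _, fun ⟨k, v⟩ => ?_⟩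
  rcases le_total n k with h | h
  · obtain ⟨a, ha⟩ := A.coSurjective h v
    exact ⟨_, ⟨a, rfl⟩, Or.inr ⟨h, ha⟩⟩
  · obtain ⟨b, hb⟩ := hA h v
    exact ⟨_, ⟨b, rfl⟩, Or.inl ⟨h, hb⟩⟩

/-- A band is finite, so it lives at bounded indices. A vertex of larger index can be comparable
with a member of it only by lying below. -/
theorem isCap_iff (hA : A.IsSurjective) {C : Set A.InducedPoset} :
    IsCap C ↔ ∃ n, ∀ v : A.V n, ∃ c ∈ C, vert n v ≤ c := by
  constructor
  · rintro ⟨B, ⟨hfin, hB⟩, hBC⟩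
    obtain ⟨N, hN⟩ := (hfin.image Sigma.fst).bddAbove
    refine ⟨N + 1, fun v => ?_⟩
    obtain ⟨b, hb, hbv | hbv⟩ := hB (vert (N + 1) v)
    · obtain ⟨h, -⟩ := hbv
      have h1 : b.1 ≤ N := hN ⟨b, hb, rfl⟩
      have h2 : N + 1 ≤ b.1 := h
      omega
    · obtain ⟨c, hc, hbc⟩ := hBC b hb
      exact ⟨c, hc, hbv.trans hbc⟩
  · rintro ⟨n, h⟩
    exact ⟨_, isBand_level hA n, by rintro _ ⟨v, rfl⟩; exact h v⟩

/-- A selector is a set whose complement is not a cap; the rest is `isCap_iff`. -/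
theorem isSelector_iff (hA : A.IsSurjective) {S : Set A.InducedPoset} :
    IsSelector S ↔ ∀ n, ∃ v : A.V n, ∀ q, vert n v ≤ q → q ∈ S := by
  constructor
  · intro hS
    by_contra! hcon
    obtain ⟨n, hn⟩ := hcon
    have hc : IsCap Sᶜ := (isCap_iff hA).2 ⟨n, fun v => by
      obtain ⟨q, hq, hqS⟩ := hn v
      exact ⟨q, hqS, hq⟩⟩
    obtain ⟨q, hq, hq'⟩ := hS _ hc
    exact hq' hq
  · intro h C hC
    obtain ⟨n, hn⟩ := (isCap_iff hA).1 hC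
    obtain ⟨v, hv⟩ := h n
    obtain ⟨c, hc, hvc⟩ := hn v
    exact ⟨c, hv c hvc, hc⟩

theorem isSelector_of_upper (hA : A.IsSurjective) {S : Set A.InducedPoset} (hS : IsUpperSet S)
    (hne : ∀ n, (level S n).Nonempty) : IsSelector S :=
  (isSelector_iff hA).2 fun n => by
    obtain ⟨v, hv⟩ := hne n
    exact ⟨v, fun q hq => hS hq hv⟩

/-- The largest upper set inside a selector is still a selector. -/
theorem isUpperSet_of_minimal (hA : A.IsSurjective) {S : Set A.InducedPoset}
    (hS : Minimal IsSelector S) : IsUpperSet S := by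
  have h : IsSelector {q | ∀ q', q ≤ q' → q' ∈ S} := (isSelector_iff hA).2 fun n => by
    obtain ⟨v, hv⟩ := (isSelector_iff hA).1 hS.1 n
    exact ⟨v, fun q hq q' hqq' => hv q' (hq.trans hqq')⟩
  intro p q hpq hp
  exact hS.2 h (fun q hq => hq q le_rfl) hp q hpq

theorem level_nonempty_of_isSelector (hA : A.IsSurjective) {S : Set A.InducedPoset}
    (hS : IsSelector S) (n : ℕ) : (level S n).Nonempty := by
  obtain ⟨v, hv⟩ := (isSelector_iff hA).1 hS n
  exact ⟨v, hv _ le_rfl⟩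

theorem minimal_isSelector_iff (hA : A.IsSurjective) {S : Set A.InducedPoset} :
    Minimal IsSelector S ↔
      Minimal (fun S => IsUpperSet S ∧ ∀ n, (level S n).Nonempty) S := by
  constructor
  · intro h
    exact ⟨⟨isUpperSet_of_minimal hA h, level_nonempty_of_isSelector hA h.1⟩,
      fun T hT hTS => h.2 (isSelector_of_upper hA hT.1 hT.2) hTS⟩
  · intro h
    refine ⟨isSelector_of_upper hA h.1.1 h.1.2, fun T hT hTS => ?_⟩
    have h1 : {q | ∀ q', q ≤ q' → q' ∈ T} ⊆ T := fun q hq => hq q le_rfl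
    refine (h.2 (y := {q | ∀ q', q ≤ q' → q' ∈ T})
      ⟨fun p q hpq hp q' hq' => hp q' (hpq.trans hq'), fun n => ?_⟩ (h1.trans hTS)).trans h1
    obtain ⟨v, hv⟩ := (isSelector_iff hA).1 hT n
    exact ⟨v, fun q hq => hv q hq⟩

theorem exists_minimal_isSelector_subset (hA : A.IsSurjective) {S : Set A.InducedPoset}
    (hS : IsUpperSet S) (hne : ∀ n, (level S n).Nonempty) :
    ∃ T, T ⊆ S ∧ Minimal IsSelector T := by
  obtain ⟨T, hTS, hT⟩ := zorn_superset_nonempty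
    {T : Set A.InducedPoset | IsUpperSet T ∧ ∀ n, (level T n).Nonempty} (by
      intro c hc hchain hcne
      refine ⟨⋂₀ c, ⟨isUpperSet_sInter fun T hT => (hc hT).1, fun n => ?_⟩,
        fun T hT => sInter_subset_of_mem hT⟩
      have := A.finite n
      -- If the intersection of the chain missed level `n`, each of the finitely many vertices there
      -- would be omitted by some member. A member of the chain below all of these would then have
      -- empty level `n`.
      by_contra hempty
      have hex : ∀ v : A.V n, ∃ T ∈ c, v ∉ level T n := by
        intro v
        by_contra! hv
        exact hempty ⟨v, fun T hT => hv T hT⟩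
      choose T hTc hvT using hex
      obtain ⟨T₀, hT₀⟩ := hcne
      have hdir : DirectedOn (· ⊇ ·) c := fun X hX Y hY => by
        rcases hchain.total hX hY with h | h
        · exact ⟨X, hX, subset_rfl, h⟩
        · exact ⟨Y, hY, h, subset_rfl⟩
      have : Nonempty c := ⟨⟨T₀, hT₀⟩⟩
      have hd : Directed (· ⊇ ·) (fun T : c => T.1) := directedOn_iff_directed.1 hdir
      obtain ⟨Z, hZ⟩ := hd.finite_le (fun v : A.V n => (⟨T v, hTc v⟩ : c))
      obtain ⟨v, hv⟩ := (hc Z.2).2 n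
      exact hvT v (hZ v hv)) S ⟨hS, hne⟩
  exact ⟨T, hTS, (minimal_isSelector_iff hA).2 hT⟩

/-- Every non-empty upper family contains a point of the spectrum. -/
theorem exists_spec_of_upperFamily (hA : A.IsSurjective) {B : ∀ n, Set (A.V n)}
    (hB : IsUpperFamily B) (hne : ∀ n, (B n).Nonempty) :
    ∃ x : A.Spec, ∀ n, level x.1 n ⊆ B n := by
  obtain ⟨T, hTS, hT⟩ := exists_minimal_isSelector_subset hA
    (S := {p : A.InducedPoset | p.2 ∈ B p.1})
    (fun p q ⟨h, hr⟩ hp => hB h hr hp) hne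
  exact ⟨⟨T, hT⟩, fun n v hv => hTS hv⟩

/-! ### Levels of points and the topology of the spectrum -/

section Levels

variable (hA : A.IsSurjective)
include hA

theorem level_nonempty (x : A.Spec) (n : ℕ) : (level x.1 n).Nonempty :=
  level_nonempty_of_isSelector hA x.2.1 n

theorem isUpperFamily_level (x : A.Spec) : IsUpperFamily (level x.1) :=
  fun h _ _ hr hb => isUpperSet_of_minimal hA x.2 (⟨h, hr⟩ : vert _ _ ≤ _) hb

/-- Every vertex of a point of the spectrum lies above all its vertices at large indices. -/
theorem eventually_rel_of_mem_level {x : A.Spec} {m : ℕ} {a : A.V m} (ha : a ∈ level x.1 m) :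
    ∃ N, m ≤ N ∧ ∀ n, N ≤ n → ∀ (h : m ≤ n), ∀ b ∈ level x.1 n, A.rel h a b := by
  -- By minimality, removing `a` destroys the selector property at some level `N`. Each vertex `v`
  -- of `x` at that level then has an element above it outside the smaller set; since `x` is an
  -- upper set, this element can only be `a`.
  have hns : ¬ IsSelector (x.1 \ {vert m a}) := fun h =>
    (x.2.2 h sdiff_subset ha).2 rfl
  rw [isSelector_iff hA] at hns
  push Not at hns
  obtain ⟨N, hN⟩ := hns
  have key : ∀ v ∈ level x.1 N, vert N v ≤ vert m a := by
    intro v hv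
    obtain ⟨q, hq, hqx⟩ := hN v
    have hq' : q ∈ x.1 := isUpperSet_of_minimal hA x.2 hq hv
    by_cases h : q = vert m a
    · rwa [← h]
    · exact absurd ⟨hq', h⟩ hqx
  obtain ⟨v, hv⟩ := level_nonempty hA x N
  obtain ⟨hmN, -⟩ := key v hv
  refine ⟨N, hmN, fun n hn h b hb => ?_⟩
  obtain ⟨c, hc⟩ := A.coSurjective hn b
  obtain ⟨h', hr⟩ := key c (isUpperFamily_level hA x hn hc hb)
  exact (A.rel_trans h' hn a b).2 ⟨c, hr, hc⟩

theorem exists_rel_of_mem_level {x : A.Spec} {m n : ℕ} (h : m ≤ n) {a : A.V m}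
    (ha : a ∈ level x.1 m) : ∃ b ∈ level x.1 n, A.rel h a b := by
  obtain ⟨N, hN, hN'⟩ := eventually_rel_of_mem_level hA ha
  obtain ⟨c, hc⟩ := level_nonempty hA x (max N n)
  have hr := hN' (max N n) (le_max_left _ _) (hN.trans (le_max_left _ _)) c hc
  obtain ⟨b, hab, hbc⟩ := (A.rel_trans h (le_max_right N n) a c).1 hr
  exact ⟨b, isUpperFamily_level hA x _ hbc hc, hab⟩

/-- Both vertices lie above a common vertex of late index, and the relations preserve edges. -/
theorem edge_of_mem_level {x : A.Spec} {n : ℕ} {a b : A.V n} (ha : a ∈ level x.1 n)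
    (hb : b ∈ level x.1 n) : Edge (A.graph n) a b := by
  obtain ⟨N, hN, hN'⟩ := eventually_rel_of_mem_level hA ha
  obtain ⟨M, hM, hM'⟩ := eventually_rel_of_mem_level hA hb
  obtain ⟨c, hc⟩ := level_nonempty hA x (max N M)
  exact A.edge_preserving (hN.trans (le_max_left _ _))
    (hN' _ (le_max_left _ _) _ c hc) (hM' _ (le_max_right _ _) _ c hc) (Or.inl rfl)

omit hA in
theorem isOpen_setOf_mem_level {n : ℕ} (a : A.V n) : IsOpen {x : A.Spec | a ∈ level x.1 n} :=
  TopologicalSpace.isOpen_generateFrom_of_mem ⟨⟨n, a⟩, rfl⟩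

/-- The sets of points containing a given vertex form a base of the topology. -/
theorem exists_nhds_of_mem_isOpen {U : Set A.Spec} (hU : IsOpen U) {x : A.Spec} (hx : x ∈ U) :
    ∃ N, ∀ n, N ≤ n → ∀ a ∈ level x.1 n, ∀ y : A.Spec, a ∈ level y.1 n → y ∈ U := by
  induction hU with
  | basic s hs =>
    obtain ⟨⟨m, p⟩, rfl⟩ := hs
    obtain ⟨N, hN, hN'⟩ := eventually_rel_of_mem_level hA (show p ∈ level x.1 m from hx)
    exact ⟨N, fun n hn a ha y hy =>
      isUpperFamily_level hA y (hN.trans hn) (hN' n hn _ a ha) hy⟩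
  | univ => exact ⟨0, fun _ _ _ _ _ _ => mem_univ _⟩
  | inter s t _ _ ihs iht =>
    obtain ⟨N, hN⟩ := ihs hx.1
    obtain ⟨M, hM⟩ := iht hx.2
    exact ⟨max N M, fun n hn a ha y hy =>
      ⟨hN n (by omega) a ha y hy, hM n (by omega) a ha y hy⟩⟩
  | sUnion S _ ih =>
    obtain ⟨s, hs, hxs⟩ := hx
    obtain ⟨N, hN⟩ := ih s hs hxs
    exact ⟨N, fun n hn a ha y hy => ⟨s, hs, hN n hn a ha y hy⟩⟩

/-- The vertices whose basic open set lies in no member of the cover form an upper family. Were it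
non-empty at every level, it would contain a point, whose small basic neighbourhoods do lie in a
member of the cover. -/
theorem compactSpace_spec : CompactSpace A.Spec := by
  refine ⟨isCompact_of_finite_subcover fun {ι} U hU hcov => ?_⟩
  let B : ∀ n, Set (A.V n) := fun n =>
    {v | ¬ ∃ i, {y : A.Spec | v ∈ level y.1 n} ⊆ U i}
  have hB : IsUpperFamily B := by
    rintro m n h a b hr hb ⟨i, hi⟩
    exact hb ⟨i, fun y hy => hi (isUpperFamily_level hA y h hr hy)⟩
  have hex : ∃ n, ∀ v, v ∉ B n := by
    by_contra! hcon
    obtain ⟨x, hx⟩ := exists_spec_of_upperFamily hA hB hcon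
    obtain ⟨i, hi⟩ := mem_iUnion.1 (hcov (mem_univ x))
    obtain ⟨N, hN⟩ := exists_nhds_of_mem_isOpen hA (hU i) hi
    obtain ⟨a, ha⟩ := level_nonempty hA x N
    exact hx N ha ⟨i, fun y hy => hN N le_rfl a ha y hy⟩
  obtain ⟨n, hn⟩ := hex
  have hn' : ∀ v : A.V n, ∃ i, {y : A.Spec | v ∈ level y.1 n} ⊆ U i := fun v => not_not.1 (hn v)
  choose i hi using hn'
  have := A.finite n
  refine ⟨(finite_range i).toFinset, fun x _ => ?_⟩
  obtain ⟨v, hv⟩ := level_nonempty hA x n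
  exact mem_biUnion (by simp) (hi v hv)

omit hA in
theorem secondCountableTopology_spec : SecondCountableTopology A.Spec := by
  have := A.countable_inducedPoset
  refine ⟨⟨{U | ∃ p : A.InducedPoset, U = {S : A.Spec | p ∈ S.1}}, ?_, rfl⟩⟩
  refine (countable_range fun p : A.InducedPoset => {S : A.Spec | p ∈ S.1}).mono ?_
  rintro _ ⟨p, rfl⟩
  exact ⟨p, rfl⟩

omit hA in
/-- The closed set of points all of whose vertices lie in a given family. -/
theorem isClosed_setOf_level_subset (B : ∀ n, Set (A.V n)) :
    IsClosed {x : A.Spec | ∀ n, level x.1 n ⊆ B n} := by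
  have : {x : A.Spec | ∀ n, level x.1 n ⊆ B n} =
      ⋂ (n) (a : A.V n) (_ : a ∉ B n), {x : A.Spec | a ∈ level x.1 n}ᶜ := by
    ext x
    simp only [mem_ofPred_eq, mem_iInter, mem_compl_iff]
    exact ⟨fun h n a ha hax => ha (h n hax), fun h n a ha => by_contra fun hb => h n a hb ha⟩
  rw [this]
  exact isClosed_iInter fun n => isClosed_iInter fun a => isClosed_iInter fun _ =>
    (isOpen_setOf_mem_level a).isClosed_compl

/-- A closed set consists of all points whose vertices are among the vertices of its points. -/
theorem mem_of_level_subset {C : Set A.Spec} (hC : IsClosed C) {x : A.Spec}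
    (hx : ∀ N, ∃ n, N ≤ n ∧ ∃ v ∈ level x.1 n, ∃ y ∈ C, v ∈ level y.1 n) : x ∈ C := by
  by_contra hxC
  obtain ⟨N, hN⟩ := exists_nhds_of_mem_isOpen hA hC.isOpen_compl hxC
  obtain ⟨n, hn, v, hv, y, hyC, hy⟩ := hx N
  exact hN n hn v hv y hy hyC

end Levels

/-! ### Upper restrictions with surjective relations -/

section Restrict

variable {H : ∀ n, Set (A.V n)} (hH : A.IsUpperRestriction H)

omit hH in
theorem isUpperFamily_of_isUpperRestriction (hH : A.IsUpperRestriction H) : IsUpperFamily H :=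
  fun h _ _ hr hb => hH.upper _ _ h ⟨_, hb, hr⟩

omit hH in
theorem incl_injective (hH : A.IsUpperRestriction H) :
    Function.Injective (A.incl H hH) := by
  rintro ⟨n, a, ha⟩ ⟨m, b, hb⟩ h
  obtain ⟨h1, h2⟩ := Sigma.mk.inj_iff.1 h
  obtain rfl : n = m := h1
  obtain rfl : a = b := eq_of_heq h2
  rfl

/-- The vertex sets of the restriction are closed upwards, so the inclusion preserves upper sets
under images as well as preimages. Minimality is then compared through `minimal_isSelector_iff`. -/
theorem minimal_isSelector_incl_image (hA : A.IsSurjective)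
    (hs : (A.restrict H hH).IsSurjective) {S : Set (A.restrict H hH).InducedPoset} :
    Minimal IsSelector S ↔ Minimal IsSelector (A.incl H hH '' S) := by
  have hinj := incl_injective hH
  have upper_image : ∀ T : Set (A.restrict H hH).InducedPoset, IsUpperSet T →
      IsUpperSet (A.incl H hH '' T) := by
    rintro T hT _ ⟨m, b⟩ ⟨h, hr⟩ ⟨⟨n, a⟩, ha, rfl⟩
    refine ⟨⟨m, ⟨b, hH.upper m n h ⟨a.1, a.2, hr⟩⟩⟩, hT ?_ ha, rfl⟩
    exact ⟨h, hr⟩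
  have upper_preimage : ∀ T : Set A.InducedPoset, IsUpperSet T →
      IsUpperSet (A.incl H hH ⁻¹' T) := by
    rintro T hT p q ⟨h, hr⟩ hp
    exact hT (show A.incl H hH p ≤ A.incl H hH q from ⟨h, hr⟩) hp
  rw [minimal_isSelector_iff hA, minimal_isSelector_iff hs]
  constructor
  · rintro ⟨⟨h1, h2⟩, h3⟩
    refine ⟨⟨upper_image S h1, fun n => ?_⟩, fun T hT hTS => ?_⟩
    · obtain ⟨v, hv⟩ := h2 n
      exact ⟨v.1, ⟨n, v⟩, hv, rfl⟩
    · rintro _ ⟨p, hp, rfl⟩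
      refine h3 (y := A.incl H hH ⁻¹' T) ⟨upper_preimage T hT.1, fun n => ?_⟩ ?_ hp
      · obtain ⟨v, hv⟩ := hT.2 n
        obtain ⟨q, hq, hqv⟩ := hTS hv
        obtain ⟨k, w⟩ := q
        obtain ⟨rfl, h2⟩ := Sigma.mk.inj_iff.1 hqv
        obtain rfl := eq_of_heq h2
        exact ⟨w, hv⟩
      · intro q hq
        obtain ⟨q', hq', h⟩ := hTS hq
        rwa [← hinj h]
  · rintro ⟨⟨h1, h2⟩, h3⟩
    have hpre : A.incl H hH ⁻¹' (A.incl H hH '' S) = S := preimage_image_eq _ hinj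
    refine ⟨⟨hpre ▸ upper_preimage _ h1, fun n => ?_⟩, fun T hT hTS => ?_⟩
    · obtain ⟨v, hv⟩ := h2 n
      obtain ⟨q, hq, hqv⟩ := hv
      obtain ⟨k, w⟩ := q
      obtain ⟨rfl, h2⟩ := Sigma.mk.inj_iff.1 hqv
      exact ⟨w, hq⟩
    · refine (image_subset_image_iff hinj).1 (h3 ⟨upper_image T hT.1, fun n => ?_⟩
        (image_mono hTS))
      obtain ⟨v, hv⟩ := hT.2 n
      exact ⟨v.1, ⟨n, v⟩, hv, rfl⟩

theorem mem_subSpec_iff (hA : A.IsSurjective) (hs : (A.restrict H hH).IsSurjective)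
    {x : A.Spec} : x ∈ A.subSpec H hH ↔ ∀ n, level x.1 n ⊆ H n := by
  constructor
  · rintro ⟨s, hx⟩ n v hv
    have : vert n v ∈ A.incl H hH '' s.1 := by rw [← hx]; exact hv
    obtain ⟨⟨k, w⟩, -, h⟩ := this
    obtain ⟨rfl, h2⟩ := Sigma.mk.inj_iff.1 h
    obtain rfl := eq_of_heq h2
    exact w.2
  · intro h
    have himg : A.incl H hH '' (A.incl H hH ⁻¹' x.1) = x.1 := by
      rw [image_preimage_eq_iff]
      rintro ⟨n, v⟩ hv
      exact ⟨⟨n, ⟨v, h n hv⟩⟩, rfl⟩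
    refine ⟨⟨A.incl H hH ⁻¹' x.1, (minimal_isSelector_incl_image hH hA hs).2 ?_⟩, himg.symm⟩
    rw [himg]
    exact x.2

theorem isClosedSubSpec_and_range (hA : A.IsSurjective)
    (hs : (A.restrict H hH).IsSurjective) :
    ∃ f : (A.restrict H hH).Spec → A.Spec,
      (IsClosedEmbedding f ∧ ∀ s, (f s).1 = A.incl H hH '' s.1) ∧
        range f = A.subSpec H hH := by
  let f : (A.restrict H hH).Spec → A.Spec := fun s =>
    ⟨A.incl H hH '' s.1, (minimal_isSelector_incl_image hH hA hs).1 s.2⟩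
  have hrange : range f = A.subSpec H hH := by
    ext x
    constructor
    · rintro ⟨s, rfl⟩
      exact ⟨s, rfl⟩
    · rintro ⟨s, hs⟩
      exact ⟨s, Subtype.ext hs.symm⟩
  have hinj : Function.Injective f := fun s t h =>
    Subtype.ext ((incl_injective hH).image_injective (congrArg Subtype.val h))
  have hind : IsInducing f := by
    refine ⟨?_⟩
    change TopologicalSpace.generateFrom _ =
      TopologicalSpace.induced f (TopologicalSpace.generateFrom _)
    rw [induced_generateFrom_eq]
    have pre : ∀ p, f ⁻¹' {x : A.Spec | A.incl H hH p ∈ x.1} =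
        {s : (A.restrict H hH).Spec | p ∈ s.1} := by
      intro p
      ext s
      exact (incl_injective hH).mem_set_image
    apply le_antisymm
    · refine le_generateFrom ?_
      rintro _ ⟨_, ⟨q, rfl⟩, rfl⟩
      -- A subbasic set given by a vertex of the restriction pulls back to a subbasic set; any other
      -- pulls back to the empty set.
      by_cases hq : ∃ p, A.incl H hH p = q
      · obtain ⟨p, rfl⟩ := hq
        rw [pre]
        exact TopologicalSpace.isOpen_generateFrom_of_mem ⟨p, rfl⟩
      · have : f ⁻¹' {x : A.Spec | q ∈ x.1} = ∅ := by
          ext s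
          simp only [mem_preimage, mem_ofPred_eq, mem_empty_iff_false, iff_false]
          rintro ⟨p, -, hp⟩
          exact hq ⟨p, hp⟩
        rw [this]
        exact @isOpen_empty _ (TopologicalSpace.generateFrom _)
    · refine le_generateFrom ?_
      rintro _ ⟨p, rfl⟩
      rw [← pre]
      exact TopologicalSpace.isOpen_generateFrom_of_mem ⟨_, ⟨_, rfl⟩, rfl⟩
  refine ⟨f, ⟨⟨⟨hind, hinj⟩, ?_⟩, fun s => rfl⟩, hrange⟩
  rw [hrange]
  have : A.subSpec H hH = {x : A.Spec | ∀ n, level x.1 n ⊆ H n} := by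
    ext x
    exact mem_subSpec_iff hH hA hs
  rw [this]
  exact isClosed_setOf_level_subset H

end Restrict

end GraphSeq

/-! ### Spokes of graph fans -/

section Connected

variable {V : Type u} {G : SimpleGraph V}

theorem Edge.symm {a b : V} (h : Edge G a b) : Edge G b a :=
  h.imp Eq.symm SimpleGraph.Adj.symm

/-- A walk inside `C` cannot leave a part of `C` closed under adjacency; conversely the vertices
reachable from a given one form such a part. This form lets properties be propagated without
handling walks. -/
theorem isConnectedSet_iff {C : Set V} :
    IsConnectedSet G C ↔ ∀ B ⊆ C, B.Nonempty → (∀ u ∈ B, ∀ v ∈ C, G.Adj u v → v ∈ B) →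
      C ⊆ B := by
  constructor
  · rintro h B hBC ⟨b, hb⟩ hB c hc
    obtain ⟨p⟩ := h ⟨b, hBC hb⟩ ⟨c, hc⟩
    have : ∀ (x y : C) (_ : (G.induce C).Walk x y), x.1 ∈ B → y.1 ∈ B := by
      intro x y p
      induction p with
      | nil => exact id
      | cons hadj _ ih => exact fun hx => ih (hB _ hx _ (Subtype.prop _) hadj)
    exact this _ _ p hb
  · rintro h ⟨a, ha⟩ ⟨b, hb⟩
    have := h {v | ∃ hv : v ∈ C, (G.induce C).Reachable ⟨a, ha⟩ ⟨v, hv⟩}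
      (fun v ⟨hv, _⟩ => hv) ⟨a, ha, SimpleGraph.Reachable.refl _⟩ (by
        rintro u ⟨hu, hau⟩ v hv huv
        exact ⟨hv, hau.trans (SimpleGraph.Adj.reachable (G := G.induce C)
          (u := ⟨u, hu⟩) (v := ⟨v, hv⟩) huv)⟩) hb
    exact this.2

theorem isConnectedSet_singleton (a : V) : IsConnectedSet G {a} := by
  rw [isConnectedSet_iff]
  rintro B hB ⟨b, hb⟩ - c rfl
  rwa [← show b = c from hB hb]

end Connected

section Fan

variable {V : Type u} {G : SimpleGraph V} {r : V}

/-- Paths in a tree are unique, so initial pieces of paths are geodesics. -/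
theorem dist_getVert_of_isTree (hG : G.IsTree) {e : V} {p : G.Walk r e} (hp : p.IsPath) {i : ℕ}
    (hi : i ≤ p.length) : G.dist r (p.getVert i) = i := by
  obtain ⟨q, hq, hlen⟩ := hG.connected.exists_path_of_dist r (p.getVert i)
  have : q = p.take i := congrArg Subtype.val
    ((hG.isAcyclic.subsingleton_path _ _).elim ⟨q, hq⟩ ⟨p.take i, hp.take i⟩)
  rw [← hlen, this, SimpleGraph.Walk.take_length]
  omega

namespace IsGraphFan

variable (hG : IsGraphFan G r)
include hG

theorem dist_adj {u v : V} (h : G.Adj u v) :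
    G.dist r v = G.dist r u + 1 ∨ G.dist r u = G.dist r v + 1 := by
  rcases hG.1.dist_eq_dist_add_one_of_adj r h with h | h
  · exact Or.inr h
  · exact Or.inl h

theorem dist_le_of_edge {u v : V} (h : Edge G u v) : G.dist r v ≤ G.dist r u + 1 := by
  rcases h with rfl | h
  · omega
  · rcases hG.dist_adj h with h | h <;> omega

theorem dist_eq_zero_iff {v : V} : G.dist r v = 0 ↔ v = r := by
  rw [hG.1.connected.dist_eq_zero_iff]
  exact eq_comm

/-- A parametrization of a spoke by the distance to the root. -/
theorem exists_param {S : Set V} (hS : S ∈ graphSpokes G r) :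
    ∃ (l : ℕ) (f : ℕ → V), S = {v | ∃ i ≤ l, f i = v} ∧ (∀ i ≤ l, G.dist r (f i) = i) ∧
      (∀ i < l, G.Adj (f i) (f (i + 1))) ∧ f l ∈ endSet G := by
  obtain ⟨e, he, p, hp, rfl⟩ := hS
  refine ⟨p.length, p.getVert, ?_, fun i hi => dist_getVert_of_isTree hG.1 hp hi,
    fun i hi => p.adj_getVert_succ hi, ?_⟩
  · ext v
    simp only [mem_ofPred_eq, SimpleGraph.Walk.mem_support_iff_exists_getVert]
    exact ⟨fun ⟨i, h1, h2⟩ => ⟨i, h2, h1⟩, fun ⟨i, h1, h2⟩ => ⟨i, h2, h1⟩⟩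
  · rwa [p.getVert_length]

variable {S S' : Set V} (hS : S ∈ graphSpokes G r)

section Spoke

include hS

theorem eq_of_dist_eq {u v : V} (hu : u ∈ S) (hv : v ∈ S) (h : G.dist r u = G.dist r v) :
    u = v := by
  obtain ⟨l, f, rfl, hd, -, -⟩ := hG.exists_param hS
  obtain ⟨i, hi, rfl⟩ := hu
  obtain ⟨j, hj, rfl⟩ := hv
  rw [hd i hi, hd j hj] at h
  rw [h]

theorem exists_mem_dist_eq {v : V} (hv : v ∈ S) {j : ℕ} (hj : j ≤ G.dist r v) :
    ∃ u ∈ S, G.dist r u = j := by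
  obtain ⟨l, f, rfl, hd, -, -⟩ := hG.exists_param hS
  obtain ⟨i, hi, rfl⟩ := hv
  rw [hd i hi] at hj
  exact ⟨f j, ⟨j, by omega, rfl⟩, hd j (by omega)⟩

theorem adj_of_dist_succ {u v : V} (hu : u ∈ S) (hv : v ∈ S)
    (h : G.dist r v = G.dist r u + 1) : G.Adj u v := by
  obtain ⟨l, f, rfl, hd, hadj, -⟩ := hG.exists_param hS
  obtain ⟨i, hi, rfl⟩ := hu
  obtain ⟨j, hj, rfl⟩ := hv
  rw [hd i hi, hd j hj] at h
  subst h
  exact hadj i (by omega)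

theorem edge_of_dist_le {u v : V} (hu : u ∈ S) (hv : v ∈ S)
    (h1 : G.dist r v ≤ G.dist r u + 1) (h2 : G.dist r u ≤ G.dist r v + 1) : Edge G u v := by
  rcases lt_trichotomy (G.dist r u) (G.dist r v) with h | h | h
  · exact Or.inr (hG.adj_of_dist_succ hS hu hv (by omega))
  · exact Or.inl (hG.eq_of_dist_eq hS hu hv h)
  · exact Or.inr (hG.adj_of_dist_succ hS hv hu (by omega)).symm

omit hG in
theorem root_mem_spoke : r ∈ S := by
  obtain ⟨e, -, p, -, rfl⟩ := hS
  exact p.start_mem_support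

omit hS in
theorem root_not_mem_endSet : r ∉ endSet G := by
  intro h
  have h1 : (G.neighborSet r).ncard ≤ 1 := h
  have h2 := (hG.2 r).2 rfl
  omega

variable [Finite V]

omit hS hG in
theorem eq_of_two_neighbors {v a b c : V} (hv : (G.neighborSet v).ncard ≤ 2) (ha : G.Adj v a)
    (hb : G.Adj v b) (hab : a ≠ b) (hc : G.Adj v c) : c = a ∨ c = b := by
  by_contra! h
  have hsub : ({a, b, c} : Set V) ⊆ G.neighborSet v := by
    rintro x (rfl | rfl | rfl) <;> assumption
  have h1 := Set.ncard_le_ncard hsub (toFinite _)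
  rw [Set.ncard_eq_three.2 ⟨a, b, c, hab, h.1.symm, h.2.symm, rfl⟩] at h1
  omega

omit hS hG in
theorem eq_of_one_neighbor {v a b : V} (hv : v ∈ endSet G) (ha : G.Adj v a)
    (hb : G.Adj v b) : a = b := by
  by_contra! h
  have hsub : ({a, b} : Set V) ⊆ G.neighborSet v := by
    rintro x (rfl | rfl) <;> assumption
  have h1 := Set.ncard_le_ncard hsub (toFinite _)
  rw [Set.ncard_pair h] at h1
  have h2 : (G.neighborSet v).ncard ≤ 1 := hv
  omega

/-- The part of a spoke outside the root is closed under adjacency, except for the root. -/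
theorem mem_of_adj {v w : V} (hv : v ∈ S) (hvr : v ≠ r) (h : G.Adj v w) : w ∈ S := by
  obtain ⟨l, f, rfl, hd, hadj, he⟩ := hG.exists_param hS
  obtain ⟨i, hi, rfl⟩ := hv
  obtain ⟨k, rfl⟩ : ∃ k, i = k + 1 := by
    cases i with
    | zero => exact absurd (hG.dist_eq_zero_iff.1 (hd 0 hi)) hvr
    | succ k => exact ⟨k, rfl⟩
  have h1 := (hadj k (by omega)).symm
  rcases hi.lt_or_eq with hlt | rfl
  · have h2 := hadj (k + 1) hlt
    have hne : f k ≠ f (k + 1 + 1) := fun h => by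
      have := hd k (by omega)
      rw [h, hd _ (by omega)] at this
      omega
    have hdeg : (G.neighborSet (f (k + 1))).ncard ≤ 2 := by
      by_contra! hcon
      exact hvr ((hG.2 _).1 hcon)
    rcases eq_of_two_neighbors hdeg h1 h2 hne h with rfl | rfl
    · exact ⟨k, by omega, rfl⟩
    · exact ⟨k + 1 + 1, by omega, rfl⟩
  · exact ⟨k, by omega, eq_of_one_neighbor he h1 h⟩

/-- The end of a spoke. -/
theorem exists_end : ∃ e ∈ S, e ∈ endSet G ∧ (∀ v ∈ S, G.dist r v ≤ G.dist r e) ∧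
    ∀ v ∈ S, v ∈ endSet G → v = e := by
  obtain ⟨l, f, rfl, hd, hadj, he⟩ := hG.exists_param hS
  refine ⟨f l, ⟨l, le_rfl, rfl⟩, he, ?_, ?_⟩
  · rintro _ ⟨i, hi, rfl⟩
    rwa [hd i hi, hd l le_rfl]
  · rintro _ ⟨i, hi, rfl⟩ hie
    by_contra hne
    have hil : i < l := lt_of_le_of_ne hi fun h => hne (by rw [h])
    cases i with
    | zero => exact hG.root_not_mem_endSet (hG.dist_eq_zero_iff.1 (hd 0 hi) ▸ hie)
    | succ k =>
      have := eq_of_one_neighbor hie (hadj k (by omega)).symm (hadj _ hil)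
      have h2 := hd k (by omega)
      rw [this, hd _ (by omega)] at h2
      omega

/-- A connected set that contains a vertex of a spoke beyond a given vertex, and another vertex
not beyond it, contains the given vertex. -/
theorem mem_of_isConnectedSet {C : Set V} (hC : IsConnectedSet G C) {u w z : V} (hu : u ∈ C)
    (huS : u ∈ S) (hw : w ∈ C) (hz : z ∈ S) (hzu : G.dist r z ≤ G.dist r u)
    (hwz : w ∈ S → G.dist r w ≤ G.dist r z) : z ∈ C := by
  by_contra hzC
  have hne : G.dist r z ≠ G.dist r u := fun h => hzC (hG.eq_of_dist_eq hS hz huS h ▸ hu)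
  -- The part of `C` strictly beyond `z` on the spoke can be left only through `z`, so it would be
  -- all of `C`, including `w`.
  have := (isConnectedSet_iff.1 hC) {v | v ∈ C ∧ v ∈ S ∧ G.dist r z < G.dist r v}
    (fun v hv => hv.1) ⟨u, hu, huS, by omega⟩ (by
      rintro a ⟨haC, haS, had⟩ b hb hab
      have har : a ≠ r := fun h => by
        rw [hG.dist_eq_zero_iff.2 h] at had
        omega
      have hbS := hG.mem_of_adj hS haS har hab
      refine ⟨hb, hbS, ?_⟩
      have hbz : G.dist r b ≠ G.dist r z := fun h => hzC (hG.eq_of_dist_eq hS hz hbS h.symm ▸ hb)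
      rcases hG.dist_adj hab with h | h <;> omega) hw
  have h2 := hwz this.2.1
  have h3 := this.2.2
  omega

omit [Finite V] in
/-- The initial segments of a spoke are connected. -/
theorem isConnectedSet_initial (j : ℕ) : IsConnectedSet G {v | v ∈ S ∧ G.dist r v ≤ j} := by
  rw [isConnectedSet_iff]
  rintro B hB ⟨b, hb⟩ hcl
  have hroot : ∀ k, ∀ v ∈ B, G.dist r v = k → r ∈ B := by
    intro k
    induction k with
    | zero => intro v hv h; rwa [hG.dist_eq_zero_iff.1 h] at hv
    | succ k ih =>
      intro v hv h
      obtain ⟨u, hu, hud⟩ := hG.exists_mem_dist_eq hS (hB hv).1 (j := k) (by omega)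
      have := (hB hv).2
      exact ih u (hcl v hv u ⟨hu, by omega⟩
        (hG.adj_of_dist_succ hS hu (hB hv).1 (by omega)).symm) hud
  have hr : r ∈ B := hroot _ b hb rfl
  have hall : ∀ k, ∀ v ∈ S, G.dist r v ≤ j → G.dist r v = k → v ∈ B := by
    intro k
    induction k with
    | zero => intro v _ _ h; rwa [hG.dist_eq_zero_iff.1 h]
    | succ k ih =>
      intro v hv hvj h
      obtain ⟨u, hu, hud⟩ := hG.exists_mem_dist_eq hS hv (j := k) (by omega)
      exact hcl u (ih u hu (by omega) hud) v ⟨hv, hvj⟩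
        (hG.adj_of_dist_succ hS hu hv (by omega))
  exact fun v hv => hall _ v hv.1 hv.2 rfl

theorem isConnectedSet_spoke : IsConnectedSet G S := by
  obtain ⟨e, -, -, he, -⟩ := hG.exists_end hS
  have : S = {v | v ∈ S ∧ G.dist r v ≤ G.dist r e} := by
    ext v
    exact ⟨fun h => ⟨h, he v h⟩, fun h => h.1⟩
  rw [this]
  exact hG.isConnectedSet_initial hS _

end Spoke

variable [Finite V]

/-- Spokes that share a vertex other than the root are equal. -/
theorem spoke_eq (hS : S ∈ graphSpokes G r) (hS' : S' ∈ graphSpokes G r) {v : V} (hvr : v ≠ r)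
    (hv : v ∈ S) (hv' : v ∈ S') : S = S' := by
  have key : ∀ {S S' : Set V}, S ∈ graphSpokes G r → S' ∈ graphSpokes G r → v ∈ S → v ∈ S' →
      S ⊆ S' := by
    intro S S' hS hS' hv hv'
    by_contra hcon
    obtain ⟨w, hw, hwS'⟩ := not_subset.1 hcon
    have hwr : w ≠ r := fun h => hwS' (h ▸ root_mem_spoke hS')
    have := isConnectedSet_iff.1 (hG.isConnectedSet_spoke hS) {a | a ∈ S ∧ (a ∈ S' ∨ a = r)}
      (fun a ha => ha.1) ⟨v, hv, Or.inl hv'⟩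
    -- Descending along `S` from a common vertex shows that the neighbour of the root on `S` also
    -- lies on `S'`. This covers the steps that start at the root, where the two spokes could
    -- otherwise part.
    have hone : ∀ k, ∀ a ∈ S, a ∈ S' → G.dist r a = k + 1 →
        ∀ b ∈ S, G.dist r b = 1 → b ∈ S' := by
      intro k
      induction k with
      | zero =>
        intro a ha ha' h b hb hb1
        rwa [hG.eq_of_dist_eq hS hb ha (by omega)]
      | succ k ih =>
        intro a ha ha' h b hb hb1
        obtain ⟨u, hu, hud⟩ := hG.exists_mem_dist_eq hS ha (j := k + 1) (by omega)
        have har : a ≠ r := fun h' => by rw [hG.dist_eq_zero_iff.2 h'] at h; omega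
        exact ih u hu (hG.mem_of_adj hS' ha' har
          (hG.adj_of_dist_succ hS hu ha (by omega)).symm) hud b hb hb1
    obtain ⟨k, hk⟩ : ∃ k, G.dist r v = k + 1 :=
      Nat.exists_eq_succ_of_ne_zero fun h => hvr (hG.dist_eq_zero_iff.1 h)
    refine hwS' ?_
    rcases this (by
      rintro a ⟨ha, ha' | rfl⟩ b hb hab
      · by_cases har : a = r
        · subst har
          refine ⟨hb, Or.inl (hone k v hv hv' hk b hb ?_)⟩
          rcases hG.dist_adj hab with h | h
          · rw [h, SimpleGraph.dist_self]
          · rw [SimpleGraph.dist_self] at h; omega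
        · exact ⟨hb, Or.inl (hG.mem_of_adj hS' ha' har hab)⟩
      · refine ⟨hb, Or.inl (hone k v hv hv' hk b hb ?_)⟩
        rcases hG.dist_adj hab with h | h
        · rw [h, SimpleGraph.dist_self]
        · rw [SimpleGraph.dist_self] at h; omega) hw with ⟨-, h | h⟩
    · exact h
    · exact absurd h hwr
  exact (key hS hS' hv hv').antisymm (key hS' hS hv' hv)

/-- Every vertex lies on a spoke. -/
theorem exists_spoke (v : V) : ∃ S ∈ graphSpokes G r, v ∈ S := by
  classical
  have hfin : Fintype V := Fintype.ofFinite V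
  obtain ⟨p₀, hp₀, -⟩ := hG.1.connected.exists_path_of_dist r v
  -- Minimizing this difference selects a longest path from the root through `v`. If its last vertex
  -- were not an end, it would have a neighbour off the path, and the path could be extended.
  have hex : ∃ n, ∃ (e : V) (p : G.Walk r e), p.IsPath ∧ v ∈ p.support ∧
      Fintype.card V - p.length = n :=
    ⟨_, v, p₀, hp₀, p₀.end_mem_support, rfl⟩
  obtain ⟨e, p, hp, hv, hlen⟩ := Nat.find_spec hex
  refine ⟨_, ⟨e, ?_, p, hp, rfl⟩, hv⟩
  by_contra he
  have hnb : ∃ w, G.Adj e w ∧ w ∉ p.support := by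
    by_contra! hcon
    apply he
    change (G.neighborSet e).ncard ≤ 1
    rw [Set.ncard_le_one (toFinite _)]
    have key : ∀ w, G.Adj e w → w = p.getVert (p.length - 1) := by
      intro w hw
      obtain ⟨i, hi, hil⟩ := SimpleGraph.Walk.mem_support_iff_exists_getVert.1 (hcon w hw)
      have h1 := dist_getVert_of_isTree hG.1 hp hil
      have h2 := dist_getVert_of_isTree hG.1 hp le_rfl
      rw [p.getVert_length] at h2
      rw [hi] at h1
      rw [← hi]
      congr 1
      rcases hG.dist_adj hw with h | h <;> omega
    intro a ha b hb
    rw [key a ha, key b hb]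
  obtain ⟨w, hw, hwp⟩ := hnb
  have hcard := hp.length_lt
  refine Nat.find_min hex (m := Fintype.card V - (p.concat hw).length) ?_
    ⟨w, p.concat hw, hp.concat hwp hw, ?_, rfl⟩
  · rw [← hlen, SimpleGraph.Walk.length_concat]
    omega
  · rw [SimpleGraph.Walk.support_concat]
    simp [hv]

/-- Related vertices other than the root lie on the same spokes. -/
theorem mem_spoke_of_edge (hS : S ∈ graphSpokes G r) {v w : V} (hv : v ∈ S) (hvr : v ≠ r)
    (h : Edge G v w) : w ∈ S := by
  rcases h with rfl | h
  · exact hv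
  · exact hG.mem_of_adj hS hv hvr h

omit [Finite V] in
/-- Three different neighbours of the root. -/
theorem exists_three_neighbors : ∃ v : Fin 3 → V, Function.Injective v ∧
    ∀ i, G.dist r (v i) = 1 := by
  have h := (hG.2 r).2 rfl
  obtain ⟨T, hT, hcard⟩ := Set.exists_subset_card_eq h
  obtain ⟨a, b, c, hab, hac, hbc, rfl⟩ := Set.ncard_eq_three.1 hcard
  have hd : ∀ v ∈ ({a, b, c} : Set V), G.dist r v = 1 := by
    intro v hv
    have hadj : G.Adj r v := hT hv
    exact SimpleGraph.dist_eq_one_iff_adj.2 hadj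
  refine ⟨![a, b, c], ?_, ?_⟩
  · intro i j hij
    fin_cases i <;> fin_cases j <;> simp_all
  · intro i
    fin_cases i
    · exact hd a (by simp)
    · exact hd b (by simp)
    · exact hd c (by simp)

end IsGraphFan

end Fan

/-! ### Subcontinua of the spectrum -/

/-- In an acyclic graph the intersection of connected sets is connected. -/
theorem IsConnectedSet.inter {V : Type u} {G : SimpleGraph V} (hG : G.IsAcyclic) {C D : Set V}
    (hC : IsConnectedSet G C) (hD : IsConnectedSet G D) : IsConnectedSet G (C ∩ D) := by
  rintro ⟨a, haC, haD⟩ ⟨b, hbC, hbD⟩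
  have key : ∀ {S : Set V}, IsConnectedSet G S → a ∈ S → b ∈ S →
      ∃ p : G.Walk a b, p.IsPath ∧ ∀ v ∈ p.support, v ∈ S := by
    intro S hS ha hb
    obtain ⟨p, hp⟩ := (hS ⟨a, ha⟩ ⟨b, hb⟩).exists_isPath
    refine ⟨p.map (SimpleGraph.Embedding.induce S).toHom,
      hp.map (SimpleGraph.Embedding.induce (G := G) S).injective, ?_⟩
    intro v hv
    obtain ⟨w, -, rfl⟩ := List.mem_map.1 ((congrArg (v ∈ ·)
      (SimpleGraph.Walk.support_map (SimpleGraph.Embedding.induce (G := G) S).toHom p)).mp hv)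
    exact w.2
  obtain ⟨p, hp, hpC⟩ := key hC haC hbC
  obtain ⟨q, hq, hqD⟩ := key hD haD hbD
  have : p = q := congrArg Subtype.val
    ((hG.subsingleton_path _ _).elim ⟨p, hp⟩ ⟨q, hq⟩)
  subst this
  exact ⟨p.induce (C ∩ D) fun v hv => ⟨hpC v hv, hqD v hv⟩⟩

/-! ### Threads and traces of sets of points -/

namespace GraphSeq

variable {A : GraphSeq.{u}}

/-- The vertices above some member of a thread. -/
def aboveThread (t : ∀ n, A.V n) (n : ℕ) : Set (A.V n) :=
  {a | ∃ k, ∃ h : n ≤ k, A.rel h a (t k)}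

theorem isUpperFamily_aboveThread (t : ∀ n, A.V n) : IsUpperFamily (aboveThread t) := by
  rintro m n h a b hr ⟨k, hk, hk'⟩
  exact ⟨k, h.trans hk, (A.rel_trans h hk _ _).2 ⟨b, hr, hk'⟩⟩

theorem aboveThread_subset {B : ∀ n, Set (A.V n)} (hB : IsUpperFamily B) {t : ∀ n, A.V n}
    (ht : ∀ n, t n ∈ B n) (n : ℕ) : aboveThread t n ⊆ B n := by
  rintro a ⟨k, hk, hr⟩
  exact hB hk hr (ht k)

/-- Both vertices lie above members of their threads at one common late index, where these members
are related. -/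
theorem edge_of_mem_aboveThread {s t : ∀ n, A.V n} (hs : A.IsThread s) (ht : A.IsThread t)
    (hst : ∀ n, Edge (A.graph n) (s n) (t n)) {n : ℕ} {a b : A.V n}
    (ha : a ∈ aboveThread s n) (hb : b ∈ aboveThread t n) : Edge (A.graph n) a b := by
  obtain ⟨k, hk, hak⟩ := ha
  obtain ⟨l, hl, hbl⟩ := hb
  exact A.edge_preserving (hk.trans (le_max_left k l))
    ((A.rel_trans hk (le_max_left k l) _ _).2 ⟨_, hak, hs _ _ _⟩)
    ((A.rel_trans hl (le_max_right k l) _ _).2 ⟨_, hbl, ht _ _ _⟩) (hst _)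

theorem self_mem_aboveThread (t : ∀ n, A.V n) (n : ℕ) : t n ∈ aboveThread t n :=
  ⟨n, le_rfl, (A.rel_self _ _).2 rfl⟩

/-- The vertices of the points of a subset of the spectrum. -/
def trace (C : Set A.Spec) (n : ℕ) : Set (A.V n) :=
  {v | ∃ x ∈ C, v ∈ level x.1 n}

theorem isUpperFamily_trace (hA : A.IsSurjective) (C : Set A.Spec) :
    IsUpperFamily (trace C) := by
  rintro m n h a b hr ⟨x, hx, hb⟩
  exact ⟨x, hx, isUpperFamily_level hA x h hr hb⟩

theorem exists_spec_subset_aboveThread (hA : A.IsSurjective) (t : ∀ n, A.V n) :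
    ∃ x : A.Spec, ∀ n, level x.1 n ⊆ aboveThread t n :=
  exists_spec_of_upperFamily hA (isUpperFamily_aboveThread t)
    fun n => ⟨t n, self_mem_aboveThread t n⟩

theorem mem_of_level_subset_trace (hA : A.IsSurjective) {C : Set A.Spec} (hC : IsClosed C)
    {x : A.Spec} (hx : ∀ n, level x.1 n ⊆ trace C n) : x ∈ C :=
  mem_of_level_subset hA hC fun N => by
    obtain ⟨v, hv⟩ := level_nonempty hA x N
    obtain ⟨y, hy, hvy⟩ := hx N hv
    exact ⟨N, le_rfl, v, hv, y, hy, hvy⟩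

/-- Connected subsets of the spectrum have connected traces. -/
theorem isConnectedSet_trace (hA : A.IsSurjective) {C : Set A.Spec} (hC : IsPreconnected C)
    (n : ℕ) : IsConnectedSet (A.graph n) (trace C n) := by
  rw [isConnectedSet_iff]
  rintro B hB ⟨b, hb⟩ hcl
  by_contra hcon
  obtain ⟨c, hc, hcB⟩ := not_subset.1 hcon
  -- The points with a vertex in `B` and those with a vertex in the rest of the trace form two open
  -- sets covering `C`. A common point has related vertices on both sides, against the closure of
  -- `B`.
  have hop : ∀ D : Set (A.V n), IsOpen (⋃ a ∈ D, {x : A.Spec | a ∈ level x.1 n}) :=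
    fun D => isOpen_biUnion fun a _ => isOpen_setOf_mem_level a
  obtain ⟨y, hy, hby⟩ := hB hb
  obtain ⟨z, hz, hcz⟩ := hc
  obtain ⟨x, hxC, hx1, hx2⟩ := hC _ _ (hop B) (hop (trace C n \ B))
    (fun x hx => by
      obtain ⟨v, hv⟩ := level_nonempty hA x n
      by_cases hvB : v ∈ B
      · exact Or.inl (mem_biUnion hvB hv)
      · exact Or.inr (mem_biUnion (⟨⟨x, hx, hv⟩, hvB⟩ : v ∈ trace C n \ B) hv))
    ⟨y, hy, mem_biUnion hb hby⟩
    ⟨z, hz, mem_biUnion (⟨⟨z, hz, hcz⟩, hcB⟩ : c ∈ trace C n \ B) hcz⟩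
  simp only [mem_iUnion] at hx1 hx2
  obtain ⟨u, hu, hux⟩ := hx1
  obtain ⟨w, hw, hwx⟩ := hx2
  rcases edge_of_mem_level hA hux hwx with rfl | h
  · exact hw.2 hu
  · exact hw.2 (hcl u hu w hw.1 h)

end GraphSeq

open GraphSeq

/-! ### Depth in the fans, and what connected Hausdorff spectra say about edges -/

namespace LSeq

variable (A : LSeq.{u})

/-- The distance of a vertex from the root. -/
noncomputable def depth {n : ℕ} (v : A.V n) : ℕ := (A.graph n).dist (A.root n) v

variable {A}

section Depth

variable {n : ℕ} {S S' : Set (A.V n)} {u v w z : A.V n}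

theorem depth_eq_zero_iff : A.depth v = 0 ↔ v = A.root n :=
  (A.isFan n).dist_eq_zero_iff

theorem depth_root (n : ℕ) : A.depth (A.root n) = 0 :=
  depth_eq_zero_iff.2 rfl

theorem depth_adj (h : (A.graph n).Adj u v) :
    A.depth v = A.depth u + 1 ∨ A.depth u = A.depth v + 1 :=
  (A.isFan n).dist_adj h

theorem depth_le_of_edge (h : Edge (A.graph n) u v) : A.depth v ≤ A.depth u + 1 :=
  (A.isFan n).dist_le_of_edge h

theorem eq_of_depth_eq (hS : S ∈ A.spokes n) (hu : u ∈ S) (hv : v ∈ S)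
    (h : A.depth u = A.depth v) : u = v :=
  (A.isFan n).eq_of_dist_eq hS hu hv h

theorem exists_mem_depth_eq (hS : S ∈ A.spokes n) (hv : v ∈ S) {j : ℕ} (hj : j ≤ A.depth v) :
    ∃ u ∈ S, A.depth u = j :=
  (A.isFan n).exists_mem_dist_eq hS hv hj

theorem adj_of_depth_succ (hS : S ∈ A.spokes n) (hu : u ∈ S) (hv : v ∈ S)
    (h : A.depth v = A.depth u + 1) : (A.graph n).Adj u v :=
  (A.isFan n).adj_of_dist_succ hS hu hv h

theorem edge_of_depth_le (hS : S ∈ A.spokes n) (hu : u ∈ S) (hv : v ∈ S)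
    (h1 : A.depth v ≤ A.depth u + 1) (h2 : A.depth u ≤ A.depth v + 1) :
    Edge (A.graph n) u v :=
  (A.isFan n).edge_of_dist_le hS hu hv h1 h2

theorem exists_end (hS : S ∈ A.spokes n) : ∃ e ∈ S, e ∈ endSet (A.graph n) ∧
    (∀ v ∈ S, A.depth v ≤ A.depth e) ∧ ∀ v ∈ S, v ∈ endSet (A.graph n) → v = e := by
  have := A.finite n
  exact (A.isFan n).exists_end hS

theorem mem_of_isConnectedSet {C : Set (A.V n)} (hC : IsConnectedSet (A.graph n) C)
    (hS : S ∈ A.spokes n) (hu : u ∈ C) (huS : u ∈ S) (hw : w ∈ C) (hz : z ∈ S)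
    (hzu : A.depth z ≤ A.depth u) (hwz : w ∈ S → A.depth w ≤ A.depth z) : z ∈ C := by
  have := A.finite n
  exact (A.isFan n).mem_of_isConnectedSet hS hC hu huS hw hz hzu hwz

theorem spoke_eq (hS : S ∈ A.spokes n) (hS' : S' ∈ A.spokes n) (hv : v ≠ A.root n)
    (h : v ∈ S) (h' : v ∈ S') : S = S' := by
  have := A.finite n
  exact (A.isFan n).spoke_eq hS hS' hv h h'

variable (v) in
theorem exists_spoke : ∃ S ∈ A.spokes n, v ∈ S := by
  have := A.finite n
  exact (A.isFan n).exists_spoke v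

theorem mem_spoke_of_edge (hS : S ∈ A.spokes n) (hv : v ∈ S) (hvr : v ≠ A.root n)
    (h : Edge (A.graph n) v w) : w ∈ S := by
  have := A.finite n
  exact (A.isFan n).mem_spoke_of_edge hS hv hvr h

end Depth

theorem isSurjective : A.toGraphSeq.IsSurjective := fun h a => by
  obtain ⟨b, hb⟩ := A.coInjective h a
  exact ⟨b, (hb a).2 rfl⟩

/-- Every vertex is the only vertex of its index in some point of the spectrum. -/
theorem exists_level_eq_singleton {n : ℕ} (v : A.V n) : ∃ x : A.Spec, level x.1 n = {v} := by
  -- The family consists of the vertices related at index `n` to nothing but `v`. Co-injectivity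
  -- makes it non-empty from index `n` on; at earlier indices it imposes no condition.
  obtain ⟨x, hx⟩ := exists_spec_of_upperFamily (A := A.toGraphSeq) A.isSurjective
    (B := fun k => {w | ∀ (h : n ≤ k) (a : A.V n), A.rel h a w → a = v})
    (fun {m k} h a b hr hb h' a' ha' => hb (h'.trans h) a' ((A.rel_trans h' h _ _).2 ⟨a, ha', hr⟩))
    (fun k => by
      rcases le_or_gt n k with h | h
      · obtain ⟨w, hw⟩ := A.coInjective h v
        exact ⟨w, fun h a ha => (hw a).1 ha⟩
      · obtain ⟨w⟩ := A.nonempty k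
        exact ⟨w, fun h' => absurd h' h.not_ge⟩)
  refine ⟨x, subset_antisymm (fun w hw => hx n hw le_rfl w ((A.rel_self _ _).2 rfl)) ?_⟩
  obtain ⟨w, hw⟩ := level_nonempty A.isSurjective x n
  rwa [singleton_subset_iff, ← hx n hw le_rfl w ((A.rel_self _ _).2 rfl)]

section Hausdorff

variable [ConnectedSpace A.Spec]

/-- If the spectrum is connected, then all edges are witnessed by points of the spectrum. -/
theorem exists_mem_level_of_edge {n : ℕ} {u v : A.V n} (h : Edge (A.graph n) u v) :
    ∃ x : A.Spec, u ∈ level x.1 n ∧ v ∈ level x.1 n := by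
  have key : ∀ {u v : A.V n}, (A.graph n).Adj u v → A.depth v = A.depth u + 1 →
      ∃ x : A.Spec, u ∈ level x.1 n ∧ v ∈ level x.1 n := by
    intro u v hadj hd
    obtain ⟨S, hS, hvS⟩ := exists_spoke v
    have hvr : v ≠ A.root n := fun h => by
      rw [depth_eq_zero_iff.2 h] at hd
      omega
    have huS := mem_spoke_of_edge hS hvS hvr (Or.inr hadj.symm)
    -- The part of the spoke from `v` outwards is joined to the rest of the fan only by the edge
    -- `uv`. A connected spectrum has a point with vertices on both sides, and these must be `v` and
    -- `u`.
    let B : Set (A.V n) := {w | w ∈ S ∧ A.depth v ≤ A.depth w}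
    have hop : ∀ D : Set (A.V n), IsOpen (⋃ a ∈ D, {x : A.Spec | a ∈ level x.1 n}) :=
      fun D => isOpen_biUnion fun a _ => isOpen_setOf_mem_level a
    obtain ⟨y, hy⟩ := exists_level_eq_singleton v
    obtain ⟨z, hz⟩ := exists_level_eq_singleton u
    obtain ⟨x, -, hx1, hx2⟩ := (isPreconnected_univ (α := A.Spec)) _ _ (hop B) (hop Bᶜ)
      (fun x _ => by
        obtain ⟨v, hv⟩ := level_nonempty A.isSurjective x n
        by_cases hvB : v ∈ B
        · exact Or.inl (mem_biUnion hvB hv)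
        · exact Or.inr (mem_biUnion (show v ∈ Bᶜ from hvB) hv))
      ⟨y, mem_univ y, mem_biUnion (⟨hvS, le_rfl⟩ : v ∈ B) (hy.symm ▸ mem_singleton v : v ∈ level y.1 n)⟩
      ⟨z, mem_univ z, mem_biUnion (show u ∈ Bᶜ from fun h => by have := h.2; omega)
        (hz.symm ▸ mem_singleton u : u ∈ level z.1 n)⟩
    simp only [mem_iUnion] at hx1 hx2
    obtain ⟨a, ⟨haS, had⟩, hax⟩ := hx1
    obtain ⟨b, hb, hbx⟩ := hx2
    have hab := edge_of_mem_level A.isSurjective hax hbx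
    have har : a ≠ A.root n := fun h => by
      rw [depth_eq_zero_iff.2 h] at had
      omega
    have hbS := mem_spoke_of_edge hS haS har hab
    have hbd : A.depth b < A.depth v := by
      by_contra hcon
      exact hb ⟨hbS, not_lt.1 hcon⟩
    have hle := depth_le_of_edge hab.symm
    rw [eq_of_depth_eq hS haS hvS (by omega)] at hax
    rw [eq_of_depth_eq hS hbS huS (by omega)] at hbx
    exact ⟨x, hbx, hax⟩
  rcases h with rfl | h
  · obtain ⟨x, hx⟩ := exists_level_eq_singleton u
    exact ⟨x, hx.symm ▸ mem_singleton u, hx.symm ▸ mem_singleton u⟩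
  · rcases depth_adj h with hd | hd
    · exact key h hd
    · obtain ⟨x, h1, h2⟩ := key h.symm hd
      exact ⟨x, h2, h1⟩

variable [T2Space A.Spec]

/-- Different points have non-related vertices at all large indices. -/
theorem eventually_not_edge {x y : A.Spec} (hxy : x ≠ y) : ∃ N, ∀ n, N ≤ n →
    ∀ a ∈ level x.1 n, ∀ b ∈ level y.1 n, ¬ Edge (A.graph n) a b := by
  obtain ⟨U, W, hU, hW, hxU, hyW, hUW⟩ := t2_separation hxy
  obtain ⟨N, hN⟩ := exists_nhds_of_mem_isOpen A.isSurjective hU hxU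
  obtain ⟨M, hM⟩ := exists_nhds_of_mem_isOpen A.isSurjective hW hyW
  refine ⟨max N M, fun n hn a ha b hb hab => ?_⟩
  obtain ⟨z, hza, hzb⟩ := exists_mem_level_of_edge hab
  exact disjoint_left.1 hUW (hN n (by omega) a ha z hza) (hM n (by omega) b hb z hzb)

/-- Threads that are related at every index determine the same point of the spectrum. -/
theorem eq_of_aboveThread {s t : ∀ n, A.V n} (hs : A.IsThread s) (ht : A.IsThread t)
    (hst : ∀ n, Edge (A.graph n) (s n) (t n)) {x y : A.Spec}
    (hx : ∀ n, level x.1 n ⊆ aboveThread s n) (hy : ∀ n, level y.1 n ⊆ aboveThread t n) :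
    x = y := by
  by_contra hxy
  obtain ⟨N, hN⟩ := eventually_not_edge hxy
  obtain ⟨a, ha⟩ := level_nonempty A.isSurjective x N
  obtain ⟨b, hb⟩ := level_nonempty A.isSurjective y N
  exact hN N le_rfl a ha b hb (edge_of_mem_aboveThread hs ht hst (hx N ha) (hy N hb))

/-- Disjoint closed sets are separated by chains of a fixed length. -/
theorem exists_no_chain {C D : Set A.Spec} (hC : IsClosed C) (hD : IsClosed D)
    (hCD : Disjoint C D) : ∃ n, ∀ p ∈ trace C n, ∀ q ∈ trace D n, ∀ u v : A.V n,
      Edge (A.graph n) p u → Edge (A.graph n) u v → ¬ Edge (A.graph n) v q := by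
  have hsurj : A.toGraphSeq.IsSurjective := A.isSurjective
  have := A.finite
  by_contra! hcon
  choose f hf using fun n => A.coSurjective (Nat.le_succ n)
  -- Relations carry chains to chains, so counterexamples at all levels would yield four threads,
  -- consecutive ones related at every index. They determine a single point, which would lie in both
  -- `C` and `D`.
  obtain ⟨c, hc, hcf⟩ := exists_compatible_sequence
    (V := fun n => A.V n × A.V n × A.V n × A.V n)
    (fun n c => (f n c.1, f n c.2.1, f n c.2.2.1, f n c.2.2.2))
    (fun n => {c | c.1 ∈ trace C n ∧ c.2.2.2 ∈ trace D n ∧ Edge (A.graph n) c.1 c.2.1 ∧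
      Edge (A.graph n) c.2.1 c.2.2.1 ∧ Edge (A.graph n) c.2.2.1 c.2.2.2})
    (fun n => by
      obtain ⟨p, hp, q, hq, u, v, h1, h2, h3⟩ := hcon n
      exact ⟨(p, u, v, q), hp, hq, h1, h2, h3⟩)
    (fun n c ⟨h1, h2, h3, h4, h5⟩ =>
      ⟨isUpperFamily_trace hsurj C _ (hf n _) h1, isUpperFamily_trace hsurj D _ (hf n _) h2,
        A.edge_preserving _ (hf n _) (hf n _) h3, A.edge_preserving _ (hf n _) (hf n _) h4,
        A.edge_preserving _ (hf n _) (hf n _) h5⟩)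
  have hthread : ∀ g : ∀ n, A.V n, (∀ n, f n (g (n + 1)) = g n) → A.IsThread g :=
    fun g hg => isThread_of_rel_succ fun n => by
      have := hf n (g (n + 1))
      rwa [hg n] at this
  have t1 := hthread (fun n => (c n).1) fun n => by rw [← hcf n]
  have t2 := hthread (fun n => (c n).2.1) fun n => by rw [← hcf n]
  have t3 := hthread (fun n => (c n).2.2.1) fun n => by rw [← hcf n]
  have t4 := hthread (fun n => (c n).2.2.2) fun n => by rw [← hcf n]
  obtain ⟨x1, h1⟩ := exists_spec_subset_aboveThread hsurj fun n => (c n).1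
  obtain ⟨x2, h2⟩ := exists_spec_subset_aboveThread hsurj fun n => (c n).2.1
  obtain ⟨x3, h3⟩ := exists_spec_subset_aboveThread hsurj fun n => (c n).2.2.1
  obtain ⟨x4, h4⟩ := exists_spec_subset_aboveThread hsurj fun n => (c n).2.2.2
  have e1 := eq_of_aboveThread t1 t2 (fun n => (hc n).2.2.1) h1 h2
  have e2 := eq_of_aboveThread t2 t3 (fun n => (hc n).2.2.2.1) h2 h3
  have e3 := eq_of_aboveThread t3 t4 (fun n => (hc n).2.2.2.2) h3 h4
  have hx1 : x1 ∈ C := mem_of_level_subset_trace hsurj hC fun n => (h1 n).trans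
    (aboveThread_subset (isUpperFamily_trace hsurj C) (fun n => (hc n).1) n)
  have hx4 : x4 ∈ D := mem_of_level_subset_trace hsurj hD fun n => (h4 n).trans
    (aboveThread_subset (isUpperFamily_trace hsurj D) (fun n => (hc n).2.1) n)
  exact disjoint_left.1 hCD hx1 (e1.trans (e2.trans e3) ▸ hx4)

/-- Upper families of connected sets determine connected sets of points. -/
theorem isPreconnected_of_isUpperFamily {B : ∀ n, Set (A.V n)} (hB : IsUpperFamily B)
    (hconn : ∀ n, IsConnectedSet (A.graph n) (B n)) :
    IsPreconnected {x : A.Spec | ∀ n, level x.1 n ⊆ B n} := by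
  have hsurj : A.toGraphSeq.IsSurjective := A.isSurjective
  rw [isPreconnected_closed_iff]
  rintro t t' ht ht' hcov ⟨c, hcK, hct⟩ ⟨d, hdK, hdt⟩
  have hK : IsClosed {x : A.Spec | ∀ n, level x.1 n ⊆ B n} := isClosed_setOf_level_subset B
  set K := {x : A.Spec | ∀ n, level x.1 n ⊆ B n} with hKdef
  by_contra hempty
  have hdisj : Disjoint (K ∩ t) (K ∩ t') := disjoint_left.2 fun x h1 h2 =>
    hempty ⟨x, h1.1, h1.2, h2.2⟩
  obtain ⟨n, hn⟩ := exists_no_chain (hK.inter ht) (hK.inter ht') hdisj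
  -- At some late level every vertex of the family lies below one near the trace of a closed piece.
  -- Otherwise the exceptions contain a thread, and the point it determines lies in a piece, a
  -- contradiction.
  have hnear : ∃ k, ∃ h : n ≤ k, ∀ v ∈ B k, ∃ w, A.rel h w v ∧
      ∃ p ∈ trace (K ∩ t) n ∪ trace (K ∩ t') n, Edge (A.graph n) p w := by
    by_contra! hcon
    let Bad : ∀ k, Set (A.V k) := fun k => {v | v ∈ B k ∧ ∀ (h : n ≤ k) w, A.rel h w v →
      ∀ p ∈ trace (K ∩ t) n ∪ trace (K ∩ t') n, ¬ Edge (A.graph n) p w}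
    have hBad : IsUpperFamily (A := A.toGraphSeq) Bad := by
      rintro l k h a b hr ⟨hb, hb'⟩
      exact ⟨hB h hr hb, fun h' w hw =>
        hb' (h'.trans h) w ((A.rel_trans h' h _ _).2 ⟨a, hw, hr⟩)⟩
    obtain ⟨s, hs, hsBad⟩ := exists_thread Bad (fun k => by
      obtain ⟨v, hv, hv'⟩ := hcon (max n k) (le_max_left n k)
      obtain ⟨a, ha⟩ := A.coSurjective (le_max_right n k) v
      exact ⟨a, hBad (le_max_right n k) ha ⟨hv, fun h => hv'⟩⟩) hBad
    obtain ⟨x, hx⟩ := exists_spec_subset_aboveThread hsurj s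
    have hxK : x ∈ K := fun m => (hx m).trans (aboveThread_subset hB (fun m => (hsBad m).1) m)
    obtain ⟨g, hg⟩ := level_nonempty hsurj x n
    refine (hsBad n).2 le_rfl (s n) ((A.rel_self _ _).2 rfl) g ?_ (edge_of_mem_aboveThread hs hs
      (fun _ => Or.inl rfl) (hx n hg) (self_mem_aboveThread s n))
    rcases hcov hxK with h | h
    · exact Or.inl ⟨x, ⟨hxK, h⟩, hg⟩
    · exact Or.inr ⟨x, ⟨hxK, h⟩, hg⟩
  obtain ⟨k, hk, hnear⟩ := hnear
  obtain ⟨v₀, hv₀⟩ := level_nonempty hsurj c k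
  obtain ⟨w₀, hw₀⟩ := A.coSurjective hk v₀
  -- Being near the first piece is inherited by neighbours: crossing over to the second would give a
  -- chain excluded by `hn`. By connectedness all of `B k` is near the first piece, including the
  -- vertices of `d`.
  have hall := isConnectedSet_iff.1 (hconn k)
    {v | v ∈ B k ∧ ∃ w, A.rel hk w v ∧ ∃ p ∈ trace (K ∩ t) n, Edge (A.graph n) p w}
    (fun v hv => hv.1) ⟨v₀, hcK k hv₀, w₀, hw₀, w₀,
      ⟨c, ⟨hcK, hct⟩, isUpperFamily_level hsurj c hk hw₀ hv₀⟩, Or.inl rfl⟩ (by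
      rintro u ⟨hu, w, hw, p, hp, hpw⟩ v hv huv
      obtain ⟨w', hw', q, hq | hq, hqw'⟩ := hnear v hv
      · exact ⟨hv, w', hw', q, hq, hqw'⟩
      · exact absurd hqw'.symm (hn p hp q hq w w' hpw
          (A.edge_preserving hk hw hw' (Or.inr huv))))
  obtain ⟨v₁, hv₁⟩ := level_nonempty hsurj d k
  obtain ⟨-, w, hw, p, hp, hpw⟩ := hall (hdK k hv₁)
  exact hn p hp w ⟨d, ⟨hdK, hdt⟩, isUpperFamily_level hsurj d hk hw hv₁⟩ w w hpw (Or.inl rfl)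
    (Or.inl rfl)

/-- A point lies in both closed sets exactly when its levels lie in both traces, and connected sets
in a tree have connected intersection. -/
theorem isPreconnected_inter {C D : Set A.Spec} (hC : IsClosed C) (hC' : IsPreconnected C)
    (hD : IsClosed D) (hD' : IsPreconnected D) : IsPreconnected (C ∩ D) := by
  have hsurj : A.toGraphSeq.IsSurjective := A.isSurjective
  have : C ∩ D = {x : A.Spec | ∀ n, level x.1 n ⊆ trace C n ∩ trace D n} := by
    ext x
    constructor
    · exact fun h n v hv => ⟨⟨x, h.1, hv⟩, ⟨x, h.2, hv⟩⟩
    · exact fun h => ⟨mem_of_level_subset_trace hsurj hC fun n => (h n).trans inter_subset_left,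
        mem_of_level_subset_trace hsurj hD fun n => (h n).trans inter_subset_right⟩
  rw [this]
  exact isPreconnected_of_isUpperFamily
    (fun h a b hr hb => ⟨isUpperFamily_trace hsurj C h hr hb.1,
      isUpperFamily_trace hsurj D h hr hb.2⟩)
    fun n => (isConnectedSet_trace hsurj hC' n).inter (A.isFan n).1.isAcyclic
      (isConnectedSet_trace hsurj hD' n)

end Hausdorff

end LSeq

/-! ### Arcs -/

/-- A compact metrizable space with a closed linear order embeds into the real line. -/
theorem exists_continuous_strictMono (S : Type u) [TopologicalSpace S] [CompactSpace S]
    [TopologicalSpace.MetrizableSpace S] [LinearOrder S] [OrderClosedTopology S] :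
    ∃ f : S → ℝ, Continuous f ∧ StrictMono f := by
  rcases isEmpty_or_nonempty S with hS | hS
  · exact ⟨fun _ => 0, continuous_const, fun x => (hS.false x).elim⟩
  let _ : MetricSpace S := TopologicalSpace.metrizableSpaceMetric S
  let d := TopologicalSpace.denseSeq S
  -- This is the distance from `d i` to the initial segment ending at `x`. Writing its elements as
  -- `min x y` keeps the index set fixed and compact, which gives continuity in `x`.
  let g : ℕ → S → ℝ := fun i x => sInf ((fun y => dist (d i) (min x y)) '' univ)
  have hcont : ∀ i x, Continuous fun y => dist (d i) (min x y) := fun i x => by fun_prop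
  have hmin : ∀ i x, ∃ z ≤ x, dist (d i) z = g i x := by
    intro i x
    obtain ⟨y, -, hy⟩ := (isCompact_univ.image (hcont i x)).sInf_mem (univ_nonempty.image _)
    exact ⟨_, min_le_left x y, hy⟩
  have hle : ∀ i x, ∀ z ≤ x, g i x ≤ dist (d i) z := by
    intro i x z hz
    refine csInf_le (isCompact_univ.image (hcont i x)).bddBelow ⟨z, mem_univ z, ?_⟩
    exact congrArg (dist (d i)) (min_eq_right hz)
  have hnonneg : ∀ i x, 0 ≤ g i x := by
    intro i x
    obtain ⟨z, -, hz⟩ := hmin i x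
    rw [← hz]
    exact dist_nonneg
  have hbound : ∀ i x, g i x ≤ Metric.diam (univ : Set S) := fun i x =>
    (hle i x x le_rfl).trans
      (Metric.dist_le_diam_of_mem isCompact_univ.isBounded (mem_univ _) (mem_univ _))
  have hgc : ∀ i, Continuous (g i) := fun i =>
    isCompact_univ.continuous_sInf (f := fun x y => dist (d i) (min x y))
      (by simp only [Function.HasUncurry.uncurry]; fun_prop)
  have hanti : ∀ i x x', x ≤ x' → g i x' ≤ g i x := by
    intro i x x' h
    obtain ⟨z, hz, hz'⟩ := hmin i x
    rw [← hz']
    exact hle i x' z (hz.trans h)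
  have hsum : Summable fun i : ℕ => (1 / 2 : ℝ) ^ i * Metric.diam (univ : Set S) :=
    summable_geometric_two.mul_right _
  have hnorm : ∀ i x, ‖-((1 / 2 : ℝ) ^ i * g i x)‖ ≤
      (1 / 2 : ℝ) ^ i * Metric.diam (univ : Set S) := by
    intro i x
    rw [norm_neg, Real.norm_of_nonneg (mul_nonneg (by positivity) (hnonneg i x))]
    exact mul_le_mul_of_nonneg_left (hbound i x) (by positivity)
  -- Initial segments grow with `x`, so every summand is monotone. Strictness for `x < x'` comes
  -- from a dense point within `ε / 2` of `x'`, where the `ε`-ball about `x'` misses the segment up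
  -- to `x`.
  refine ⟨fun x => ∑' i, -((1 / 2 : ℝ) ^ i * g i x), ?_, ?_⟩
  · exact continuous_tsum (fun i => (continuous_const.mul (hgc i)).neg) hsum hnorm
  · intro x x' hxx'
    obtain ⟨ε, hε, hball⟩ := Metric.isOpen_iff.1 (isClosed_Iic (a := x)).isOpen_compl x'
      (by simpa using hxx')
    obtain ⟨i, hi⟩ := Metric.denseRange_iff.1 (TopologicalSpace.denseRange_denseSeq S) x' (ε / 2)
      (by positivity)
    have hs : ∀ x, Summable fun i => -((1 / 2 : ℝ) ^ i * g i x) := fun x =>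
      Summable.of_norm_bounded hsum fun i => hnorm i x
    refine Summable.tsum_lt_tsum (i := i) (fun j => ?_) ?_ (hs x) (hs x')
    · exact neg_le_neg (mul_le_mul_of_nonneg_left (hanti j x x' hxx'.le) (by positivity))
    · refine neg_lt_neg (mul_lt_mul_of_pos_left ?_ (by positivity))
      obtain ⟨z, hz, hz'⟩ := hmin i x
      have h1 := hle i x' x' le_rfl
      have h2 : ε ≤ dist z x' := by
        by_contra! hcon
        exact hball (Metric.mem_ball.2 hcon) hz
      have h3 : dist z x' ≤ dist (d i) z + dist (d i) x' := dist_triangle_left _ _ _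
      have h4 : dist (d i) x' < ε / 2 := by rw [dist_comm]; exact hi
      linarith

section Arc

variable {X : Type u} [TopologicalSpace X] {A C : Set X} {a b e : X}

theorem IsArcBetween.left_mem (h : IsArcBetween A a b) : a ∈ A := by
  obtain ⟨f, -, rfl, rfl, -⟩ := h
  exact mem_range_self _

theorem IsArcBetween.right_mem (h : IsArcBetween A a b) : b ∈ A := by
  obtain ⟨f, -, rfl, -, rfl⟩ := h
  exact mem_range_self _

theorem IsArcBetween.ne (h : IsArcBetween A a b) : a ≠ b := by
  obtain ⟨f, hf, -, rfl, rfl⟩ := h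
  exact hf.injective.ne zero_ne_one

theorem IsArcBetween.isCompact (h : IsArcBetween A a b) : IsCompact A := by
  obtain ⟨f, hf, rfl, -, -⟩ := h
  exact isCompact_range hf.continuous

theorem IsArcBetween.isPreconnected (h : IsArcBetween A a b) : IsPreconnected A := by
  obtain ⟨f, hf, rfl, -, -⟩ := h
  exact isPreconnected_range hf.continuous

/-- An arc is irreducible between its endpoints. -/
theorem IsArcBetween.eq_of_subset (h : IsArcBetween A a b) (hC : IsPreconnected C)
    (hCA : C ⊆ A) (ha : a ∈ C) (hb : b ∈ C) : C = A := by
  obtain ⟨f, hf, rfl, rfl, rfl⟩ := h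
  have himg : f '' (f ⁻¹' C) = C := image_preimage_eq_of_subset hCA
  have hpre : IsPreconnected (f ⁻¹' C) := by
    rw [← hf.isInducing.isPreconnected_image, himg]
    exact hC
  refine hCA.antisymm ?_
  rintro _ ⟨t, rfl⟩
  exact hpre.Icc_subset ha hb ⟨t.2.1, t.2.2⟩

/-- An arc is cut by each of its points into two subcontinua. -/
theorem IsArcBetween.exists_split (h : IsArcBetween A a b) (he : e ∈ A) :
    ∃ C D : Set X, IsCompact C ∧ IsPreconnected C ∧ IsCompact D ∧ IsPreconnected D ∧
      a ∈ C ∧ e ∈ C ∧ b ∈ D ∧ e ∈ D ∧ C ∩ D = {e} := by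
  obtain ⟨f, hf, rfl, rfl, rfl⟩ := h
  obtain ⟨t, rfl⟩ := he
  refine ⟨f '' Iic t, f '' Ici t, isClosed_Iic.isCompact.image hf.continuous,
    ordConnected_Iic.isPreconnected.image _ hf.continuous.continuousOn,
    isClosed_Ici.isCompact.image hf.continuous,
    ordConnected_Ici.isPreconnected.image _ hf.continuous.continuousOn,
    ⟨0, t.2.1, rfl⟩, ⟨t, self_mem_Iic, rfl⟩, ⟨1, t.2.2, rfl⟩, ⟨t, self_mem_Ici, rfl⟩, ?_⟩
  rw [← image_inter hf.injective, Iic_inter_Ici, Icc_self, image_singleton]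

/-- A continuous injective real function on a continuum parametrizes its arcs. -/
theorem isArcBetween_of_injOn [T2Space X] {K : Set X} (hK : IsCompact K)
    (hK' : IsPreconnected K) {h : X → ℝ} (hc : ContinuousOn h K) (hi : InjOn h K) {x y : X}
    (hx : x ∈ K) (hy : y ∈ K) (hxy : h x < h y) :
    IsArcBetween {z | z ∈ K ∧ h z ∈ Icc (h x) (h y)} x y := by
  have : CompactSpace K := isCompact_iff_compactSpace.1 hK
  -- Compactness makes `h` a homeomorphism from `K` onto its image, which is order-convex by
  -- connectedness. The arc is the inverse of `h` composed with the affine map onto `[h x, h y]`.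
  have hemb : IsEmbedding (K.domRestrict h) :=
    (hc.domRestrict.isClosedEmbedding hi.injective).isEmbedding
  let φ := hemb.toHomeomorph
  have hsub : Icc (h x) (h y) ⊆ range (K.domRestrict h) := by
    rw [range_domRestrict]
    exact (hK'.image h hc).Icc_subset (mem_image_of_mem h hx) (mem_image_of_mem h hy)
  have hφ : ∀ s, h (φ.symm s).1 = s.1 := by
    intro s
    have := φ.apply_symm_apply s
    exact congrArg Subtype.val this
  let p : unitInterval → ℝ := fun t => h x + t * (h y - h x)
  have hp : ∀ t, p t ∈ Icc (h x) (h y) := by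
    intro t
    have h1 := t.2.1
    have h2 := t.2.2
    constructor
    · have := mul_nonneg h1 (sub_nonneg.2 hxy.le)
      simp only [p]; linarith
    · have := mul_le_mul_of_nonneg_right h2 (sub_nonneg.2 hxy.le)
      simp only [p]; linarith
  let f : unitInterval → X := fun t => (φ.symm ⟨p t, hsub (hp t)⟩).1
  have hfh : ∀ t, h (f t) = p t := fun t => hφ _
  have hfc : Continuous f := by
    have : Continuous p := by fun_prop
    exact continuous_subtype_val.comp (φ.symm.continuous.comp (this.subtype_mk _))
  have hfi : Function.Injective f := by
    intro s t hst
    have h1 : p s = p t := by rw [← hfh, ← hfh, hst]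
    have h2 : (s : ℝ) * (h y - h x) = t * (h y - h x) := by simp only [p] at h1; linarith
    exact Subtype.ext (mul_right_cancel₀ (sub_pos.2 hxy).ne' h2)
  have hfK : ∀ t, f t ∈ K := fun t => (φ.symm ⟨p t, hsub (hp t)⟩).2
  refine ⟨f, (hfc.isClosedEmbedding hfi).isEmbedding, ?_, ?_, ?_⟩
  · ext z
    constructor
    · rintro ⟨t, rfl⟩
      exact ⟨hfK t, by rw [hfh]; exact hp t⟩
    · rintro ⟨hz, hz1, hz2⟩
      have hpos := sub_pos.2 hxy
      refine ⟨⟨(h z - h x) / (h y - h x), div_nonneg (by linarith) hpos.le,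
        (div_le_one hpos).2 (by linarith)⟩, hi (hfK _) hz ?_⟩
      rw [hfh]
      simp only [p]
      rw [div_mul_cancel₀ _ hpos.ne']
      ring
  · exact hi (hfK _) hx (by rw [hfh]; simp [p])
  · exact hi (hfK _) hy (by rw [hfh]; simp [p])

end Arc

namespace LSeq

variable {A : LSeq.{u}}

/-! ### The root of the spectrum and branches of spokes -/

theorem rel_root {m n : ℕ} (h : m ≤ n) : A.rel h (A.root m) (A.root n) :=
  ((A.spokeMonotone h).1 _).2 rfl

theorem eq_root_of_rel {m n : ℕ} (h : m ≤ n) {a : A.V m} (ha : A.rel h a (A.root n)) :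
    a = A.root m :=
  ((A.spokeMonotone h).1 a).1 ha

theorem level_rootThread (n : ℕ) : level (A := A.toGraphSeq) A.rootThread n = {A.root n} := by
  ext v
  constructor
  · rintro ⟨k, hk⟩
    obtain ⟨rfl, h⟩ := Sigma.mk.inj_iff.1 hk
    exact (eq_of_heq h).symm
  · rintro rfl
    exact ⟨n, rfl⟩

theorem minimal_isSelector_rootThread : Minimal IsSelector A.rootThread := by
  refine (minimal_isSelector_iff A.isSurjective).2 ⟨⟨?_, fun n => ?_⟩, ?_⟩
  · rintro _ ⟨m, a⟩ ⟨h, hr⟩ ⟨n, rfl⟩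
    exact ⟨m, congrArg (vert (A := A.toGraphSeq) m) (eq_root_of_rel h hr).symm⟩
  · rw [level_rootThread]
    exact singleton_nonempty _
  · rintro T ⟨-, hT⟩ hTr _ ⟨n, rfl⟩
    obtain ⟨v, hv⟩ := hT n
    have hv' : v ∈ level (A := A.toGraphSeq) A.rootThread n := hTr hv
    rw [level_rootThread] at hv'
    rw [show v = A.root n from hv'] at hv
    exact hv

variable (A) in
/-- The point of the spectrum formed by the roots. -/
def rootPoint : A.Spec := ⟨A.rootThread, minimal_isSelector_rootThread⟩

theorem level_rootPoint (n : ℕ) : level A.rootPoint.1 n = {A.root n} :=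
  level_rootThread n

/-- The order of a spoke is respected by the relations. -/
theorem exists_rel_of_depth_le {m n : ℕ} (h : m ≤ n) {S : Set (A.V n)} (hS : S ∈ A.spokes n)
    {c c' : A.V n} (hc : c ∈ S) (hc' : c' ∈ S) (hle : A.depth c' ≤ A.depth c) {a : A.V m}
    (ha : A.rel h a c) : ∃ a', A.depth a' ≤ A.depth a ∧ A.rel h a' c' := by
  obtain ⟨T, hT, hST, hmon⟩ := (A.spokeMonotone h).2 S hS
  -- The preimage of the initial segment up to `a` is connected and contains the root and `c`, hence
  -- every vertex of the spoke between them.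
  have hconn := hmon {u | u ∈ T ∧ A.depth u ≤ A.depth a} (fun u hu => hu.1)
    ((A.isFan m).isConnectedSet_initial hT (A.depth a))
  have : c' ∈ {b | b ∈ S ∧ ∃ u ∈ {u | u ∈ T ∧ A.depth u ≤ A.depth a}, A.rel h u b} := by
    refine mem_of_isConnectedSet (w := A.root n) hconn hS
      (⟨hc, a, ⟨hST ⟨c, hc, ha⟩, le_rfl⟩, ha⟩) hc
      ⟨A.root_mem_of_spoke hS, A.root m, ⟨A.root_mem_of_spoke hT, ?_⟩, rel_root h⟩ hc' hle
      fun _ => ?_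
    · rw [depth_root]; exact Nat.zero_le _
    · rw [depth_root]; exact Nat.zero_le _
  obtain ⟨-, u, hu, hur⟩ := this
  exact ⟨u, hu.2, hur⟩

/-- The set of vertices of a spoke related to a given vertex is an interval. -/
theorem rel_of_depth_between {m n : ℕ} (h : m ≤ n) {S : Set (A.V n)} (hS : S ∈ A.spokes n)
    {c c₁ c₂ : A.V n} (hc : c ∈ S) (hc₁ : c₁ ∈ S) (hc₂ : c₂ ∈ S)
    (h₁ : A.depth c₁ ≤ A.depth c) (h₂ : A.depth c ≤ A.depth c₂) {a : A.V m}
    (ha₁ : A.rel h a c₁) (ha₂ : A.rel h a c₂) : A.rel h a c := by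
  obtain ⟨T, hT, hST, hmon⟩ := (A.spokeMonotone h).2 S hS
  have hconn := hmon {a} (singleton_subset_iff.2 (hST ⟨c₁, hc₁, ha₁⟩))
    (isConnectedSet_singleton a)
  have : c ∈ {b | b ∈ S ∧ ∃ u ∈ ({a} : Set (A.V m)), A.rel h u b} :=
    mem_of_isConnectedSet (w := c₁) hconn hS ⟨hc₂, a, rfl, ha₂⟩ hc₂ ⟨hc₁, a, rfl, ha₁⟩ hc h₂
      fun _ => h₁
  obtain ⟨-, u, rfl, hur⟩ := this
  exact hur

namespace Branch

variable (b : A.Branch)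

theorem eq_root_or_mem_spokes (n : ℕ) : b.S n = {A.root n} ∨ b.S n ∈ A.spokes n := by
  obtain ⟨n₀, h1, h2⟩ := b.isBranch
  rcases le_or_gt n₀ n with h | h
  · exact Or.inr (h1 n h).1
  · exact Or.inl (h2 n h).1

theorem mem_spokes_of_mem {n : ℕ} {v : A.V n} (hv : v ∈ b.S n) (hvr : v ≠ A.root n) :
    b.S n ∈ A.spokes n := by
  rcases b.eq_root_or_mem_spokes n with h | h
  · rw [h] at hv
    exact absurd hv hvr
  · exact h

theorem exists_spoke_superset (n : ℕ) : ∃ S ∈ A.spokes n, b.S n ⊆ S := by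
  rcases b.eq_root_or_mem_spokes n with h | h
  · obtain ⟨S, hS, hr⟩ := exists_spoke (A.root n)
    exact ⟨S, hS, by rw [h]; exact singleton_subset_iff.2 hr⟩
  · exact ⟨_, h, subset_rfl⟩

theorem isUpperFamily_S : IsUpperFamily b.S :=
  fun h _ c hr hc => b.relImage_subset _ _ h ⟨c, hc, hr⟩

theorem isConnectedSet_S (n : ℕ) : IsConnectedSet (A.graph n) (b.S n) := by
  have := A.finite n
  rcases b.eq_root_or_mem_spokes n with h | h
  · rw [h]
    exact isConnectedSet_singleton _
  · exact (A.isFan n).isConnectedSet_spoke h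

theorem S_eq_root {n : ℕ} (h : relImage (A.rel n.le_succ) (b.S (n + 1)) ⊆ {A.root n}) :
    b.S n = {A.root n} := by
  obtain ⟨n₀, h1, h2⟩ := b.isBranch
  rcases le_or_gt n₀ n with hn | hn
  · exact absurd h (h1 n hn).2.1.2
  · exact (h2 n hn).1

theorem S_mem_spokes {n : ℕ} (h : ¬ relImage (A.rel n.le_succ) (b.S (n + 1)) ⊆ {A.root n}) :
    b.S n ∈ A.spokes n := by
  obtain ⟨c, hc, hcr⟩ := not_subset.1 h
  exact b.mem_spokes_of_mem (b.relImage_subset _ _ n.le_succ hc) hcr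

/-- Each term determines the preceding one: either its image is collapsed to the root, or the image
contains a non-root vertex, which lies on only one spoke. -/
theorem eq_of_eventually_eq {b b' : A.Branch} {N : ℕ} (h : ∀ n, N ≤ n → b.S n = b'.S n) :
    b = b' := by
  have key : ∀ k n, N ≤ n + k → b.S n = b'.S n := by
    intro k
    induction k with
    | zero => exact h
    | succ k ih =>
      intro n hn
      have hsucc := ih (n + 1) (by omega)
      by_cases hr : relImage (A.rel n.le_succ) (b.S (n + 1)) ⊆ {A.root n}
      · rw [b.S_eq_root hr, b'.S_eq_root (hsucc ▸ hr)]
      · obtain ⟨c, hc, hcr⟩ := not_subset.1 hr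
        exact spoke_eq (b.S_mem_spokes hr) (b'.S_mem_spokes (hsucc ▸ hr)) hcr
          (b.relImage_subset _ _ n.le_succ hc) (b'.relImage_subset _ _ n.le_succ (hsucc ▸ hc))
  have hS : b.S = b'.S := funext fun n => key N n (by omega)
  cases b
  cases b'
  congr

/-- The points of the spectrum whose vertices lie on the spokes of a branch. -/
def points : Set A.Spec := {x | ∀ n, level x.1 n ⊆ b.S n}

theorem mem_points_of_eventually {x : A.Spec} {N : ℕ}
    (h : ∀ n, N ≤ n → level x.1 n ⊆ b.S n) : x ∈ b.points := by
  intro m v hv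
  obtain ⟨w, hw, hr⟩ := exists_rel_of_mem_level A.isSurjective (le_max_left m N) hv
  exact b.isUpperFamily_S _ hr (h _ (le_max_right m N) hw)

theorem rootPoint_mem_points : A.rootPoint ∈ b.points := by
  intro n v hv
  rw [level_rootPoint] at hv
  rw [show v = A.root n from hv]
  exact b.root_mem n

theorem isClosed_points : IsClosed b.points := isClosed_setOf_level_subset b.S

theorem isUpperFamily_core : IsUpperFamily b.core :=
  isUpperFamily_of_isUpperRestriction b.core_isUpperRestriction

/-- If every vertex below `a` dropped out of the image of some later spoke, finiteness would give
one index by which all have dropped out. But `a` itself lies in the image of that spoke. -/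
theorem isSurjective_coreSeq : b.coreSeq.IsSurjective := by
  rintro m n h ⟨a, ha⟩
  have := A.finite n
  by_contra! hcon
  have hex : ∀ c : A.V n, A.rel h a c → ∃ k, ∃ _ : n ≤ k, ∀ d ∈ b.S k, ¬ A.rel ‹_› c d := by
    intro c hac
    by_contra! hc
    refine hcon ⟨c, fun k hk => ?_⟩ hac
    obtain ⟨d, hd, hcd⟩ := hc k hk
    exact ⟨d, hd, hcd⟩
  choose! k hk using hex
  obtain ⟨K, hK⟩ := (finite_range k).bddAbove
  have hnK : n ≤ max n K := le_max_left n K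
  obtain ⟨d, hd, had⟩ := ha (max n K) (h.trans hnK)
  obtain ⟨c, hac, hcd⟩ := (A.rel_trans h hnK a d).1 had
  obtain ⟨hnk, hk'⟩ := hk c hac
  have hkK : k c ≤ max n K := (hK ⟨c, rfl⟩).trans (le_max_right n K)
  obtain ⟨d', hcd', hdd'⟩ := (A.rel_trans hnk hkK c d).1 hcd
  exact hk' d' (b.isUpperFamily_S hkK hdd' hd) hcd'

/-- A vertex of a point lies above vertices of the same point at every later index, so a point on
the spokes lies in the core automatically. -/
theorem mem_points_iff {x : A.Spec} : x ∈ b.points ↔ ∀ n, level x.1 n ⊆ b.core n := by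
  constructor
  · intro h n v hv k hk
    obtain ⟨w, hw, hr⟩ := exists_rel_of_mem_level A.isSurjective hk hv
    exact ⟨w, h k hw, hr⟩
  · intro h n v hv
    obtain ⟨w, hw, hr⟩ := h n hv n le_rfl
    exact b.isUpperFamily_S le_rfl hr hw

theorem subSpec_eq_points : b.subSpec = b.points := by
  ext x
  rw [mem_points_iff]
  exact mem_subSpec_iff b.core_isUpperRestriction A.isSurjective b.isSurjective_coreSeq

theorem nondegenerate_iff : b.Nondegenerate ↔ ∃ x ∈ b.points, x ≠ A.rootPoint := by
  obtain ⟨f, ⟨hf, -⟩, hr⟩ := isClosedSubSpec_and_range b.core_isUpperRestriction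
    A.isSurjective b.isSurjective_coreSeq
  have hr' : range f = b.points := hr.trans b.subSpec_eq_points
  obtain ⟨s₀, hs₀⟩ : A.rootPoint ∈ range f := hr' ▸ b.rootPoint_mem_points
  constructor
  · intro h
    by_contra! hcon
    refine h ⟨s₀, fun s => hf.injective ?_⟩
    have hs : f s ∈ b.points := hr' ▸ mem_range_self s
    rw [hs₀]
    exact hcon _ hs
  · rintro ⟨x, hx, hxr⟩ ⟨s, hs⟩
    obtain ⟨s₁, rfl⟩ : x ∈ range f := hr' ▸ hx
    rw [hs s₁, ← hs s₀, hs₀] at hxr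
    exact hxr rfl

end Branch

/-- A compatible sequence of spokes extends to a branch. -/
theorem exists_branch_of_spokes (N : ℕ) : ∀ σ : ∀ n, Set (A.V n),
    (∀ n, N ≤ n → σ n ∈ A.spokes n ∧ {A.root n} ⊂ relImage (A.rel n.le_succ) (σ (n + 1)) ∧
      relImage (A.rel n.le_succ) (σ (n + 1)) ⊆ σ n) →
    ∃ b : A.Branch, ∀ n, N ≤ n → b.S n = σ n := by
  induction N with
  | zero => exact fun σ hσ => ⟨⟨σ, 0, hσ, fun m h => absurd h (Nat.not_lt_zero m)⟩, fun _ _ => rfl⟩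
  | succ N ih =>
    intro σ hσ
    have hroot : ∀ m (h : m ≤ N + 1), A.root m ∈ relImage (A.rel h) (σ (N + 1)) :=
      fun m h => ⟨_, A.root_mem_of_spoke (hσ (N + 1) le_rfl).1, rel_root h⟩
    by_cases hr : relImage (A.rel N.le_succ) (σ (N + 1)) ⊆ {A.root N}
    -- The spoke at `N + 1` is collapsed at index `N`, so the branch begins at `N + 1`.
    · classical
      refine ⟨⟨fun n => if N + 1 ≤ n then σ n else {A.root n}, N + 1, fun n hn => ?_,
        fun m hm => ⟨if_neg hm.not_ge, ?_⟩⟩, fun n hn => if_pos hn⟩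
      · rw [if_pos hn, if_pos (hn.trans n.le_succ)]
        exact hσ n hn
      · rw [if_pos le_rfl]
        refine subset_antisymm ?_ (singleton_subset_iff.2 (hroot m hm.le))
        rintro a ⟨c, hc, hac⟩
        obtain ⟨d, had, hdc⟩ := (A.rel_trans (Nat.lt_succ_iff.1 hm) N.le_succ a c).1 hac
        rw [show d = A.root N from hr ⟨c, hc, hdc⟩] at had
        exact eq_root_of_rel _ had
    -- Otherwise the spoke containing the image prolongs the sequence one index down, and the
    -- induction hypothesis applies.
    · obtain ⟨T, hT, hσT, -⟩ := (A.spokeMonotone N.le_succ).2 _ (hσ (N + 1) le_rfl).1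
      classical
      obtain ⟨b, hb⟩ := ih (Function.update σ N T) (fun n hn => by
        rcases hn.eq_or_lt with rfl | hn
        · rw [Function.update_self, Function.update_of_ne (by omega)]
          exact ⟨hT, ⟨singleton_subset_iff.2 (hroot N N.le_succ), hr⟩, hσT⟩
        · rw [Function.update_of_ne (by omega), Function.update_of_ne (by omega)]
          exact hσ n hn)
      exact ⟨b, fun n hn => by rw [hb n (by omega), Function.update_of_ne (by omega)]⟩

/-! ### Each point other than the root point lies on exactly one branch -/

section Hausdorff

variable [ConnectedSpace A.Spec] [T2Space A.Spec]

theorem eventually_ne_root {x : A.Spec} (hx : x ≠ A.rootPoint) :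
    ∃ N, ∀ n, N ≤ n → ∀ a ∈ level x.1 n, a ≠ A.root n := by
  obtain ⟨N, hN⟩ := eventually_not_edge hx
  exact ⟨N, fun n hn a ha h => hN n hn a ha (A.root n) (by rw [level_rootPoint]; rfl) (Or.inl h)⟩

theorem Branch.eq_of_mem_points {b b' : A.Branch} {x : A.Spec} (hx : x ≠ A.rootPoint)
    (h : x ∈ b.points) (h' : x ∈ b'.points) : b = b' := by
  obtain ⟨N, hN⟩ := eventually_ne_root hx
  refine Branch.eq_of_eventually_eq (N := N) fun n hn => ?_
  obtain ⟨a, ha⟩ := level_nonempty A.isSurjective x n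
  have har := hN n hn a ha
  exact spoke_eq (b.mem_spokes_of_mem (h n ha) har) (b'.mem_spokes_of_mem (h' n ha) har) har
    (h n ha) (h' n ha)

/-- Once the levels of `x` avoid the root, each consists of pairwise related vertices and so lies on
a single spoke. A non-root image vertex forces consecutive spokes to be compatible. -/
theorem exists_branch_of_ne {x : A.Spec} (hx : x ≠ A.rootPoint) :
    ∃ b : A.Branch, x ∈ b.points := by
  obtain ⟨N, hN⟩ := eventually_ne_root hx
  choose a ha using level_nonempty A.isSurjective x
  choose σ hσ haσ using fun n => exists_spoke (a n)
  have hsub : ∀ n, N ≤ n → level x.1 n ⊆ σ n := fun n hn v hv =>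
    mem_spoke_of_edge (hσ n) (haσ n) (hN n hn _ (ha n))
      (edge_of_mem_level A.isSurjective (ha n) hv)
  obtain ⟨b, hb⟩ := exists_branch_of_spokes N σ (fun n hn => by
    obtain ⟨g, hg⟩ := A.coSurjective n.le_succ (a (n + 1))
    have hgx := isUpperFamily_level A.isSurjective x n.le_succ hg (ha (n + 1))
    have hgr := hN n hn g hgx
    obtain ⟨T, hT, hσT, -⟩ := (A.spokeMonotone n.le_succ).2 _ (hσ (n + 1))
    have hgT : g ∈ T := hσT ⟨_, haσ (n + 1), hg⟩
    rw [spoke_eq hT (hσ n) hgr hgT (hsub n hn hgx)] at hσT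
    refine ⟨hσ n, ⟨singleton_subset_iff.2 ⟨_, A.root_mem_of_spoke (hσ (n + 1)), rel_root _⟩,
      fun h => hgr (h ⟨_, haσ (n + 1), hg⟩)⟩, hσT⟩)
  exact ⟨b, b.mem_points_of_eventually (N := N) fun n hn => by rw [hb n hn]; exact hsub n hn⟩

end Hausdorff

end LSeq

namespace LSeq

variable {A : LSeq.{u}}

/-! ### The order of the points of a branch -/

/-- Some vertices of `x` and `y` are not related and the former is closer to the root. -/
def Before (x y : A.Spec) : Prop :=
  ∃ n, ∃ g ∈ level x.1 n, ∃ h ∈ level y.1 n, A.depth g + 1 < A.depth h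

theorem isOpen_setOf_before : IsOpen {p : A.Spec × A.Spec | Before p.1 p.2} := by
  have : {p : A.Spec × A.Spec | Before p.1 p.2} =
      ⋃ (n) (g : A.V n) (h : A.V n) (_ : A.depth g + 1 < A.depth h),
        {x : A.Spec | g ∈ level x.1 n} ×ˢ {y : A.Spec | h ∈ level y.1 n} := by
    ext ⟨x, y⟩
    simp only [mem_iUnion]
    constructor
    · rintro ⟨n, g, hg, h, hh, hd⟩
      exact ⟨n, g, h, hd, hg, hh⟩
    · rintro ⟨n, g, h, hd, hg, hh⟩
      exact ⟨n, g, hg, h, hh, hd⟩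
  rw [this]
  exact isOpen_iUnion fun n => isOpen_iUnion fun g => isOpen_iUnion fun h => isOpen_iUnion
    fun _ => (isOpen_setOf_mem_level g).prod (isOpen_setOf_mem_level h)

theorem not_before_rootPoint (x : A.Spec) : ¬ Before x A.rootPoint := by
  rintro ⟨n, g, -, h, hh, hd⟩
  rw [level_rootPoint] at hh
  rw [show h = A.root n from hh, depth_root] at hd
  omega

theorem metrizableSpace_spec [T2Space A.Spec] : TopologicalSpace.MetrizableSpace A.Spec := by
  have := compactSpace_spec (A := A.toGraphSeq) A.isSurjective
  have := secondCountableTopology_spec (A := A.toGraphSeq)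
  infer_instance

namespace Branch

variable {b : A.Branch} {x y z : A.Spec}

/-- If the vertices were reversed or related at a late index, `exists_rel_of_depth_le` or edge
preservation would bring the original vertex of `y` to depth at most one more than that of `x`. -/
theorem eventually_depth_lt (hx : x ∈ b.points) (hy : y ∈ b.points) (h : Before x y) :
    ∃ N, ∀ n, N ≤ n → ∀ g ∈ level x.1 n, ∀ h ∈ level y.1 n, A.depth g + 1 < A.depth h := by
  obtain ⟨m, g, hg, k, hk, hd⟩ := h
  obtain ⟨N, hmN, hN⟩ := eventually_rel_of_mem_level A.isSurjective hg
  obtain ⟨M, hmM, hM⟩ := eventually_rel_of_mem_level A.isSurjective hk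
  refine ⟨max N M, fun n hn g' hg' k' hk' => ?_⟩
  have hmn : m ≤ n := hmN.trans ((le_max_left N M).trans hn)
  have hgg := hN n ((le_max_left N M).trans hn) hmn g' hg'
  have hkk := hM n ((le_max_right N M).trans hn) hmn k' hk'
  obtain ⟨S, hS, hbS⟩ := b.exists_spoke_superset n
  have hgS := hbS (hx n hg')
  have hkS := hbS (hy n hk')
  by_contra! hcon
  rcases le_or_gt (A.depth k') (A.depth g') with hle | hlt
  · obtain ⟨a, ha, hak⟩ := exists_rel_of_depth_le hmn hS hgS hkS hle hgg
    have := depth_le_of_edge (A.edge_preserving hmn hak hkk (Or.inl rfl))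
    omega
  · have := depth_le_of_edge (A.edge_preserving hmn hgg hkk
      (edge_of_depth_le hS hgS hkS hcon (by omega)))
    omega

theorem before_asymm (hx : x ∈ b.points) (hy : y ∈ b.points) (h : Before x y) :
    ¬ Before y x := by
  intro h'
  obtain ⟨N, hN⟩ := eventually_depth_lt hx hy h
  obtain ⟨M, hM⟩ := eventually_depth_lt hy hx h'
  obtain ⟨g, hg⟩ := level_nonempty A.isSurjective x (max N M)
  obtain ⟨k, hk⟩ := level_nonempty A.isSurjective y (max N M)
  have h1 := hN _ (le_max_left N M) g hg k hk
  have h2 := hM _ (le_max_right N M) k hk g hg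
  omega

theorem before_trans (hx : x ∈ b.points) (hy : y ∈ b.points) (hz : z ∈ b.points)
    (h : Before x y) (h' : Before y z) : Before x z := by
  obtain ⟨N, hN⟩ := eventually_depth_lt hx hy h
  obtain ⟨M, hM⟩ := eventually_depth_lt hy hz h'
  obtain ⟨g, hg⟩ := level_nonempty A.isSurjective x (max N M)
  obtain ⟨k, hk⟩ := level_nonempty A.isSurjective y (max N M)
  obtain ⟨l, hl⟩ := level_nonempty A.isSurjective z (max N M)
  have h1 := hN _ (le_max_left N M) g hg k hk
  have h2 := hM _ (le_max_right N M) k hk l hl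
  exact ⟨_, g, hg, l, hl, by omega⟩

variable [ConnectedSpace A.Spec] [T2Space A.Spec]

/-- Distinct points have unrelated vertices on a common spoke, and the depths of these differ by at
least two. -/
theorem before_or_before (hx : x ∈ b.points) (hy : y ∈ b.points) (hxy : x ≠ y) :
    Before x y ∨ Before y x := by
  obtain ⟨N, hN⟩ := eventually_not_edge hxy
  obtain ⟨g, hg⟩ := level_nonempty A.isSurjective x N
  obtain ⟨k, hk⟩ := level_nonempty A.isSurjective y N
  obtain ⟨S, hS, hbS⟩ := b.exists_spoke_superset N
  by_contra! hcon
  refine hN N le_rfl g hg k hk (edge_of_depth_le hS (hbS (hx N hg)) (hbS (hy N hk)) ?_ ?_)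
  · by_contra! h
    exact hcon.1 ⟨N, g, hg, k, hk, h⟩
  · by_contra! h
    exact hcon.2 ⟨N, k, hk, g, hg, h⟩

theorem before_rootPoint (hx : x ∈ b.points) (hxr : x ≠ A.rootPoint) :
    Before A.rootPoint x :=
  (before_or_before hx b.rootPoint_mem_points hxr).resolve_left (not_before_rootPoint x)

variable (b)

theorem isPreconnected_points : IsPreconnected b.points :=
  isPreconnected_of_isUpperFamily b.isUpperFamily_S b.isConnectedSet_S

omit [ConnectedSpace A.Spec] [T2Space A.Spec] in
theorem isCompact_points : IsCompact b.points := by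
  have := compactSpace_spec (A := A.toGraphSeq) A.isSurjective
  exact b.isClosed_points.isCompact

/-- The points of a branch are linearly ordered. -/
noncomputable abbrev linearOrder : LinearOrder b.points where
  le x y := ¬ Before y.1 x.1
  lt x y := Before x.1 y.1
  le_refl x := fun h => before_asymm x.2 x.2 h h
  le_trans x y z hxy hyz h := by
    by_cases hxy' : x.1 = y.1
    · exact hyz (hxy' ▸ h)
    · rcases before_or_before x.2 y.2 hxy' with h' | h'
      · exact hyz (before_trans z.2 x.2 y.2 h h')
      · exact hxy h'
  le_antisymm x y hxy hyx := by
    by_contra hne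
    rcases before_or_before x.2 y.2 fun h => hne (Subtype.ext h) with h | h
    · exact hyx h
    · exact hxy h
  le_total x y := by
    by_contra! h
    exact before_asymm y.2 x.2 h.1 h.2
  lt_iff_le_not_ge x y := by
    rw [not_not]
    exact ⟨fun h => ⟨before_asymm x.2 y.2 h, h⟩, fun h => h.2⟩
  toDecidableLE := Classical.decRel _

/-- A continuous parametrization of the points of a branch that respects their order. -/
theorem exists_param : ∃ f : A.Spec → ℝ, ContinuousOn f b.points ∧ f A.rootPoint = 0 ∧
    ∀ x ∈ b.points, ∀ y ∈ b.points, f x < f y ↔ Before x y := by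
  have := compactSpace_spec (A := A.toGraphSeq) A.isSurjective
  have := metrizableSpace_spec (A := A)
  have : CompactSpace b.points := isCompact_iff_compactSpace.1 b.isCompact_points
  let _ := b.linearOrder
  have : OrderClosedTopology b.points := ⟨by
    have h1 : Continuous fun p : b.points × b.points => ((p.2.1, p.1.1) : A.Spec × A.Spec) := by
      fun_prop
    exact (isOpen_setOf_before.preimage h1).isClosed_compl⟩
  obtain ⟨f, hf, hmono⟩ := exists_continuous_strictMono b.points
  classical
  let r : b.points := ⟨A.rootPoint, b.rootPoint_mem_points⟩
  have hval : ∀ x (hx : x ∈ b.points),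
      (if h : x ∈ b.points then f ⟨x, h⟩ - f r else 0) = f ⟨x, hx⟩ - f r := fun x hx => dif_pos hx
  -- The shift puts the root point at `0`; the value off the branch is irrelevant.
  refine ⟨fun x => if h : x ∈ b.points then f ⟨x, h⟩ - f r else 0, ?_, ?_, ?_⟩
  · rw [continuousOn_iff_continuous_domRestrict]
    have : b.points.domRestrict (fun x => if h : x ∈ b.points then f ⟨x, h⟩ - f r else 0) =
        fun x => f x - f r := funext fun x => hval x.1 x.2
    rw [this]
    exact hf.sub continuous_const
  · exact (hval _ b.rootPoint_mem_points).trans (sub_self _)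
  · intro x hx y hy
    simp only
    rw [hval x hx, hval y hy, sub_lt_sub_iff_right, hmono.lt_iff_lt]
    exact Iff.rfl

variable {b}

/-- The last point of a branch. -/
theorem exists_last (b : A.Branch) : ∃ e ∈ b.points, ∀ x ∈ b.points, ¬ Before e x := by
  obtain ⟨f, hf, -, hlt⟩ := b.exists_param
  obtain ⟨e, he, hmax⟩ := b.isCompact_points.exists_isMaxOn
    ⟨_, b.rootPoint_mem_points⟩ hf
  exact ⟨e, he, fun x hx h => ((hlt e he x hx).2 h).not_ge (hmax hx)⟩

/-! ### Continua meeting a branch -/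

variable {C : Set A.Spec}

omit [ConnectedSpace A.Spec] [T2Space A.Spec] in
-- The connected trace of `C` contains vertices of `z` at arbitrarily late indices, as they lie
-- between those of `x` and `y` on a spoke. Closedness does the rest.
theorem mem_of_before_of_before (hC : IsClosed C) (hC' : IsPreconnected C) (hx : x ∈ b.points)
    (hy : y ∈ b.points) (hz : z ∈ b.points) (hxC : x ∈ C) (hyC : y ∈ C) (hxz : Before x z)
    (hzy : Before z y) : z ∈ C := by
  have hsurj : A.toGraphSeq.IsSurjective := A.isSurjective
  obtain ⟨N, hN⟩ := eventually_depth_lt hx hz hxz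
  obtain ⟨M, hM⟩ := eventually_depth_lt hz hy hzy
  refine mem_of_level_subset hsurj hC fun K => ⟨max K (max N M), le_max_left _ _, ?_⟩
  set n := max K (max N M)
  obtain ⟨g, hg⟩ := level_nonempty hsurj x n
  obtain ⟨k, hk⟩ := level_nonempty hsurj y n
  obtain ⟨l, hl⟩ := level_nonempty hsurj z n
  have h1 := hN n (by omega) g hg l hl
  have h2 := hM n (by omega) l hl k hk
  obtain ⟨S, hS, hbS⟩ := b.exists_spoke_superset n
  exact ⟨l, hl, mem_of_isConnectedSet (isConnectedSet_trace hsurj hC' n) hS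
    (⟨y, hyC, hk⟩ : k ∈ trace C n) (hbS (hy n hk)) (⟨x, hxC, hg⟩ : g ∈ trace C n)
    (hbS (hz n hl)) (by omega) fun _ => by omega⟩

/-- At late indices the connected trace of `C` contains a non-root vertex of the spoke as well as a
vertex off it, and a spoke can be left only through the root. -/
theorem rootPoint_mem_of_not_mem (hC : IsClosed C) (hC' : IsPreconnected C)
    (hx : x ∈ b.points) (hy : y ∉ b.points) (hxC : x ∈ C) (hyC : y ∈ C) :
    A.rootPoint ∈ C := by
  by_cases hxr : x = A.rootPoint
  · rwa [← hxr]
  have hsurj : A.toGraphSeq.IsSurjective := A.isSurjective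
  obtain ⟨N, hN⟩ := eventually_ne_root hxr
  obtain ⟨m, v, hv, hvS⟩ : ∃ m, ∃ v ∈ level y.1 m, v ∉ b.S m := by
    by_contra! hcon
    exact hy fun m v hv => hcon m v hv
  obtain ⟨M, hmM, hM⟩ := eventually_rel_of_mem_level hsurj hv
  refine mem_of_level_subset hsurj hC fun K => ⟨max K (max N M), le_max_left _ _, ?_⟩
  set n := max K (max N M)
  obtain ⟨g, hg⟩ := level_nonempty hsurj x n
  obtain ⟨k, hk⟩ := level_nonempty hsurj y n
  have hgr := hN n (by omega) g hg
  have hS := b.mem_spokes_of_mem (hx n hg) hgr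
  have hkS : k ∉ b.S n := fun h =>
    hvS (b.isUpperFamily_S (by omega) (hM n (by omega) (by omega) k hk) h)
  refine ⟨A.root n, by rw [level_rootPoint]; rfl, mem_of_isConnectedSet
    (isConnectedSet_trace hsurj hC' n) hS (⟨x, hxC, hg⟩ : g ∈ trace C n) (hx n hg)
    (⟨y, hyC, hk⟩ : k ∈ trace C n) (b.root_mem n) ?_ fun h => absurd h hkS⟩
  rw [depth_root]
  exact Nat.zero_le _

/-- A continuum that contains a point of a branch and some other point contains another point of
the branch. -/
theorem exists_mem_points_ne (hC : IsClosed C) (hC' : IsPreconnected C) (hx : x ∈ b.points)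
    (hxr : x ≠ A.rootPoint) (hxC : x ∈ C) (hyC : y ∈ C) (hyx : y ≠ x) :
    ∃ z ∈ b.points, z ∈ C ∧ z ≠ x := by
  by_cases hy : y ∈ b.points
  · exact ⟨y, hy, hyC, hyx⟩
  · exact ⟨A.rootPoint, b.rootPoint_mem_points,
      rootPoint_mem_of_not_mem hC hC' hx hy hxC hyC, hxr.symm⟩

/-- Two continua containing a point of a branch that both contain a point before it, or both
contain a point after it, meet in another point. -/
theorem exists_mem_inter_ne {D : Set A.Spec} (hC : IsClosed C) (hC' : IsPreconnected C)
    (hD : IsClosed D) (hD' : IsPreconnected D) (hx : x ∈ b.points) (hxC : x ∈ C) (hxD : x ∈ D)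
    (hy : y ∈ b.points) (hyC : y ∈ C) (hyx : y ≠ x) (hz : z ∈ b.points) (hzD : z ∈ D)
    (hzx : z ≠ x) (h : Before y x ↔ Before z x) : ∃ w ∈ C ∩ D, w ≠ x := by
  by_cases hyz : y = z
  · subst hyz
    exact ⟨y, ⟨hyC, hzD⟩, hyx⟩
  rcases before_or_before hy hx hyx with h1 | h1
  · have h2 := h.1 h1
    rcases before_or_before hy hz hyz with h3 | h3
    · exact ⟨z, ⟨mem_of_before_of_before hC hC' hy hx hz hyC hxC h3 h2, hzD⟩, hzx⟩
    · exact ⟨y, ⟨hyC, mem_of_before_of_before hD hD' hz hx hy hzD hxD h3 h1⟩, hyx⟩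
  · have h2 := (before_or_before hz hx hzx).resolve_left
      fun h' => before_asymm hx hy h1 (h.2 h')
    rcases before_or_before hy hz hyz with h3 | h3
    · exact ⟨y, ⟨hyC, mem_of_before_of_before hD hD' hx hz hy hxD hzD h1 h3⟩, hyx⟩
    · exact ⟨z, ⟨mem_of_before_of_before hC hC' hx hy hz hxC hyC h2 h3, hzD⟩, hzx⟩

end Branch

end LSeq
theorem IsArcBetween.symm {X : Type u} [TopologicalSpace X] {A : Set X} {a b : X}
    (h : IsArcBetween A a b) : IsArcBetween A b a := by
  obtain ⟨f, hf, rfl, rfl, rfl⟩ := h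
  refine ⟨f ∘ unitInterval.symmHomeomorph, hf.comp unitInterval.symmHomeomorph.isEmbedding,
    unitInterval.symmHomeomorph.surjective.range_comp f, ?_, ?_⟩
  · simp
  · simp

namespace LSeq

variable {A : LSeq.{u}} [ConnectedSpace A.Spec] [T2Space A.Spec]

/-! ### The spectrum is a fan -/

variable (A) in
-- Three neighbours of the root at index `0` are sole vertices of points. Having equal depth, they
-- lie on different spokes, so these points lie on different branches.
theorem exists_three_branches : ∃ b : Fin 3 → A.Branch, Function.Injective b ∧
    ∀ i, ∃ x ∈ (b i).points, x ≠ A.rootPoint := by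
  obtain ⟨v, hv, hd⟩ := (A.isFan 0).exists_three_neighbors
  choose x hx using fun i => exists_level_eq_singleton (v i)
  have hxr : ∀ i, x i ≠ A.rootPoint := by
    intro i h
    have h1 : v i ∈ level (x i).1 0 := (hx i).symm ▸ mem_singleton (v i)
    rw [h, level_rootPoint] at h1
    have h2 : A.depth (v i) = 1 := hd i
    rw [show v i = A.root 0 from h1, depth_root] at h2
    omega
  choose b hb using fun i => exists_branch_of_ne (hxr i)
  refine ⟨b, fun i j hij => hv ?_, fun i => ⟨x i, hb i, hxr i⟩⟩
  obtain ⟨S, hS, hbS⟩ := (b i).exists_spoke_superset 0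
  have h1 : v i ∈ (b i).S 0 := hb i 0 ((hx i).symm ▸ mem_singleton (v i))
  have h2 : v j ∈ (b j).S 0 := hb j 0 ((hx j).symm ▸ mem_singleton (v j))
  rw [← hij] at h2
  exact eq_of_depth_eq hS (hbS h1) (hbS h2) ((hd i).trans (hd j).symm)

theorem exists_branch (x : A.Spec) : ∃ b : A.Branch, x ∈ b.points := by
  by_cases hx : x = A.rootPoint
  · obtain ⟨b, -, -⟩ := exists_three_branches A
    exact ⟨b 0, hx ▸ (b 0).rootPoint_mem_points⟩
  · exact exists_branch_of_ne hx

namespace Branch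

variable {b b' : A.Branch} {x y e : A.Spec}

theorem points_inter_points (h : b ≠ b') : b.points ∩ b'.points = {A.rootPoint} := by
  ext x
  constructor
  · intro hx
    by_contra hxr
    exact h (eq_of_mem_points hxr hx.1 hx.2)
  · rintro rfl
    exact ⟨b.rootPoint_mem_points, b'.rootPoint_mem_points⟩

theorem injOn_of_param {f : A.Spec → ℝ}
    (hf : ∀ x ∈ b.points, ∀ y ∈ b.points, f x < f y ↔ Before x y) : InjOn f b.points := by
  intro x hx y hy hxy
  by_contra hne
  rcases before_or_before hx hy hne with h | h
  · exact ((hf x hx y hy).2 h).ne hxy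
  · exact ((hf y hy x hx).2 h).ne hxy.symm

theorem exists_arc_of_before (hx : x ∈ b.points) (hy : y ∈ b.points) (h : Before x y) :
    ∃ C, IsArcBetween C x y ∧
      ∀ z, z ∈ C ↔ z ∈ b.points ∧ ¬ Before z x ∧ ¬ Before y z := by
  obtain ⟨f, hf, -, hlt⟩ := b.exists_param
  refine ⟨_, isArcBetween_of_injOn b.isCompact_points b.isPreconnected_points hf
    (injOn_of_param hlt) hx hy ((hlt x hx y hy).2 h), fun z => and_congr_right fun hz => ?_⟩
  rw [← hlt z hz x hx, ← hlt y hy z hz, not_lt, not_lt]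
  exact Iff.rfl

theorem isArcBetween_points (he : e ∈ b.points) (hlast : ∀ x ∈ b.points, ¬ Before e x)
    (her : e ≠ A.rootPoint) : IsArcBetween b.points A.rootPoint e := by
  obtain ⟨C, hC, hCmem⟩ := exists_arc_of_before b.rootPoint_mem_points he
    (before_rootPoint he her)
  rwa [show C = b.points from Set.ext fun z => (hCmem z).trans
    ⟨fun h => h.1, fun h => ⟨h, not_before_rootPoint z, hlast z h⟩⟩] at hC

theorem exists_arc_through_root (hbb : b ≠ b') (hx : x ∈ b.points) (hxr : x ≠ A.rootPoint)
    (hy : y ∈ b'.points) (hyr : y ≠ A.rootPoint) :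
    ∃ C, IsArcBetween C x y ∧ A.rootPoint ∈ C := by
  obtain ⟨f, hf, hf0, hlt⟩ := b.exists_param
  obtain ⟨f', hf', hf0', hlt'⟩ := b'.exists_param
  have hpos : ∀ z ∈ b.points, z ≠ A.rootPoint → 0 < f z := fun z hz hzr => by
    rw [← hf0]
    exact (hlt _ b.rootPoint_mem_points z hz).2 (before_rootPoint hz hzr)
  have hpos' : ∀ z ∈ b'.points, z ≠ A.rootPoint → 0 < f' z := fun z hz hzr => by
    rw [← hf0']
    exact (hlt' _ b'.rootPoint_mem_points z hz).2 (before_rootPoint hz hzr)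
  classical
  -- Two branches meet only in the root point, where both parametrizations vanish. Reversing one of
  -- them glues them into a continuous injection with the root point at `0`.
  let h : A.Spec → ℝ := fun z => if z ∈ b.points then -f z else f' z
  have hb : ∀ z ∈ b.points, h z = -f z := fun z hz => if_pos hz
  have hb' : ∀ z ∈ b'.points, h z = f' z := by
    intro z hz
    by_cases hzb : z ∈ b.points
    · have : z = A.rootPoint := (points_inter_points hbb).subset ⟨hzb, hz⟩
      rw [hb z hzb, this, hf0, hf0', neg_zero]
    · exact if_neg hzb
  have hc : ContinuousOn h (b.points ∪ b'.points) :=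
    (hf.neg.congr hb).union_of_isClosed (hf'.congr hb') b.isClosed_points b'.isClosed_points
  have hsep : ∀ z ∈ b.points, ∀ w ∈ b'.points, h z = h w → z = w := by
    intro z hz w hw hzw
    rw [hb z hz, hb' w hw] at hzw
    by_cases hzr : z = A.rootPoint
    · by_cases hwr : w = A.rootPoint
      · rw [hzr, hwr]
      · have := hpos' w hw hwr
        rw [hzr, hf0] at hzw
        linarith
    · have h1 := hpos z hz hzr
      by_cases hwr : w = A.rootPoint
      · rw [hwr, hf0'] at hzw
        linarith
      · have := hpos' w hw hwr
        linarith
  have hi : InjOn h (b.points ∪ b'.points) := by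
    rintro z (hz | hz) w (hw | hw) hzw
    · rw [hb z hz, hb w hw] at hzw
      exact injOn_of_param hlt hz hw (neg_injective hzw)
    · exact hsep z hz w hw hzw
    · exact (hsep w hw z hz hzw.symm).symm
    · rw [hb' z hz, hb' w hw] at hzw
      exact injOn_of_param hlt' hz hw hzw
  have hxneg : h x < 0 := by
    rw [hb x hx]
    exact neg_lt_zero.2 (hpos x hx hxr)
  have hypos : 0 < h y := by
    rw [hb' y hy]
    exact hpos' y hy hyr
  have hr : h A.rootPoint = 0 := by rw [hb _ b.rootPoint_mem_points, hf0, neg_zero]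
  refine ⟨_, isArcBetween_of_injOn (b.isCompact_points.union b'.isCompact_points)
    (b.isPreconnected_points.union A.rootPoint b.rootPoint_mem_points b'.rootPoint_mem_points
      b'.isPreconnected_points) hc hi (Or.inl hx) (Or.inr hy) (hxneg.trans hypos),
    Or.inl b.rootPoint_mem_points, ?_⟩
  rw [hr]
  exact ⟨hxneg.le, hypos.le⟩

/-- The last point of a branch is an endpoint. -/
theorem isEndpoint_of_last (he : e ∈ b.points) (hlast : ∀ x ∈ b.points, ¬ Before e x)
    (her : e ≠ A.rootPoint) : IsEndpoint e := by
  intro T p q hT heT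
  by_contra! hne
  -- If `e` were interior to the arc, both halves would contain a point of the branch other than
  -- `e`. Both points come before `e`, so the halves would share more than `e`.
  obtain ⟨C, D, hC, hC', hD, hD', hpC, heC, hqD, heD, hCD⟩ := hT.exists_split heT
  obtain ⟨y, hy, hyC, hye⟩ := exists_mem_points_ne hC.isClosed hC' he her heC hpC hne.1.symm
  obtain ⟨z, hz, hzD, hze⟩ := exists_mem_points_ne hD.isClosed hD' he her heD hqD hne.2.symm
  have h1 := (before_or_before hy he hye).resolve_right (hlast y hy)
  have h2 := (before_or_before hz he hze).resolve_right (hlast z hz)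
  obtain ⟨w, hw, hwe⟩ := exists_mem_inter_ne hC.isClosed hC' hD.isClosed hD' he heC heD hy hyC
    hye hz hzD hze (iff_of_true h1 h2)
  rw [hCD] at hw
  exact hwe hw

theorem not_before_of_isEndpoint (hx : IsEndpoint x) (hxb : x ∈ b.points)
    (hxr : x ≠ A.rootPoint) (hy : y ∈ b.points) : ¬ Before x y := by
  intro h
  have hyr : y ≠ A.rootPoint := fun h' => not_before_rootPoint x (h' ▸ h)
  obtain ⟨C, hC, hCmem⟩ := exists_arc_of_before b.rootPoint_mem_points hy
    (before_rootPoint hy hyr)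
  rcases hx C _ _ hC ((hCmem x).2 ⟨hxb, not_before_rootPoint x, before_asymm hxb hy h⟩)
    with h' | h'
  · exact hxr h'
  · rw [h'] at h
    exact before_asymm hy hy h h

/-- The points of a branch form the only arc from the root to its last point. -/
theorem eq_points_of_isArcBetween {C : Set A.Spec} (hC : IsArcBetween C A.rootPoint e)
    (he : e ∈ b.points) (hlast : ∀ x ∈ b.points, ¬ Before e x) : b.points = C := by
  refine hC.eq_of_subset b.isPreconnected_points (fun z hz => ?_) b.rootPoint_mem_points he
  by_cases hzr : z = A.rootPoint
  · rw [hzr]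
    exact hC.left_mem
  by_cases hze : z = e
  · rw [hze]
    exact hC.right_mem
  exact mem_of_before_of_before hC.isCompact.isClosed hC.isPreconnected b.rootPoint_mem_points he
    hz hC.left_mem hC.right_mem (before_rootPoint hz hzr)
    ((before_or_before hz he hze).resolve_right (hlast z hz))

end Branch

/-! ### Endpoints, ramification points and spokes of the spectrum -/

open Branch

theorem not_isEndpoint_rootPoint : ¬ IsEndpoint A.rootPoint := by
  intro h
  obtain ⟨b, hb, hx⟩ := exists_three_branches A
  obtain ⟨x, hx0, hxr⟩ := hx 0
  obtain ⟨y, hy1, hyr⟩ := hx 1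
  obtain ⟨C, hC, hr⟩ := exists_arc_through_root (hb.ne (by decide)) hx0 hxr hy1 hyr
  rcases h C x y hC hr with h | h
  · exact hxr h.symm
  · exact hyr h.symm

theorem isRamificationPoint_iff (x : A.Spec) : IsRamificationPoint x ↔ x = A.rootPoint := by
  constructor
  · rintro ⟨T, hT, hTx⟩
    by_contra hxr
    obtain ⟨b, hxb⟩ := exists_branch x
    have hxT : ∀ i, x ∈ T i := by
      intro i
      obtain ⟨j, hj⟩ : ∃ j, i ≠ j := (exists_ne i).imp fun _ => Ne.symm
      exact ((hTx i j hj).symm.subset rfl).1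
    have hcl : ∀ i, IsClosed (T i) ∧ IsPreconnected (T i) := by
      intro i
      obtain ⟨p, q, h⟩ := hT i
      exact ⟨h.isCompact.isClosed, h.isPreconnected⟩
    have hex : ∀ i, ∃ z ∈ b.points, z ∈ T i ∧ z ≠ x := by
      intro i
      obtain ⟨p, q, h⟩ := hT i
      by_cases hp : p = x
      · exact exists_mem_points_ne (hcl i).1 (hcl i).2 hxb hxr (hxT i) h.right_mem
          (hp ▸ h.ne.symm)
      · exact exists_mem_points_ne (hcl i).1 (hcl i).2 hxb hxr (hxT i) h.left_mem hp
    choose z hzb hzT hzx using hex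
    -- There are only two directions along a branch at `x`, and two arcs taking the same one would
    -- share a further point. Three arcs are one too many.
    have key : ∀ i j, i ≠ j → ¬ (Before (z i) x ↔ Before (z j) x) := by
      intro i j hij h
      obtain ⟨w, hw, hwx⟩ := exists_mem_inter_ne (hcl i).1 (hcl i).2 (hcl j).1 (hcl j).2 hxb
        (hxT i) (hxT j) (hzb i) (hzT i) (hzx i) (hzb j) (hzT j) (hzx j) h
      rw [hTx i j hij] at hw
      exact hwx hw
    have h01 := key 0 1 (by decide)
    have h02 := key 0 2 (by decide)
    have h12 := key 1 2 (by decide)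
    tauto
  · rintro rfl
    obtain ⟨b, hb, hx⟩ := exists_three_branches A
    refine ⟨fun i => (b i).points, fun i => ?_, fun i j hij => points_inter_points (hb.ne hij)⟩
    obtain ⟨x, hxb, hxr⟩ := hx i
    obtain ⟨e, he, hlast⟩ := exists_last (b i)
    refine ⟨_, _, isArcBetween_points he hlast ?_⟩
    rintro rfl
    exact hlast x hxb (before_rootPoint hxb hxr)

theorem exists_isArcBetween {x y : A.Spec} (hxy : x ≠ y) :
    ∃ C : Set A.Spec, IsArcBetween C x y := by
  have key : ∀ {b : A.Branch}, x ∈ b.points → y ∈ b.points →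
      ∃ C : Set A.Spec, IsArcBetween C x y := by
    intro b hx hy
    rcases before_or_before hx hy hxy with h | h
    · obtain ⟨C, hC, -⟩ := exists_arc_of_before hx hy h
      exact ⟨C, hC⟩
    · obtain ⟨C, hC, -⟩ := exists_arc_of_before hy hx h
      exact ⟨C, hC.symm⟩
  obtain ⟨b, hx⟩ := exists_branch x
  obtain ⟨b', hy⟩ := exists_branch y
  by_cases hyb : y ∈ b.points
  · exact key hx hyb
  by_cases hxb : x ∈ b'.points
  · exact key hxb hy
  obtain ⟨C, hC, -⟩ := exists_arc_through_root (fun h : b = b' => hyb (h ▸ hy)) hx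
    (fun h => hxb (h ▸ b'.rootPoint_mem_points)) hy (fun h => hyb (h ▸ b.rootPoint_mem_points))
  exact ⟨C, hC⟩

theorem isFanWithRoot_spec : IsFanWithRoot A.Spec A.rootPoint where
  left :=
    { connected := inferInstance
      compact := compactSpace_spec (A := A.toGraphSeq) A.isSurjective
      metrizable := metrizableSpace_spec
      arcwise := fun _ _ => exists_isArcBetween
      unicoherent := fun _ _ hC hC' hD hD' =>
        isPreconnected_inter hC.isClosed hC'.isPreconnected hD.isClosed hD'.isPreconnected }
  right := isRamificationPoint_iff

/-- A non-root point determines its branch, which gives injectivity. An endpoint is the last point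
of its branch, and irreducibility of arcs makes the branch the only arc from the root point to it.
-/
theorem bijOn_subSpec : BijOn (fun b : A.Branch => b.subSpec) {b | b.Nondegenerate}
    (spokesFrom A.rootPoint) := by
  simp only [subSpec_eq_points]
  refine ⟨fun b hb => ?_, fun b hb b' _ hbb => ?_, ?_⟩
  · obtain ⟨x, hx, hxr⟩ := b.nondegenerate_iff.1 hb
    obtain ⟨e, he, hlast⟩ := exists_last b
    have her : e ≠ A.rootPoint := fun h => hlast x hx (h ▸ before_rootPoint hx hxr)
    exact ⟨e, isEndpoint_of_last he hlast her, isArcBetween_points he hlast her⟩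
  · obtain ⟨x, hx, hxr⟩ := b.nondegenerate_iff.1 hb
    have hx' : x ∈ b'.points := by
      simp only at hbb
      rwa [← hbb]
    exact eq_of_mem_points hxr hx hx'
  · rintro C ⟨e, he, hC⟩
    obtain ⟨b, heb⟩ := exists_branch e
    exact ⟨b, b.nondegenerate_iff.2 ⟨e, heb, hC.ne.symm⟩,
      eq_points_of_isArcBetween hC heb fun x hx => not_before_of_isEndpoint he heb hC.ne.symm hx⟩

end LSeq

namespace LSeq

variable {A : LSeq.{u}}

/-! ### The co-bijective modification of the surjective core -/

namespace Branch

variable (b : A.Branch)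

/-- The vertices that are the only vertices of their index in some point of the branch. -/
def witnessed (n : ℕ) : Set (A.V n) := {v | ∃ p ∈ b.points, level p.1 n = {v}}

/-- The witnessed vertices as vertices of the surjective core. -/
def modification (n : ℕ) : Set (b.coreSeq.V n) := {v | v.1 ∈ b.witnessed n}

variable {b}

theorem witnessed_subset_trace (n : ℕ) : b.witnessed n ⊆ trace b.points n := by
  rintro v ⟨p, hp, hpv⟩
  exact ⟨p, hp, hpv.symm ▸ mem_singleton v⟩

theorem trace_subset_core (n : ℕ) : trace b.points n ⊆ b.core n := by
  rintro v ⟨p, hp, hv⟩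
  exact b.mem_points_iff.1 hp n hv

theorem trace_subset_S (n : ℕ) : trace b.points n ⊆ b.S n := by
  rintro v ⟨p, hp, hv⟩
  exact hp n hv

theorem root_mem_witnessed (n : ℕ) : A.root n ∈ b.witnessed n :=
  ⟨_, b.rootPoint_mem_points, level_rootPoint n⟩

theorem rel_of_level_eq_singleton {p : A.Spec} {m n : ℕ} (h : m ≤ n) {a : A.V m}
    (ha : level p.1 m = {a}) {c : A.V n} (hc : c ∈ level p.1 n) : A.rel h a c := by
  obtain ⟨a', ha'⟩ := A.coSurjective h c
  have := isUpperFamily_level A.isSurjective p h ha' hc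
  rw [ha] at this
  rwa [← show a' = a from this]

theorem rel_of_mem_level_of_eq_singleton {p : A.Spec} {m n : ℕ} (h : m ≤ n) {a : A.V m}
    (ha : a ∈ level p.1 m) {c : A.V n} (hc : level p.1 n = {c}) : A.rel h a c := by
  obtain ⟨c', hc', hr⟩ := exists_rel_of_mem_level A.isSurjective h ha
  rw [hc] at hc'
  rwa [← show c' = c from hc']

theorem eq_of_rel_of_level_eq_singleton {p : A.Spec} {m n : ℕ} (h : m ≤ n) {a a' : A.V m}
    (ha : level p.1 m = {a}) {c : A.V n} (hc : c ∈ level p.1 n) (hr : A.rel h a' c) :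
    a' = a := by
  have := isUpperFamily_level A.isSurjective p h hr hc
  rwa [ha] at this

section Hausdorff

variable [ConnectedSpace A.Spec] [T2Space A.Spec]

/-- The branch is connected and runs from the root point to a point containing `v`. If `u` were
never a sole vertex, the points with a shallower vertex and those with a deeper one would cover it;
a common point would have vertices two levels apart in depth. -/
theorem mem_witnessed_of_depth_lt {n : ℕ} {u v : A.V n} (hu : u ∈ b.S n)
    (hv : v ∈ trace b.points n) (h : A.depth u < A.depth v) : u ∈ b.witnessed n := by
  by_cases hur : u = A.root n
  · rw [hur]
    exact root_mem_witnessed n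
  have hud : 0 < A.depth u := Nat.pos_of_ne_zero fun h => hur (depth_eq_zero_iff.1 h)
  obtain ⟨S, hS, hbS⟩ := b.exists_spoke_superset n
  by_contra hcon
  have hop : ∀ D : Set (A.V n), IsOpen (⋃ a ∈ D, {x : A.Spec | a ∈ level x.1 n}) :=
    fun D => isOpen_biUnion fun a _ => isOpen_setOf_mem_level a
  obtain ⟨q, hq, hvq⟩ := hv
  obtain ⟨p, hp, hp1, hp2⟩ := b.isPreconnected_points _ _
    (hop {w | A.depth w < A.depth u}) (hop {w | A.depth u < A.depth w})
    (fun p hp => by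
      have hex : ∃ w ∈ level p.1 n, A.depth w ≠ A.depth u := by
        by_contra! hall
        refine hcon ⟨p, hp, ?_⟩
        have hsub : level p.1 n ⊆ {u} := fun w hw =>
          eq_of_depth_eq hS (hbS (hp n hw)) (hbS hu) (hall w hw)
        exact hsub.antisymm (singleton_subset_iff.2 (by
          obtain ⟨w, hw⟩ := level_nonempty A.isSurjective p n
          rwa [← show w = u from hsub hw]))
      obtain ⟨w, hw, hwd⟩ := hex
      rcases lt_or_gt_of_ne hwd with h | h
      · exact Or.inl (mem_biUnion (show w ∈ {w | A.depth w < A.depth u} from h) hw)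
      · exact Or.inr (mem_biUnion (show w ∈ {w | A.depth u < A.depth w} from h) hw))
    ⟨A.rootPoint, b.rootPoint_mem_points,
      mem_biUnion (show A.root n ∈ {w | A.depth w < A.depth u} by
        change A.depth (A.root n) < A.depth u
        rwa [depth_root])
      ((level_rootPoint n).symm ▸ mem_singleton _ : A.root n ∈ level A.rootPoint.1 n)⟩
    ⟨q, hq, mem_biUnion (show v ∈ {w | A.depth u < A.depth w} from h) hvq⟩
  simp only [mem_iUnion] at hp1 hp2
  obtain ⟨w, hw, hwp⟩ := hp1
  obtain ⟨w', hw', hwp'⟩ := hp2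
  have h1 : A.depth w < A.depth u := hw
  have h2 : A.depth u < A.depth w' := hw'
  have := depth_le_of_edge (edge_of_mem_level A.isSurjective hwp hwp')
  omega

/-- If the level has two vertices, the shallower one is witnessed by `mem_witnessed_of_depth_lt`; a
sole vertex is witnessed by `p` itself. -/
theorem exists_mem_level_witnessed {p : A.Spec} (hp : p ∈ b.points) (n : ℕ) :
    ∃ v ∈ level p.1 n, v ∈ b.witnessed n := by
  obtain ⟨v, hv⟩ := level_nonempty A.isSurjective p n
  by_cases hsub : level p.1 n ⊆ {v}
  · exact ⟨v, hv, p, hp, hsub.antisymm (singleton_subset_iff.2 hv)⟩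
  · obtain ⟨u, hu, huv⟩ := not_subset.1 hsub
    obtain ⟨S, hS, hbS⟩ := b.exists_spoke_superset n
    have hd : A.depth u ≠ A.depth v := fun h =>
      huv (eq_of_depth_eq hS (hbS (hp n hu)) (hbS (hp n hv)) h)
    rcases lt_or_gt_of_ne hd with h | h
    · exact ⟨u, hu, mem_witnessed_of_depth_lt (hp n hu) ⟨p, hp, hv⟩ h⟩
    · exact ⟨v, hv, mem_witnessed_of_depth_lt (hp n hv) ⟨p, hp, hu⟩ h⟩

variable (b)

theorem isDenseLaxRestriction_modification :
    b.coreSeq.IsDenseLaxRestriction b.modification := by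
  have hsurj : A.toGraphSeq.IsSurjective := A.isSurjective
  constructor
  · intro n
    -- Core vertices that lie below no witnessed vertex of index `n` would contain a thread, and so
    -- determine a point of the branch without any witnessed vertex at that index.
    by_contra! hcon
    let Bad : ∀ k, Set (A.V k) := fun k =>
      {v | v ∈ b.core k ∧ ∀ (h : n ≤ k), ∀ y ∈ b.witnessed n, ¬ A.rel h y v}
    have hBad : IsUpperFamily (A := A.toGraphSeq) Bad := by
      rintro l k h a c hr ⟨hc, hc'⟩
      exact ⟨b.isUpperFamily_core h hr hc, fun h' y hy hya =>
        hc' (h'.trans h) y hy ((A.rel_trans h' h _ _).2 ⟨a, hya, hr⟩)⟩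
    obtain ⟨t, ht, htBad⟩ := exists_thread Bad (fun k => by
      obtain ⟨v, hv⟩ := hcon (max n k) (le_max_left n k)
      obtain ⟨a, ha⟩ := A.coSurjective (le_max_right n k) v.1
      exact ⟨a, hBad (le_max_right n k) ha ⟨v.2, fun h y hy =>
        hv ⟨y, trace_subset_core n (witnessed_subset_trace n hy)⟩ hy⟩⟩) hBad
    obtain ⟨x, hx⟩ := exists_spec_subset_aboveThread hsurj t
    have hxb : x ∈ b.points := b.mem_points_iff.2 fun m =>
      (hx m).trans (aboveThread_subset b.isUpperFamily_core (fun m => (htBad m).1) m)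
    obtain ⟨y, hyx, hy⟩ := exists_mem_level_witnessed hxb n
    obtain ⟨k, hk, hyk⟩ := hx n hyx
    exact (htBad k).2 hk y hy hyk
  · rintro m n h ⟨x, hxc⟩ ⟨p, hp, hpx⟩
    obtain ⟨a, hap, ha⟩ := exists_mem_level_witnessed hp m
    exact ⟨⟨a, b.mem_points_iff.1 hp m hap⟩, ha, rel_of_mem_level_of_eq_singleton h hap hpx⟩

variable {b} in
omit [ConnectedSpace A.Spec] [T2Space A.Spec] in
/-- The witnessed vertices belong to all dense lax restrictions of the core. -/
theorem modification_le {H : ∀ n, Set (b.coreSeq.V n)} (hH : b.coreSeq.IsDenseLaxRestriction H) :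
    b.modification ≤ H := by
  rintro n ⟨v, hvc⟩ ⟨p, hp, hpv⟩
  obtain ⟨k, hk, hdense⟩ := hH.1 n
  obtain ⟨x, hx⟩ := level_nonempty A.isSurjective p k
  obtain ⟨⟨y, hyc⟩, hy, hr⟩ := hdense ⟨x, b.mem_points_iff.1 hp k hx⟩
  obtain rfl : y = v := eq_of_rel_of_level_eq_singleton hk hpv hx hr
  exact hy

theorem isCoBijectiveModification_modification :
    b.coreSeq.IsCoBijectiveModification b.modification := by
  have hsurj : A.toGraphSeq.IsSurjective := A.isSurjective
  refine ⟨⟨b.isDenseLaxRestriction_modification, fun H hH _ => modification_le hH⟩, ?_⟩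
  rintro l m n h h' ⟨a, hac⟩ ⟨pa, hpa, hpaa⟩ ⟨c, hcc⟩ ⟨pc, hpc, hpcc⟩ hr
  obtain ⟨S, hS, hbS⟩ := b.exists_spoke_superset m
  have hapc : a ∈ level pc.1 l := isUpperFamily_level hsurj pc (h.trans h') hr
    (hpcc.symm ▸ mem_singleton c)
  obtain ⟨d, hd, had⟩ := exists_rel_of_mem_level hsurj h hapc
  obtain ⟨d', hd', hdw'⟩ := exists_mem_level_witnessed hpc m
  have hdc' := rel_of_mem_level_of_eq_singleton h' hd' hpcc
  have hcore : ∀ v ∈ level pc.1 m, v ∈ b.core m := b.mem_points_iff.1 hpc m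
  by_cases hdw : d ∈ b.witnessed m
  · exact ⟨⟨d, hcore d hd⟩, hdw, had, rel_of_mem_level_of_eq_singleton h' hd hpcc⟩
  -- An unwitnessed `d` is deeper than all witnessed vertices, so its witnessed companion `d'` is
  -- exactly one step shallower and at least as deep as `z`. Since `a` is related to both `z` and
  -- `d`, it is related to `d'` in between.
  refine ⟨⟨d', hcore d' hd'⟩, hdw', ?_, hdc'⟩
  obtain ⟨z, hz, hzw⟩ := exists_mem_level_witnessed hpa m
  have hle : ∀ v ∈ b.witnessed m, A.depth v < A.depth d := by
    intro v hv
    by_contra! hlt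
    rcases hlt.lt_or_eq with hlt | heq
    · exact hdw (mem_witnessed_of_depth_lt (hpc m hd) (witnessed_subset_trace m hv) hlt)
    · refine hdw ?_
      rwa [eq_of_depth_eq hS (hbS (hpc m hd))
        (hbS (trace_subset_S m (witnessed_subset_trace m hv))) heq]
  have h1 := hle d' hdw'
  have h2 := hle z hzw
  have h3 := depth_le_of_edge (edge_of_mem_level hsurj hd' hd)
  exact rel_of_depth_between h hS (hbS (hpc m hd')) (hbS (hpa m hz)) (hbS (hpc m hd))
    (by omega) h1.le (rel_of_level_eq_singleton h hpaa hz) had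

variable {b} in
theorem eq_modification {H : ∀ n, Set (b.coreSeq.V n)}
    (hH : b.coreSeq.IsCoBijectiveModification H) : H = b.modification :=
  le_antisymm (hH.1.2 b.isDenseLaxRestriction_modification (modification_le hH.1.1))
    (modification_le hH.1.1)

/-! ### The thread of ends -/

/-- The witnessed vertex that is the farthest from the root. -/
def IsDeepest (n : ℕ) (v : A.V n) : Prop :=
  v ∈ b.witnessed n ∧ ∀ w ∈ b.witnessed n, A.depth w ≤ A.depth v

omit [ConnectedSpace A.Spec] [T2Space A.Spec] in
theorem exists_isDeepest (n : ℕ) : ∃ v, b.IsDeepest n v := by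
  have := A.finite n
  obtain ⟨v, hv, hmax⟩ := (toFinite (b.witnessed n)).exists_maximalFor A.depth _
    ⟨_, root_mem_witnessed n⟩
  refine ⟨v, hv, fun w hw => ?_⟩
  by_contra! h
  exact absurd (hmax hw h.le) h.not_ge

variable {b}

omit [ConnectedSpace A.Spec] [T2Space A.Spec] in
theorem IsDeepest.eq_of_le {n : ℕ} {v w : A.V n} (hv : b.IsDeepest n v)
    (hw : w ∈ b.witnessed n) (h : A.depth v ≤ A.depth w) : w = v := by
  obtain ⟨S, hS, hbS⟩ := b.exists_spoke_superset n
  exact eq_of_depth_eq hS (hbS (trace_subset_S n (witnessed_subset_trace n hw)))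
    (hbS (trace_subset_S n (witnessed_subset_trace n hv.1))) (le_antisymm (hv.2 w hw) h)

/-- Let `a` be a witnessed vertex above `w`. As `w` is at least as deep as a witnessed vertex below
`v`, the order along the spoke makes `a` at least as deep as `v`, whence they agree. -/
theorem IsDeepest.rel {m n : ℕ} (h : m ≤ n) {v : A.V m} {w : A.V n} (hv : b.IsDeepest m v)
    (hw : b.IsDeepest n w) : A.rel h v w := by
  obtain ⟨S, hS, hbS⟩ := b.exists_spoke_superset n
  obtain ⟨pv, hpv, hpvv⟩ := hv.1
  obtain ⟨pw, hpw, hpww⟩ := hw.1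
  obtain ⟨a, hap, ha⟩ := exists_mem_level_witnessed hpw m
  have haw := rel_of_mem_level_of_eq_singleton h hap hpww
  obtain ⟨z, hzp, hz⟩ := exists_mem_level_witnessed hpv n
  obtain ⟨a', haa, haz⟩ := exists_rel_of_depth_le h hS
    (hbS (trace_subset_S n (witnessed_subset_trace n hw.1))) (hbS (hpv n hzp)) (hw.2 z hz) haw
  rw [eq_of_rel_of_level_eq_singleton h hpvv hzp haz] at haa
  rwa [← hv.eq_of_le ha haa]

/-- The deepest witnessed vertices belong to the last point of a branch. -/
theorem IsDeepest.mem_level {m : ℕ} {v : A.V m} (hv : b.IsDeepest m v) {e : A.Spec}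
    (he : e ∈ b.points) (hlast : ∀ x ∈ b.points, ¬ Before e x) : v ∈ level e.1 m := by
  obtain ⟨p, hp, hpv⟩ := hv.1
  by_cases hpe : p = e
  · rw [← hpe, hpv]
    rfl
  have hbef := (before_or_before hp he hpe).resolve_right (hlast p hp)
  obtain ⟨N, hN⟩ := eventually_depth_lt hp he hbef
  obtain ⟨a, hae, ha⟩ := exists_mem_level_witnessed he m
  have hmn := le_max_left m N
  obtain ⟨g, hg, hag⟩ := exists_rel_of_mem_level A.isSurjective hmn hae
  obtain ⟨z, hz⟩ := level_nonempty A.isSurjective p (max m N)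
  obtain ⟨S, hS, hbS⟩ := b.exists_spoke_superset (max m N)
  have hlt := hN _ (le_max_right m N) z hz g hg
  obtain ⟨a', haa, haz⟩ := exists_rel_of_depth_le hmn hS (hbS (he _ hg)) (hbS (hp _ hz))
    (by omega) hag
  rw [eq_of_rel_of_level_eq_singleton hmn hpv hz haz] at haa
  rwa [← hv.eq_of_le ha haa]

/-- The last point contains all deepest witnessed vertices, and their upward closure is already a
selector; minimality gives equality. -/
theorem upClosure_eq {t : ∀ n, A.V n} (ht : ∀ n, b.IsDeepest n (t n)) {e : A.Spec}
    (he : e ∈ b.points) (hlast : ∀ x ∈ b.points, ¬ Before e x) :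
    e.1 = A.upClosure t := by
  have hsurj : A.toGraphSeq.IsSurjective := A.isSurjective
  have hsub : A.upClosure t ⊆ e.1 := by
    rintro p ⟨⟨n, v⟩, hv, hp⟩
    have hv' : v = t n := hv
    subst hv'
    exact isUpperSet_of_minimal hsurj e.2 hp ((ht n).mem_level he hlast)
  refine Subset.antisymm (e.2.2 (isSelector_of_upper hsurj ?_ fun n => ?_) hsub) hsub
  · rintro p p' hpp ⟨q, hq, hqp⟩
    exact ⟨q, hq, hqp.trans hpp⟩
  · exact ⟨t n, vert n (t n), rfl, le_rfl⟩

omit [T2Space A.Spec] [ConnectedSpace A.Spec] in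
/-- The deepest witnessed vertex is an end of the modification. -/
theorem IsDeepest.mem_endSet {n : ℕ} {v : b.coreSeq.V n} (hv : b.IsDeepest n v.1) :
    (⟨v, hv.1⟩ : ↥(b.modification n)) ∈
      endSet ((b.coreSeq.graph n).induce (b.modification n)) := by
  have := b.coreSeq.finite n
  change (((b.coreSeq.graph n).induce (b.modification n)).neighborSet _).ncard ≤ 1
  rw [ncard_le_one (toFinite _)]
  obtain ⟨S, hS, hbS⟩ := b.exists_spoke_superset n
  have key : ∀ w : ↥(b.modification n),
      ((b.coreSeq.graph n).induce (b.modification n)).Adj ⟨v, hv.1⟩ w →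
      A.depth v.1 = A.depth w.1.1 + 1 := by
    intro w hw
    have hadj : (A.graph n).Adj v.1 w.1.1 := hw
    have := hv.2 w.1.1 w.2
    rcases depth_adj hadj with h | h <;> omega
  intro w hw w' hw'
  have h1 := key w hw
  have h2 := key w' hw'
  exact Subtype.ext (Subtype.ext (eq_of_depth_eq hS
    (hbS (trace_subset_S n (witnessed_subset_trace n w.2)))
    (hbS (trace_subset_S n (witnessed_subset_trace n w'.2))) (by omega)))

/-- An end of the modification other than the root is its deepest vertex. -/
theorem isDeepest_of_mem_endSet {n : ℕ} {v : b.coreSeq.V n} (hv : v ∈ b.modification n)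
    (hend : (⟨v, hv⟩ : ↥(b.modification n)) ∈
      endSet ((b.coreSeq.graph n).induce (b.modification n)))
    (hvr : v.1 ≠ A.root n) : b.IsDeepest n v.1 := by
  have := b.coreSeq.finite n
  have hsub : b.witnessed n ⊆ b.S n := (witnessed_subset_trace n).trans (trace_subset_S n)
  have hS := b.mem_spokes_of_mem (hsub hv) hvr
  refine ⟨hv, fun w hw => ?_⟩
  by_contra! hlt
  have hvd : A.depth v.1 ≠ 0 := fun h => hvr (depth_eq_zero_iff.1 h)
  -- If some witnessed vertex were deeper than `v`, both neighbours of `v` on the spoke would be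
  -- witnessed, giving `v` degree at least two in the modification.
  obtain ⟨u, hu, hud⟩ := exists_mem_depth_eq hS (hsub hv) (j := A.depth v.1 - 1) (by omega)
  obtain ⟨z, hz, hzd⟩ := exists_mem_depth_eq hS (hsub hw) (j := A.depth v.1 + 1) (by omega)
  have huw : u ∈ b.witnessed n :=
    mem_witnessed_of_depth_lt hu (witnessed_subset_trace n hv) (by omega)
  have hzw : z ∈ b.witnessed n := by
    rcases (show A.depth z ≤ A.depth w by omega).lt_or_eq with h | h
    · exact mem_witnessed_of_depth_lt hz (witnessed_subset_trace n hw) h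
    · rwa [eq_of_depth_eq hS hz (hsub hw) h]
  have hcore := (witnessed_subset_trace n).trans (trace_subset_core (b := b) n)
  have huv : (A.graph n).Adj v.1 u := (adj_of_depth_succ hS hu (hsub hv) (by omega)).symm
  have hzv : (A.graph n).Adj v.1 z := adj_of_depth_succ hS (hsub hv) hz hzd
  have heq := IsGraphFan.eq_of_one_neighbor
    (a := (⟨⟨u, hcore huw⟩, huw⟩ : ↥(b.modification n)))
    (b := (⟨⟨z, hcore hzw⟩, hzw⟩ : ↥(b.modification n))) hend huv hzv
  have huz : u = z := congrArg (fun w : ↥(b.modification n) => w.1.1) heq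
  rw [huz] at hud
  omega

theorem isDeepest_of_isEndThread {t : ∀ n, b.coreSeq.V n} (ht : b.IsEndThread t) (n : ℕ) :
    b.IsDeepest n (t n).1 := by
  obtain ⟨H, hH, hthread, hends, N, hN⟩ := ht
  obtain rfl := eq_modification hH
  have hrel : ∀ (m n : ℕ) (h : m ≤ n), A.rel h (t m).1 (t n).1 := hthread
  have hdeep : ∀ k, (t k).1 ≠ A.root k → b.IsDeepest k (t k).1 := fun k hk => by
    obtain ⟨hm, hend⟩ := hends k
    exact isDeepest_of_mem_endSet hm hend hk
  -- The root may itself be an end of the modification at an early index. Then a later deepest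
  -- vertex lies below it, hence so does every witnessed vertex of that later index, and the deepest
  -- witnessed vertex at `n` can only be the root.
  by_cases hn : (t n).1 = A.root n
  · obtain ⟨v, hv⟩ := b.exists_isDeepest n
    have hM : b.IsDeepest (max n N) (t (max n N)).1 := hdeep _ fun h => by
      have := hrel N (max n N) (le_max_right n N)
      rw [h] at this
      exact hN (eq_root_of_rel _ this)
    have hr := hrel n (max n N) (le_max_left n N)
    rw [hn] at hr
    obtain ⟨p, hp, hpv⟩ := hv.1
    obtain ⟨z, hzp, hz⟩ := exists_mem_level_witnessed hp (max n N)
    obtain ⟨S, hS, hbS⟩ := b.exists_spoke_superset (max n N)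
    have hsub : b.witnessed (max n N) ⊆ S :=
      ((witnessed_subset_trace _).trans (trace_subset_S _)).trans hbS
    have hrz := rel_of_depth_between (le_max_left n N) hS (hsub hz) (A.root_mem_of_spoke hS)
      (hsub hM.1) (by rw [depth_root]; exact Nat.zero_le _) (hM.2 z hz)
      (rel_root (le_max_left n N)) hr
    rw [hn, eq_of_rel_of_level_eq_singleton (le_max_left n N) hpv hzp hrz]
    exact hv
  · exact hdeep n hn

theorem existsUnique_isEndThread (hb : b.Nondegenerate) : ∃! t, b.IsEndThread t := by
  choose v hv using b.exists_isDeepest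
  have hcore : ∀ n, v n ∈ b.core n := fun n =>
    trace_subset_core n (witnessed_subset_trace n (hv n).1)
  refine ⟨fun n => ⟨v n, hcore n⟩, ⟨b.modification, b.isCoBijectiveModification_modification,
    fun m n h => (hv m).rel h (hv n), fun n => ⟨(hv n).1, IsDeepest.mem_endSet (hv n)⟩, ?_⟩, ?_⟩
  · obtain ⟨x, hx, hxr⟩ := b.nondegenerate_iff.1 hb
    obtain ⟨N, hN⟩ := eventually_ne_root hxr
    obtain ⟨w, hwx, hw⟩ := exists_mem_level_witnessed hx N
    refine ⟨N, fun h => hN N le_rfl w hwx (depth_eq_zero_iff.1 ?_)⟩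
    have := (hv N).2 w hw
    rw [show v N = A.root N from h, depth_root] at this
    omega
  · intro t ht
    funext n
    have h := isDeepest_of_isEndThread ht n
    exact Subtype.ext ((hv n).eq_of_le h.1 (h.2 _ (hv n).1))

theorem arc_of_isEndThread (hb : b.Nondegenerate) {t : ∀ n, b.coreSeq.V n}
    (ht : b.IsEndThread t) : ∃ x : A.Spec, x.1 = A.upClosure (fun n => (t n).1) ∧
      IsEndpoint x ∧ x ∈ b.subSpec ∧ IsArcBetween b.subSpec A.rootPoint x := by
  rw [subSpec_eq_points]
  obtain ⟨x, hx, hxr⟩ := b.nondegenerate_iff.1 hb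
  obtain ⟨e, he, hlast⟩ := exists_last b
  have her : e ≠ A.rootPoint := fun h => hlast x hx (h ▸ before_rootPoint hx hxr)
  exact ⟨e, upClosure_eq (isDeepest_of_isEndThread ht) he hlast,
    isEndpoint_of_last he hlast her, he, isArcBetween_points he hlast her⟩

end Hausdorff

theorem isClosedSubSpec_core :
    A.IsClosedSubSpec b.core b.core_isUpperRestriction := by
  obtain ⟨f, hf, -⟩ := isClosedSubSpec_and_range b.core_isUpperRestriction A.isSurjective
    b.isSurjective_coreSeq
  exact ⟨f, hf⟩

end Branch

/-! ### End-preserving relations -/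

theorem root_not_mem_endSet (n : ℕ) : A.root n ∉ endSet (A.graph n) :=
  (A.isFan n).root_not_mem_endSet

/-- Adjacent ends would share a spoke, which has only one end. For co-injectivity, a vertex below
only `a` is replaced by the end of its spoke: that end is related only to ends of the image spoke,
and `a` is the only one. -/
theorem isInD_endSeq (hA : A.IsInX) : (A.endSeq hA).IsInD := by
  constructor
  · intro n
    ext ⟨v, hv⟩ ⟨w, hw⟩
    refine iff_of_false (fun h => ?_) (fun h => h)
    have hadj : (A.graph n).Adj v w := h
    obtain ⟨S, hS, hvS⟩ := exists_spoke v
    have hwS := mem_spoke_of_edge hS hvS (fun h => root_not_mem_endSet n (h ▸ hv)) (Or.inr hadj)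
    obtain ⟨e, -, -, -, he⟩ := exists_end hS
    exact hadj.ne ((he v hvS hv).trans (he w hwS hw).symm)
  · rintro m n h ⟨a, ha⟩
    obtain ⟨c, hc⟩ := A.coInjective h a
    obtain ⟨S, hS, hcS⟩ := exists_spoke c
    obtain ⟨T, hT, hST, -⟩ := (A.spokeMonotone h).2 S hS
    obtain ⟨e, heS, heE, -, -⟩ := exists_end hS
    have haT : a ∈ T := hST ⟨c, hcS, (hc a).2 rfl⟩
    obtain ⟨e', -, -, -, he'⟩ := exists_end hT
    have huniq : ∀ a', A.rel h a' e → a' = a := fun a' ha' =>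
      (he' a' (hST ⟨e, heS, ha'⟩) (hA m n h ⟨e, heE, ha'⟩)).trans (he' a haT ha).symm
    refine ⟨⟨e, heE⟩, fun a' => ⟨fun h' => Subtype.ext (huniq a'.1 h'), ?_⟩⟩
    rintro rfl
    obtain ⟨a', ha'⟩ := A.coSurjective h e
    obtain rfl := huniq a' ha'
    exact ha'

theorem isSurjective_endSeq (hA : A.IsInX) : (A.endSeq hA).IsSurjective := fun h a => by
  obtain ⟨c, hc⟩ := (isInD_endSeq hA).2 _ _ h a
  exact ⟨c, (hc a).2 rfl⟩

theorem isClosedSubSpec_ends (hA : A.IsInX) :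
    A.IsClosedSubSpec (fun n => endSet (A.graph n)) (A.ends_isUpperRestriction hA) := by
  obtain ⟨f, hf, -⟩ := isClosedSubSpec_and_range (A.ends_isUpperRestriction hA) A.isSurjective
    (isSurjective_endSeq hA)
  exact ⟨f, hf⟩

/-- The end of a spoke is its deepest vertex, so no point of the branch can be deeper. -/
theorem Branch.not_before_of_level_subset_endSet {b : A.Branch} {x y : A.Spec}
    (hx : x ∈ b.points) (hy : y ∈ b.points) (hends : ∀ n, level x.1 n ⊆ endSet (A.graph n)) :
    ¬ Before x y := by
  intro h
  obtain ⟨N, hN⟩ := eventually_depth_lt hx hy h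
  obtain ⟨g, hg⟩ := level_nonempty A.isSurjective x N
  obtain ⟨k, hk⟩ := level_nonempty A.isSurjective y N
  obtain ⟨S, hS, hbS⟩ := b.exists_spoke_superset N
  obtain ⟨e, -, -, hmax, he⟩ := exists_end hS
  have h1 := hN N le_rfl g hg k hk
  have h2 := hmax k (hbS (hy N hk))
  rw [he g (hbS (hx N hg)) (hends N hg)] at h1
  omega

theorem subSpec_ends [ConnectedSpace A.Spec] [T2Space A.Spec] (hA : A.IsInX) :
    A.subSpec (fun n => endSet (A.graph n)) (A.ends_isUpperRestriction hA) =
      {x : A.Spec | IsEndpoint x} := by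
  ext x
  refine (mem_subSpec_iff (A.ends_isUpperRestriction hA) A.isSurjective
    (isSurjective_endSeq hA)).trans ⟨fun hends => ?_, fun hx => ?_⟩
  · have hxr : x ≠ A.rootPoint := by
      rintro rfl
      refine root_not_mem_endSet 0 (hends 0 ?_)
      rw [level_rootPoint]
      rfl
    obtain ⟨b, hb⟩ := exists_branch x
    exact Branch.isEndpoint_of_last hb
      (fun y hy => Branch.not_before_of_level_subset_endSet hb hy hends) hxr
  · have hxr : x ≠ A.rootPoint := fun h => not_isEndpoint_rootPoint (h ▸ hx)
    obtain ⟨b, hb⟩ := exists_branch x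
    obtain ⟨N, hN⟩ := eventually_ne_root hxr
    -- The ends of the spokes of the branch through `x` contain a point `y`. Nothing on the branch
    -- comes after `x` or after `y`, so they coincide.
    have hup : IsUpperFamily (A := A.toGraphSeq) fun n => b.S n ∩ endSet (A.graph n) :=
      fun {m n} h a c hr hc => ⟨b.isUpperFamily_S h hr hc.1, hA m n h ⟨c, hc.2, hr⟩⟩
    obtain ⟨y, hy⟩ := exists_spec_of_upperFamily A.isSurjective hup fun n => by
      obtain ⟨v, hv⟩ := level_nonempty A.isSurjective x (max n N)
      have hS := b.mem_spokes_of_mem (hb _ hv) (hN _ (le_max_right n N) v hv)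
      obtain ⟨e, he, heE, -, -⟩ := exists_end hS
      obtain ⟨a, ha⟩ := A.coSurjective (le_max_left n N) e
      exact ⟨a, hup (le_max_left n N) ha ⟨he, heE⟩⟩
    have hyb : y ∈ b.points := fun n => (hy n).trans inter_subset_left
    have hyE : ∀ n, level y.1 n ⊆ endSet (A.graph n) := fun n => (hy n).trans inter_subset_right
    have hxy : x = y := by
      by_contra hne
      rcases Branch.before_or_before hb hyb hne with h | h
      · exact Branch.not_before_of_isEndpoint hx hb hxr hyb h
      · exact Branch.not_before_of_level_subset_endSet hyb hb hyE h
    rw [hxy]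
    exact hyE

end LSeq

end FanSpectra

open FanSpectra
theorem mainTheorem7 (A : LSeq.{u}) [ConnectedSpace A.Spec] [T2Space A.Spec] :
    ∃ r : A.Spec, r.1 = A.rootThread ∧
      IsFanWithRoot A.Spec r ∧
      Set.BijOn (fun b : A.Branch => b.subSpec) {b | b.Nondegenerate} (spokesFrom r) ∧
      (∀ b : A.Branch, b.Nondegenerate →
        A.IsClosedSubSpec b.core b.core_isUpperRestriction ∧
        (∃! H, b.coreSeq.IsCoBijectiveModification H) ∧
        (∃! e, b.IsEndThread e) ∧
        ∀ e, b.IsEndThread e → ∃ x : A.Spec,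
          x.1 = A.upClosure (fun n => (e n).1) ∧ IsEndpoint x ∧ x ∈ b.subSpec ∧
          IsArcBetween b.subSpec r x) ∧
      ∀ hA : A.IsInX,
        (A.endSeq hA).IsInD ∧
        A.IsClosedSubSpec (fun n => endSet (A.graph n)) (A.ends_isUpperRestriction hA) ∧
        A.subSpec (fun n => endSet (A.graph n)) (A.ends_isUpperRestriction hA) =
          {x : A.Spec | IsEndpoint x} :=
  ⟨A.rootPoint, rfl, LSeq.isFanWithRoot_spec, LSeq.bijOn_subSpec,
    fun b hb => ⟨LSeq.Branch.isClosedSubSpec_core,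
      ⟨b.modification, b.isCoBijectiveModification_modification,
        fun _ hH => LSeq.Branch.eq_modification hH⟩,
      LSeq.Branch.existsUnique_isEndThread hb,
      fun _ he => LSeq.Branch.arc_of_isEndThread hb he⟩,
    fun hA => ⟨LSeq.isInD_endSeq hA, LSeq.isClosedSubSpec_ends hA, LSeq.subSpec_ends hA⟩⟩
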